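/- **Setting.** Write $B\big[{x\atop y}\big]=\frac{\Gamma(x)\Gamma(y-x)}{\Gamma(y)}$. Mellin variables on a finite set $L$ of legs with dimensions $\Delta_i$ are complex numbers $\delta_{ij}=\delta_{ji}$ with $\delta_{ii}=-\Delta_i$ and $\sum_{j\in L}\delta_{ij}=0$; the Mandelstam variable of $A\subseteq L$ is $s_A=\sum_{i\in A}\Delta_i-2\sum_{i<j\in A}\delta_{ij}$. Put $\Delta_A=\sum_{i\in A}\Delta_i$. A pre-amplitude on $L$ is a measurable function of these variables. All Mellin integrals are over straight vertical contours ($\frac{d\tau}{2\pi i}$ for each independent variable) on which the Gamma functions of the integration variables listed in the kernels have arguments of positive real part, and the pre-amplitudes integrated are assumed to grow at most polynomially along their contours. For a pre-amplitude $M$ on $A\sqcup\{a\}$ put $$I_a[M](\delta)=\int[d\tau]\,M[\tau]\prod_{i<j\in A}\frac{\Gamma(\tau_{ij})\Gamma(\delta_{ij}-\tau_{ij})}{\Gamma(\delta_{ij})},\qquad \mathrm{Re}\,\tau_{ij}<\mathrm{Re}\,\delta_{ij}.$$ Gluing leg $a$ (dimension $h\mp c$) of $M_1$ to leg $b$ (dimension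 $h\pm c$) of $M_2$ by a propagator with spectrum variable $c$ gives the pre-amplitude $I_a[M_1]\,I_b[M_2]$. Vertex insertion is the case in which $M_2$ is a contact diagram, whose pre-amplitude is $\Gamma(\frac{\sum_i\Delta_i}{2}-h)$. In (1) and (2) the inserted vertex carries the end of dimension $h+c$ of the new propagator. Let $K_2(c,D;s)=\Gamma(\tfrac{D-h\pm c}{2})\Gamma(\tfrac{h+c-s}{2})/\Gamma(\tfrac{D-s}{2})$, where $\Gamma(x\pm y)=\Gamma(x+y)\Gamma(x-y)$. Throughout, at each gluing of leg $a$ at least two other legs are present on its side (so that the Mellin variables exist). **(1) Insertion onto an end vertex.** Let $M_0'$ be any pre-amplitude (any loop order) on the points $A_{(1)}$ and one further leg; insert a vertex with boundary points $A_0$ through a propagator $(c_1,s_1)$, obtaining $M_0$, and then insert a vertex with boundary points $A_{-1}$ onto $A_0$ through a propagator $(c_0,s_0)$, obtaining $M$. Here $s_1=s_{A_{(1)}}$ and $s_0=s_{A_{(1)}\sqcup A_0}$. Let $D=\Delta_{A_0}+h-c_0$ and let $M_0[s]=K_2(c_1,D;s_1)\,I[M_0'](\delta)$. Then $M_0[s]$,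 at the Mellin variables of the first diagram, is the pre-amplitude $M_0$; and at the Mellin variables of the final diagram $$M[s]=M_0[s]\cdot\frac12\int\frac{dt}{2\pi i}\,\frac{K_2(c_1,D;t)}{K_2(c_1,D;s_1)}\,K_2(c_0,\Delta_{A_{-1}};s_0)\,B\Big[{\frac{\Delta_{A_0}-h+c_0+t}{2}\atop\frac{\Delta_{A_0}-s_0+s_1}{2}}\Big]B\Big[{\frac{h-c_1-t}{2}\atop\frac{h-c_1-s_1}{2}}\Big].$$ The integrals that define $M$ and the factor converge absolutely. The factor depends on the original diagram only through $\Delta_{A_0},c_1,s_1$. **(2) Several components.** Let $M_1,\dots,M_r$ be any pre-amplitudes, on points $A_{(a)}$ and one further leg of dimension $h-c_a$ each. Let a vertex $A_0$ with $r+|A_0|\ge2$ (not counting the leg used in the next step) glue them into a connected diagram with pre-amplitude $M_0=K'(t)\prod_aI[M_a]$, where $t_a$ is the Mandelstam variable of $A_{(a)}$, $D=\Delta_{A_0}+h-c_0$ and $$K'(t)=\int[dw]\,\Gamma\Big(\tfrac{D+(r-2)h+\sum_ac_a}{2}+\sum_aw_a\Big)\prod_{a=1}^r\frac{\Gamma(-w_a)\Gamma(-c_a-w_a)\Gamma(\frac{h+c_a-t_a}{2}+w_a)}{\Gamma(\frac{h-c_a-t_a}{2})},$$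 and insert a vertex $A_{-1}$ onto $A_0$ through a propagator $(c_0,s_0)$. Then, with absolutely convergent integrals, $$M=\prod_aI[M_a](\delta)\cdot X,\qquad X=\frac1{2^r}\int\prod_a\frac{dt_a}{2\pi i}\,K'(t)\,K_2(c_0,\Delta_{A_{-1}};s_0)\,B\Big[{\frac{\Delta_{A_0}-h+c_0+\sum_at_a}{2}\atop\frac{\Delta_{A_0}-s_0+\sum_as_a}{2}}\Big]\prod_aB\Big[{\frac{h-c_a-t_a}{2}\atop\frac{h-c_a-s_a}{2}}\Big],$$ so that $M=M_0[s]\cdot X/K'(s)$ whenever $K'(s)\ne0$: only the contribution of $A_0$ is modified. **(3) Factorization.** Let $G$ be a connected scalar diagram with any number of loops (a multigraph of bulk vertices and propagators, with boundary points). Call a propagator a tree propagator if cutting it disconnects its two ends; the 1PI parts are the components left after all tree propagators are cut. In a 1PI part on its own, a tree propagator $e$ at it is replaced by a leg of dimension $h-c_e$ at one end of $e$ and $h+c_e$ at the other. A single-vertex part has the contact pre-amplitude; a part with loops has an arbitrary pre-amplitude on its own legs. Let $M$ be a pre-amplitude of $G$ obtained by gluing the 1PI parts along the tree propagators, where $G$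 is built from some root part by repeatedly attaching to it, in any order, subdiagrams built in the same way and having no other open tree propagator. For a leg $l$ of a part $P$ let $A_l$ be the set of boundary points seen through $l$, and let the local variables of $P$ be $x_{ll'}=\sum_{i\in A_l,\,j\in A_{l'}}\delta_{ij}$; thus $x_{ll}=-s_{A_l}$. Then $$M[\delta]=\prod_{e\ \text{tree}}\Gamma\Big(\frac{h+c_e-s_e}{2}\Big)\Gamma\Big(\frac{h-c_e-s_e}{2}\Big)\prod_{P\ \text{1PI}}F_P(x^P),\qquad F_P(x)=\frac{H_P(x)}{\prod_{l}\Gamma\big(\frac{\Delta_l+x_{ll}}{2}\big)},$$ where $l$ runs over the tree legs of $P$, $\Delta_l=h\pm c_l$, and $H_P$ is obtained from the pre-amplitude of $P$ alone by dressing its tree legs one after another. Dressing leg $a$, when the legs in $Y$ have been dressed before, is the absolutely convergent integral $$H\mapsto\int[d\tau]\,H[\tau]\prod_{i<j;\ i,j\ne a}B\Big[{\tau_{ij}\atop x_{ij}}\Big]\prod_{b\in Y}B\Big[{\frac{2h-\Delta_b+\tau_{bb}}{2}\atop\frac{2h-\Delta_b+x_{bb}}{2}}\Big]$$ over the local variables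 $\tau$ of $P$ with $\sum_j\tau_{ij}=0$ and $\tau_{ii}=-\Delta_i$ for $i\notin Y$ (for $b\in Y$ the variable $\tau_{bb}/2$ is integrated as well). Hence $F_P$ depends only on data local to $P$. -/

import Mathlib

noncomputable section

namespace Witten

/-! ### Mellin variables

A set of Mellin variables on a finite set `L` of legs is a function `δ` on unordered pairs of
labels; the diagonal entry `δ s(i, i)` stands for minus the conformal dimension of leg `i`. -/

/-- The Beta function `B[x; y] = Γ(x) Γ(y - x) / Γ(y)`. -/
def bfn (x y : ℂ) : ℂ := Complex.Gamma x * Complex.Gamma (y - x) / Complex.Gamma y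

/-- The pairs `i < j` of labels in `A`. -/
def pairs {Λ : Type} [DecidableEq Λ] (A : Finset Λ) : Finset (Sym2 Λ) :=
  A.sym2.filter fun q => ¬ q.IsDiag

/-- The canonical constraints `δ_ij = δ_ji`, `δ_ii = -Δ_i`, `∑_j δ_ij = 0` on the legs `L`.
For the legs in `X` (the off-shell legs) the value of `δ_ii` is left free. -/
structure IsMellin {Λ : Type} (L X : Finset Λ) (Δ : Λ → ℂ) (δ : Sym2 Λ → ℂ) : Prop where
  row : ∀ i ∈ L, ∑ j ∈ L, δ s(i, j) = 0
  diag : ∀ i ∈ L, i ∉ X → δ s(i, i) = -Δ i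

/-- The Mandelstam variable `s_A = ∑_{i ∈ A} Δ_i - 2 ∑_{i < j ∈ A} δ_ij`, with `Δ_i = -δ_ii`. -/
def mandelstam {Λ : Type} [DecidableEq Λ] (A : Finset Λ) (δ : Sym2 Λ → ℂ) : ℂ :=
  ∑ i ∈ A, -δ s(i, i) - 2 * ∑ q ∈ pairs A, δ q

/-- `Re τ_q < Re δ_q` for all `q ∈ P`. -/
def Below {Λ : Type} (P : Finset (Sym2 Λ)) (τ δ : Sym2 Λ → ℂ) : Prop :=
  ∀ q ∈ P, (τ q).re < (δ q).re

/-- `M` is a (measurable) function of the Mellin variables on the legs `L` only. -/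
structure IsMellinFunction {Λ : Type} (L : Finset Λ) (M : (Sym2 Λ → ℂ) → ℂ) : Prop where
  measurable : Measurable M
  depends : ∀ τ τ' : Sym2 Λ → ℂ, (∀ q ∈ L.sym2, τ q = τ' q) → M τ = M τ'

/-- Polynomial growth of `M` along the vertical contour with real parts `ρ`. -/
def PolyGrowth {Λ : Type} (L : Finset Λ) (Δ : Λ → ℂ) (M : (Sym2 Λ → ℂ) → ℂ)
    (ρ : Sym2 Λ → ℝ) : Prop :=
  ∃ (C : ℝ) (N : ℕ), ∀ τ : Sym2 Λ → ℂ, IsMellin L ∅ Δ τ → (∀ q ∈ L.sym2, (τ q).re = ρ q) →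
    ‖M τ‖ ≤ C * (1 + ∑ q ∈ L.sym2, |(τ q).im|) ^ N

/-! ### Mellin integrals against the Beta kernel -/

/-- The independent integration variables when leg `a` of `L` is glued: the Mellin variables of
the other legs, and one variable for every off-shell leg.  They obey a single linear constraint,
which is solved for the variable `q₀`. -/
def indexSet {Λ : Type} [DecidableEq Λ] (L X : Finset Λ) (a : Λ) : Finset (Sym2 Λ) :=
  pairs (L.erase a) ∪ X.image fun b => s(b, b)

/-- Increments of the integration variables: free for the indices other than `q₀`, with sum zero. -/
def increment {Λ : Type} [DecidableEq Λ] (Q : Finset (Sym2 Λ)) (q₀ : Sym2 Λ)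
    (y : {q // q ∈ Q.erase q₀} → ℝ) (q : Sym2 Λ) : ℝ :=
  if hq : q ∈ Q.erase q₀ then y ⟨q, hq⟩ else if q = q₀ then -∑ p, y p else 0

/-- The induced increments of the matrix entries between legs other than `a`.  The variable of an
off-shell leg `b` is `δ_bb / 2`, that is, minus one half of its Mandelstam variable. -/
def innerIncrement {Λ : Type} [DecidableEq Λ] (Q : Finset (Sym2 Λ)) (q₀ : Sym2 Λ)
    (y : {q // q ∈ Q.erase q₀} → ℝ) (q : Sym2 Λ) : ℝ :=
  if q.IsDiag then 2 * increment Q q₀ y q else increment Q q₀ y q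

/-- The point with parameter `y` on the vertical contour through `τ`.  The entries that involve
leg `a` are solved from the constraints `∑_j τ_ij = 0`. -/
def contourPoint {Λ : Type} [DecidableEq Λ] (L X : Finset Λ) (a : Λ) (τ : Sym2 Λ → ℂ)
    (q₀ : Sym2 Λ) (y : {q // q ∈ (indexSet L X a).erase q₀} → ℝ) (q : Sym2 Λ) : ℂ :=
  τ q + Complex.I *
    ((if a ∈ q then
        -∑ i ∈ (L.erase a).filter (fun i => i ∈ q), ∑ j ∈ L.erase a,
          innerIncrement (indexSet L X a) q₀ y s(i, j)
      else innerIncrement (indexSet L X a) q₀ y q : ℝ) : ℂ)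

/-- The integrand `M[τ] ∏_{i<j} B[τ_ij; δ_ij]` of the gluing integral for leg `a`, where the
product is over the pairs of legs other than `a`.  An off-shell leg `b`, whose propagator has the
dimension `Δ' b` at its far end, contributes `B[(Δ' b - t_b)/2; (Δ' b - s_b)/2]` with
`t_b = -τ_bb` and `s_b = -δ_bb`. -/
def glueIntegrand {Λ : Type} [DecidableEq Λ] (Δ' : Λ → ℂ) (L X : Finset Λ) (a : Λ)
    (τ : Sym2 Λ → ℂ) (q₀ : Sym2 Λ) (M : (Sym2 Λ → ℂ) → ℂ) (δ : Sym2 Λ → ℂ)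
    (y : {q // q ∈ (indexSet L X a).erase q₀} → ℝ) : ℂ :=
  M (contourPoint L X a τ q₀ y) *
    (∏ q ∈ pairs (L.erase a), bfn (contourPoint L X a τ q₀ y q) (δ q)) *
    ∏ b ∈ X, bfn ((Δ' b + contourPoint L X a τ q₀ y s(b, b)) / 2) ((Δ' b + δ s(b, b)) / 2)

/-- The gluing integral `∫ [dτ] M[τ] ∏ B[τ_ij; δ_ij]`, with measure `dτ / (2πi)` for each
independent variable. -/
def glueIntegral {Λ : Type} [DecidableEq Λ] (Δ' : Λ → ℂ) (L X : Finset Λ) (a : Λ)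
    (τ : Sym2 Λ → ℂ) (q₀ : Sym2 Λ) (M : (Sym2 Λ → ℂ) → ℂ) (δ : Sym2 Λ → ℂ) : ℂ :=
  (∫ y, glueIntegrand Δ' L X a τ q₀ M δ y) /
    (2 * (Real.pi : ℂ)) ^ ((indexSet L X a).erase q₀).card

/-- The vertical contour through `τ` is admissible for gluing leg `a`: on it the constraints hold
and the Gamma functions of the integration variables have arguments of positive real part. -/
structure IsContour {Λ : Type} [DecidableEq Λ] (Δ Δ' : Λ → ℂ) (L X : Finset Λ) (a : Λ)
    (τ : Sym2 Λ → ℂ) (q₀ : Sym2 Λ) : Prop where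
  mellin : IsMellin L X Δ τ
  pos : ∀ q ∈ pairs (L.erase a), 0 < (τ q).re
  pos_off : ∀ b ∈ X, 0 < (Δ' b + τ s(b, b)).re
  mem : q₀ ∈ pairs (L.erase a)

/-- The pre-amplitude of a contact diagram with legs `L`. -/
def contact {Λ : Type} (h : ℂ) (Δ : Λ → ℂ) (L : Finset Λ) : (Sym2 Λ → ℂ) → ℂ :=
  fun _ => Complex.Gamma ((∑ i ∈ L, Δ i) / 2 - h)

/-- Gluing two diagrams, with pre-amplitudes `M₁` on `L₁` and `M₂` on `L₂`, into one by a new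
propagator between leg `a₁` and leg `a₂`. -/
def glue {Λ : Type} [DecidableEq Λ]
    (L₁ : Finset Λ) (a₁ : Λ) (τ₁ : Sym2 Λ → ℂ) (q₁ : Sym2 Λ) (M₁ : (Sym2 Λ → ℂ) → ℂ)
    (L₂ : Finset Λ) (a₂ : Λ) (τ₂ : Sym2 Λ → ℂ) (q₂ : Sym2 Λ) (M₂ : (Sym2 Λ → ℂ) → ℂ)
    (δ : Sym2 Λ → ℂ) : ℂ :=
  glueIntegral 0 L₁ ∅ a₁ τ₁ q₁ M₁ δ * glueIntegral 0 L₂ ∅ a₂ τ₂ q₂ M₂ δ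

/-- Vertex insertion: gluing leg `a` of a diagram to leg `b` of a contact diagram `L'`. -/
def insertVertex {Λ : Type} [DecidableEq Λ] (h : ℂ) (Δ : Λ → ℂ)
    (L : Finset Λ) (a : Λ) (τ : Sym2 Λ → ℂ) (q : Sym2 Λ) (M : (Sym2 Λ → ℂ) → ℂ)
    (L' : Finset Λ) (b : Λ) (ν : Sym2 Λ → ℂ) (p : Sym2 Λ) : (Sym2 Λ → ℂ) → ℂ :=
  glue L a τ q M L' b ν p (contact h Δ L')

/-- The factor `K₂[s]` of a vertex whose boundary points have total dimension `D`, inserted through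
a propagator with spectrum variable `c`. -/
def kernelTwo (h c D s : ℂ) : ℂ :=
  Complex.Gamma ((D - h + c) / 2) * Complex.Gamma ((D - h - c) / 2) *
    Complex.Gamma ((h + c - s) / 2) / Complex.Gamma ((D - s) / 2)

/-- The integrand over `t` of the local factor produced by inserting a vertex (total dimension
`D'`, propagator `c₀`, `s₀`) onto an end vertex (total dimension `D₀`, propagator `c₁`, `s₁`). -/
def localIntegrand (h c₀ c₁ D₀ D' s₀ s₁ t : ℂ) : ℂ :=
  kernelTwo h c₁ (D₀ + (h - c₀)) t / kernelTwo h c₁ (D₀ + (h - c₀)) s₁ *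
    kernelTwo h c₀ D' s₀ *
    bfn ((D₀ - h + c₀ + t) / 2) ((D₀ - s₀ + s₁) / 2) *
    bfn ((h - c₁ - t) / 2) ((h - c₁ - s₁) / 2)

/-- The local factor `(1/2) ∫ dt/(2πi) …`, over the vertical line with real part `θ`. -/
def localFactor (h c₀ c₁ D₀ D' s₀ s₁ : ℂ) (θ : ℝ) : ℂ :=
  1 / 2 * ((∫ y : ℝ, localIntegrand h c₀ c₁ D₀ D' s₀ s₁ (θ + y * Complex.I)) /
    (2 * (Real.pi : ℂ)))

/-- The integrand over `w` of the kernel of a vertex that glues the components `κ`. -/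
def forestIntegrand {κ : Type} [Fintype κ] (h : ℂ) (c : κ → ℂ) (D : ℂ) (t w : κ → ℂ) : ℂ :=
  Complex.Gamma ((D + ((Fintype.card κ : ℂ) - 2) * h + ∑ a, c a) / 2 + ∑ a, w a) *
    ∏ a, Complex.Gamma (-w a) * Complex.Gamma (-c a - w a) *
      Complex.Gamma ((h + c a - t a) / 2 + w a) / Complex.Gamma ((h - c a - t a) / 2)

/-- The kernel, as a function of the Mandelstam variables `t`, of a vertex of total boundary
dimension `D` that glues the components `κ` through propagators with spectrum variables `c`. -/
def forestKernel {κ : Type} [Fintype κ] (h : ℂ) (c : κ → ℂ) (D : ℂ) (ω : κ → ℝ) (t : κ → ℂ) : ℂ :=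
  (∫ y : κ → ℝ, forestIntegrand h c D t fun a => ω a + y a * Complex.I) /
    (2 * (Real.pi : ℂ)) ^ Fintype.card κ

/-- Generalized vertex insertion: the pre-amplitude of the connected diagram obtained from the
components `M a`, with legs `insert (k a) (A a)`, by joining the legs `k a` to one new vertex of
total boundary dimension `D`. -/
def forestGlue {Λ κ : Type} [DecidableEq Λ] [Fintype κ] (h : ℂ) (c : κ → ℂ) (D : ℂ) (ω : κ → ℝ)
    (A : κ → Finset Λ) (k : κ → Λ) (σ : κ → Sym2 Λ → ℂ) (q : κ → Sym2 Λ)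
    (M : κ → (Sym2 Λ → ℂ) → ℂ) (δ : Sym2 Λ → ℂ) : ℂ :=
  forestKernel h c D ω (fun a => mandelstam (A a) δ) *
    ∏ a, glueIntegral 0 (insert (k a) (A a)) ∅ (k a) (σ a) (q a) (M a) δ

/-- The integrand over the `t a` of the factor of the vertex `A₀` (total boundary dimension `D₀`,
gluing the components `κ`) after insertion of a vertex onto it. -/
def forestLocalIntegrand {κ : Type} [Fintype κ] (h c₀ : ℂ) (c : κ → ℂ) (D₀ D' s₀ : ℂ) (ω : κ → ℝ)
    (s t : κ → ℂ) : ℂ :=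
  forestKernel h c (D₀ + (h - c₀)) ω t * kernelTwo h c₀ D' s₀ *
    bfn ((D₀ - h + c₀ + ∑ a, t a) / 2) ((D₀ - s₀ + ∑ a, s a) / 2) *
    ∏ a, bfn ((h - c a - t a) / 2) ((h - c a - s a) / 2)

/-- The factor that replaces the kernel of the vertex `A₀` after insertion of a vertex onto it. -/
def forestLocalFactor {κ : Type} [Fintype κ] (h c₀ : ℂ) (c : κ → ℂ) (D₀ D' s₀ : ℂ) (ω : κ → ℝ)
    (s : κ → ℂ) (θ : κ → ℝ) : ℂ :=
  (1 / 2) ^ Fintype.card κ *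
    ((∫ y : κ → ℝ, forestLocalIntegrand h c₀ c D₀ D' s₀ ω s fun a => θ a + y a * Complex.I) /
      (2 * (Real.pi : ℂ)) ^ Fintype.card κ)

/-! ### Scalar diagrams, tree propagators and one-particle irreducible parts -/

/-- A scalar diagram of any loop order: a multigraph with bulk vertices `V`, bulk-to-bulk
propagators `E` (self-loops and multiple edges allowed) and boundary points `ι`, together with
`h` (half the boundary dimension), the spectrum variables and the conformal dimensions. -/
structure ScalarDiagram (V E ι : Type) where
  src : E → V
  tgt : E → V
  att : ι → V
  h : ℂ
  c : E → ℂ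
  dim : ι → ℂ

namespace ScalarDiagram

variable {V E ι : Type} (G : ScalarDiagram V E ι)

/-- Two vertices are joined by a path of propagators that satisfy `P`. -/
def Joined (P : E → Prop) : V → V → Prop :=
  Relation.EqvGen fun v w => ∃ e, P e ∧ G.src e = v ∧ G.tgt e = w

def Connected : Prop := Nonempty V ∧ ∀ v w, G.Joined (fun _ => True) v w

/-- A tree propagator: cutting it separates its two ends. -/
def IsTree (e : E) : Prop := ¬ G.Joined (fun e' => e' ≠ e) (G.src e) (G.tgt e)

/-- Two vertices are in the same 1PI part if they are joined by propagators none of which is a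
tree propagator. -/
def partSetoid : Setoid V where
  r := G.Joined fun e => ¬ G.IsTree e
  iseqv := Relation.EqvGen.is_equivalence _

/-- The one-particle irreducible parts: what remains connected after all tree propagators have
been cut.  A part without internal propagators is a single bulk vertex. -/
def Part : Type := Quotient G.partSetoid

def partOf (v : V) : G.Part := Quotient.mk G.partSetoid v

instance [Finite V] : Finite G.Part := inferInstanceAs (Finite (Quotient G.partSetoid))

instance [Fintype V] : Fintype G.Part := Fintype.ofFinite _

instance : DecidableEq G.Part := Classical.decEq _

/-- Labels: boundary points, and the two ends of every propagator (`false` at `src`, `true` at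
`tgt`). -/
abbrev Label (_ : ScalarDiagram V E ι) : Type := ι ⊕ (E × Bool)

/-- The vertex at which a label sits. -/
def base : G.Label → V
  | .inl i => G.att i
  | .inr (e, false) => G.src e
  | .inr (e, true) => G.tgt e

/-- The conformal dimension at a label; the two ends of a propagator carry `h - c` and `h + c`. -/
def labelDim : G.Label → ℂ
  | .inl i => G.dim i
  | .inr (e, false) => G.h - G.c e
  | .inr (e, true) => G.h + G.c e

/-- The dimension at the other end of a propagator. -/
def farDim (l : G.Label) : ℂ := 2 * G.h - G.labelDim l

open Classical in
/-- The legs of the subdiagram made of the parts in `S`: the boundary points attached to it, and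
the ends of the tree propagators that leave it. -/
def legs [Fintype V] [Fintype E] [Fintype ι] (S : Finset G.Part) : Finset G.Label :=
  Finset.univ.filter fun l => G.partOf (G.base l) ∈ S ∧
    match l with
    | .inl _ => True
    | .inr (e, b) => G.IsTree e ∧ G.partOf (G.base (.inr (e, !b))) ∉ S

open Classical in
/-- The legs of a part that are ends of tree propagators. -/
def treeLegs [Fintype V] [Fintype E] [Fintype ι] (B : G.Part) : Finset G.Label :=
  (G.legs {B}).filter fun l => l.isRight

open Classical in
/-- The legs of the whole diagram. -/
def boundary [Fintype E] [Fintype ι] : Finset G.Label :=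
  Finset.univ.filter fun l => l.isLeft

open Classical in
/-- The boundary points seen through a leg `l` of a part: the point itself, or all the points on
the far side of the tree propagator. -/
def branch [Fintype E] [Fintype ι] : G.Label → Finset G.Label
  | .inl i => {.inl i}
  | .inr (e, b) => G.boundary.filter fun k =>
      ¬ G.Joined (fun e' => e' ≠ e) (G.base (.inr (e, b))) (G.base k)

/-- The local Mellin variables: for legs `l`, `l'` of a part, the sum of `δ_ij` over the boundary
points `i` seen through `l` and `j` seen through `l'`.  For a tree leg `l` the diagonal entry is
minus the Mandelstam variable of its propagator. -/
def localVars [Fintype E] [Fintype ι] (δ : Sym2 G.Label → ℂ) : Sym2 G.Label → ℂ :=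
  Sym2.lift ⟨fun l l' => ∑ i ∈ G.branch l, ∑ j ∈ G.branch l', δ s(i, j), by
    intro l l'
    show ∑ i ∈ G.branch l, ∑ j ∈ G.branch l', δ s(i, j) =
      ∑ i ∈ G.branch l', ∑ j ∈ G.branch l, δ s(i, j)
    rw [Finset.sum_comm]
    exact Finset.sum_congr rfl fun i _ => Finset.sum_congr rfl fun j _ => by rw [Sym2.eq_swap]⟩

open Classical in
/-- The pre-amplitude of a 1PI part on its own, with the tree propagators at it replaced by legs
of dimension `h ± c`: the contact pre-amplitude for a single vertex, and the given function
`loop B` for a part with loops. -/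
def partAmp [Fintype V] [Fintype E] [Fintype ι] (loop : G.Part → (Sym2 G.Label → ℂ) → ℂ)
    (B : G.Part) : (Sym2 G.Label → ℂ) → ℂ :=
  if ∃ e, ¬ G.IsTree e ∧ G.partOf (G.src e) = B then loop B
  else contact G.h G.labelDim (G.legs {B})

/-- `G.PreAmp loop B S R M`: the function `M`, on the domain of points whose real parts lie in
`R`, is the pre-amplitude of the subdiagram made of the parts in `S`, built by starting from the
part `B` and repeatedly gluing to `B` a subdiagram (built in the same manner) which is
complete, i.e. has no open tree propagator other than the one used for gluing. -/
inductive PreAmp [Fintype V] [Fintype E] [Fintype ι] [DecidableEq E] [DecidableEq ι]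
    (loop : G.Part → (Sym2 G.Label → ℂ) → ℂ) :
    G.Part → Finset G.Part → Set (Sym2 G.Label → ℝ) → ((Sym2 G.Label → ℂ) → ℂ) → Prop
  | part (B : G.Part) :
      PreAmp loop B {B} {ρ | PolyGrowth (G.legs {B}) G.labelDim (G.partAmp loop B) ρ}
        (G.partAmp loop B)
  | glue {B B' : G.Part} {S S' : Finset G.Part} {R R' : Set (Sym2 G.Label → ℝ)}
      {M M' : (Sym2 G.Label → ℂ) → ℂ} (e : E) (b : Bool) (τ τ' : Sym2 G.Label → ℂ)
      (q q' : Sym2 G.Label) :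
      PreAmp loop B S R M → PreAmp loop B' S' R' M' → Disjoint S S' → G.IsTree e →
      G.partOf (G.base (.inr (e, b))) = B → G.partOf (G.base (.inr (e, !b))) = B' →
      (∀ l ∈ G.legs S', l.isRight → l = .inr (e, !b)) →
      IsContour G.labelDim G.farDim (G.legs S) ∅ (.inr (e, b)) τ q →
      IsContour G.labelDim G.farDim (G.legs S') ∅ (.inr (e, !b)) τ' q' →
      (fun p => (τ p).re) ∈ R → (fun p => (τ' p).re) ∈ R' →
      PreAmp loop B (S ∪ S')
        {ρ | (∀ p ∈ pairs ((G.legs S).erase (.inr (e, b))), (τ p).re < ρ p) ∧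
          ∀ p ∈ pairs ((G.legs S').erase (.inr (e, !b))), (τ' p).re < ρ p}
        (Witten.glue (G.legs S) (.inr (e, b)) τ q M (G.legs S') (.inr (e, !b)) τ' q' M')

/-- `G.Dressed loop B X R H`: the function `H` of the local Mellin variables of the part `B`, on
the domain of points whose real parts lie in `R`, arises from the pre-amplitude of `B` alone by
taking its tree legs in `X` off shell one after another, by (absolutely convergent) Mellin
integrals over the local variables of `B`.  Nothing outside `B` enters. -/
inductive Dressed [Fintype V] [Fintype E] [Fintype ι] [DecidableEq E] [DecidableEq ι]
    (loop : G.Part → (Sym2 G.Label → ℂ) → ℂ) (B : G.Part) :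
    Finset G.Label → Set (Sym2 G.Label → ℝ) → ((Sym2 G.Label → ℂ) → ℂ) → Prop
  | bare :
      Dressed loop B ∅ {ρ | PolyGrowth (G.legs {B}) G.labelDim (G.partAmp loop B) ρ}
        (G.partAmp loop B)
  | dress {X : Finset G.Label} {R : Set (Sym2 G.Label → ℝ)} {H : (Sym2 G.Label → ℂ) → ℂ}
      (a : G.Label) (τ : Sym2 G.Label → ℂ) (q : Sym2 G.Label) :
      Dressed loop B X R H → a ∈ G.treeLegs B → a ∉ X →
      IsContour G.labelDim G.farDim (G.legs {B}) X a τ q → (fun p => (τ p).re) ∈ R →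
      (∀ δ, IsMellin (G.legs {B}) (insert a X) G.labelDim δ →
        Below (indexSet (G.legs {B}) X a) τ δ →
        MeasureTheory.Integrable (glueIntegrand G.farDim (G.legs {B}) X a τ q H δ)) →
      Dressed loop B (insert a X)
        {ρ | ∀ p ∈ indexSet (G.legs {B}) X a, (τ p).re < ρ p}
        (glueIntegral G.farDim (G.legs {B}) X a τ q H)

open Classical in
/-- The tree propagators of the diagram. -/
def treeEdges [Fintype E] : Finset E := Finset.univ.filter fun e => G.IsTree e

/-- The factor `Γ[(h ± c_e - s_e)/2]` of a tree propagator, `s_e` being the Mandelstam variable of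
the boundary points on one side of it. -/
def propagatorFactor [Fintype E] [Fintype ι] [DecidableEq E] [DecidableEq ι]
    (δ : Sym2 G.Label → ℂ) (e : E) : ℂ :=
  Complex.Gamma ((G.h + G.c e - mandelstam (G.branch (.inr (e, false))) δ) / 2) *
    Complex.Gamma ((G.h - G.c e - mandelstam (G.branch (.inr (e, false))) δ) / 2)

/-- The factor of a 1PI part as a function of its local variables `x`: the dressed pre-amplitude,
with the propagator Gamma functions `Γ[(h ± c_l - s_l)/2]` of its tree legs stripped off. -/
def partFactor [Fintype V] [Fintype E] [Fintype ι] (B : G.Part) (H : (Sym2 G.Label → ℂ) → ℂ)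
    (x : Sym2 G.Label → ℂ) : ℂ :=
  H x / ∏ l ∈ G.treeLegs B, Complex.Gamma ((G.labelDim l + x s(l, l)) / 2)

end ScalarDiagram

end Witten

end

/-!
A gluing integral pairs a pre-amplitude with the kernel `∏ B[τ_ij; δ_ij]` over a vertical contour.
In imaginary directions such a contour is a hyperplane `∑ w_q = 0`: the variables `τ_ij` between the
legs that are not glued have a fixed sum, because the glued leg has a fixed dimension
(`glueIntegral_eq`).  Everything rests on three properties of the Beta function.

* From `x B[x; y] = y B[x + 1; y + 1]` it decays faster than any power of `Im x` on vertical lines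
  (`exists_norm_bfn_le_pow`).  Hence all gluing integrals of pre-amplitudes of polynomial growth
  converge absolutely, and grow at most polynomially themselves (`exists_norm_lineIntegrand_le`,
  `exists_norm_glueIntegral_le`).
* By Mellin inversion it satisfies the convolution form of Barnes' first lemma
  (`integral_bfn_mul_bfn`).  Iterated, this says that the integral of `∏ B[z_q; b_q]` over a
  hyperplane `∑ z_q = const` is the single Beta function `B[∑ z_q; ∑ b_q]`, up to a power of `2π`
  (`integral_hyperVolume_prod_bfn`).
* `B[σ; τ] B[τ; δ] = B[σ; δ] B[τ - σ; δ - σ]` (`bfn_mul_bfn`).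

By the last two, a gluing integral `I[M](τ)`, integrated once more against `∏ B[τ_q; δ_q]` with the sum
of the `τ_q` held fixed, gives back `I[M](δ)` times one Beta function of that sum
(`reproduces_glueIntegral`).  So if the variables of an outer gluing integral are divided into
blocks, on each of which the integrand is either constant or such an inner gluing integral, then only
the sums over the blocks remain to be integrated (`integral_hyperVolume_collapse`,
`integral_of_reproduces`).

Vertex insertion.  The blocks are the pairs of legs inside a component `A_a`, whose sum is a function
of the Mandelstam variable `t_a`, and one block with all other pairs, whose sum is then determined by
the `t_a`.  This leaves the integral over the `t_a` (`glueIntegral_components`); a contact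
pre-amplitude, being constant, is one block and gives `K₂` (`glueIntegral_contact`).

Factorization.  When a tree propagator at a part `P` is glued, the legs of the composite diagram fall
into the sets seen through the legs of `P`.  The pairs inside the set behind an already glued leg `b`
form a block that reproduces the subdiagram behind `b`, the pairs between two such sets form blocks
with constant factor, and the integral over the block sums is the dressing integral of `P` alone, in
its local variables (`Blocks.glueIntegral_eq`).  Induction over the construction of the diagram
expands its pre-amplitude into dressed parts (`Expansion.dress`, `Expansion.glue`,
`PreAmp.exists_expansion`).  The Gamma functions of the propagators cancel against those in the
denominators of the `F_P`, one for each end of a tree propagator (`prod_propagatorFactor`); their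
arguments have positive real part (`Dressed.re_pos`), so that no pole, where `Complex.Gamma` takes the
value zero, interferes.
-/

namespace Witten

open MeasureTheory

/-! ### The Beta function on vertical lines -/

theorem measurable_Gamma : Measurable Complex.Gamma := by
  have : Complex.Gamma = fun s => ((Complex.Gamma s)⁻¹)⁻¹ := by
    funext s; simp
  rw [this]
  exact Complex.differentiable_one_div_Gamma.continuous.measurable.inv

theorem _root_.Measurable.bfn {X : Type*} [MeasurableSpace X] {f g : X → ℂ} (hf : Measurable f)
    (hg : Measurable g) : Measurable fun x => bfn (f x) (g x) :=
  ((measurable_Gamma.comp hf).mul (measurable_Gamma.comp (hg.sub hf))).div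
    (measurable_Gamma.comp hg)

theorem ne_zero_of_re_pos {z : ℂ} (h : 0 < z.re) : z ≠ 0 := by
  rintro rfl; simp at h

theorem bfn_eq_betaIntegral {x y : ℂ} (hx : 0 < x.re) (hxy : x.re < y.re) :
    bfn x y = Complex.betaIntegral x (y - x) := by
  rw [Complex.betaIntegral_eq_Gamma_mul_div x (y - x) hx (by simpa using hxy), add_sub_cancel, bfn]

/-- On the strip `0 < Re x < Re y`, the Beta function is bounded by its value at the real parts. -/
theorem exists_norm_bfn_le {a b : ℝ} (ha : 0 < a) (hab : a < b) :
    ∃ C : ℝ, ∀ x y : ℂ, x.re = a → y.re = b → ‖bfn x y‖ ≤ C := by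
  refine ⟨∫ t in (0 : ℝ)..1, t ^ (a - 1) * (1 - t) ^ (b - a - 1), fun x y hx hy => ?_⟩
  rw [bfn_eq_betaIntegral (hx ▸ ha) (by rwa [hx, hy]), Complex.betaIntegral]
  refine (intervalIntegral.norm_integral_le_integral_norm zero_le_one).trans (le_of_eq ?_)
  refine intervalIntegral.integral_congr_ae ?_
  have h1 : ∀ᵐ t : ℝ, t ≠ 1 := by simp [ae_iff, measure_singleton]
  filter_upwards [h1] with t ht1 ht
  rw [Set.uIoc_of_le zero_le_one] at ht
  have h2 : 0 < 1 - t := by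
    have := lt_of_le_of_ne ht.2 ht1
    linarith
  have h3 : (1 - (t : ℂ)) = ((1 - t : ℝ) : ℂ) := by push_cast; ring
  rw [norm_mul, Complex.norm_cpow_eq_rpow_re_of_pos ht.1, h3,
    Complex.norm_cpow_eq_rpow_re_of_pos h2]
  simp [hx, hy]

/-- The functional equations of `Γ` turn a bound for the Beta function into rapid decay. -/
theorem mul_bfn {x y : ℂ} (hx : x ≠ 0) (hy : y ≠ 0) :
    x * bfn x y = y * bfn (x + 1) (y + 1) := by
  simp only [bfn, Complex.Gamma_add_one x hx, Complex.Gamma_add_one y hy, add_sub_add_right_eq_sub]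
  by_cases h : Complex.Gamma y = 0
  · simp [h]
  · field_simp

/-- Rapid decay of the Beta function in the imaginary part of its first argument. -/
theorem exists_norm_bfn_le_pow (n : ℕ) : ∀ {a b : ℝ}, 0 < a → a < b →
    ∃ C : ℝ, 0 ≤ C ∧ ∀ x y : ℂ, x.re = a → y.re = b →
      ‖bfn x y‖ ≤ C * (1 + |y.im|) ^ n / (1 + |x.im|) ^ n := by
  induction n with
  | zero =>
    intro a b ha hab
    obtain ⟨C, hC⟩ := exists_norm_bfn_le ha hab
    exact ⟨|C|, abs_nonneg C, fun x y hx hy => by simpa using (hC x y hx hy).trans (le_abs_self C)⟩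
  | succ n ih =>
    intro a b ha hab
    obtain ⟨C, hC0, hC⟩ := ih (a := a + 1) (b := b + 1) (by linarith) (by linarith)
    have hb : 0 < b := ha.trans hab
    refine ⟨C * ((1 / a + 1) * (b + 1)), by positivity, fun x y hx hy => ?_⟩
    have hx0 : x ≠ 0 := ne_zero_of_re_pos (hx ▸ ha)
    have hy0 : y ≠ 0 := ne_zero_of_re_pos (hy ▸ hb)
    have key := congrArg norm (mul_bfn hx0 hy0)
    rw [norm_mul, norm_mul] at key
    have h1 := hC (x + 1) (y + 1) (by simp [hx]) (by simp [hy])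
    have h2 : 1 + |x.im| ≤ (1 / a + 1) * ‖x‖ := by
      have h3 : a ≤ ‖x‖ := by
        have := Complex.abs_re_le_norm x
        rw [hx, abs_of_pos ha] at this
        exact this
      have h4 := Complex.abs_im_le_norm x
      have h5 : 1 ≤ 1 / a * ‖x‖ := by rw [one_div, inv_mul_eq_div, le_div_iff₀ ha]; linarith
      linarith
    have h6 : ‖y‖ ≤ (b + 1) * (1 + |y.im|) := by
      have := Complex.norm_le_abs_re_add_abs_im y
      rw [hy, abs_of_pos hb] at this
      nlinarith [abs_nonneg y.im]
    simp only [Complex.add_im, Complex.one_im, add_zero] at h1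
    rw [le_div_iff₀ (by positivity)]
    have h8 : 0 < (1 + |x.im|) ^ n := by positivity
    rw [le_div_iff₀ h8] at h1
    calc ‖bfn x y‖ * (1 + |x.im|) ^ (n + 1)
        = ‖bfn x y‖ * (1 + |x.im|) ^ n * (1 + |x.im|) := by ring
      _ ≤ ‖bfn x y‖ * (1 + |x.im|) ^ n * ((1 / a + 1) * ‖x‖) := by gcongr
      _ = (1 / a + 1) * (‖x‖ * ‖bfn x y‖) * (1 + |x.im|) ^ n := by ring
      _ = (1 / a + 1) * ‖y‖ * (‖bfn (x + 1) (y + 1)‖ * (1 + |x.im|) ^ n) := by rw [key]; ring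
      _ ≤ (1 / a + 1) * ((b + 1) * (1 + |y.im|)) * (C * (1 + |y.im|) ^ n) := by gcongr
      _ = C * ((1 / a + 1) * (b + 1)) * (1 + |y.im|) ^ (n + 1) := by ring

/-- Peetre's inequality, used to express decay in `u + v` by decay in `v`. -/
theorem one_add_abs_le_mul (u v : ℝ) : 1 + |v| ≤ (1 + |u|) * (1 + |u + v|) := by
  have h : |v| ≤ |u + v| + |u| := by
    calc |v| = |(u + v) - u| := by ring_nf
      _ ≤ |u + v| + |u| := abs_sub _ _
  nlinarith [abs_nonneg u, abs_nonneg (u + v)]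

/-- Rapid decay along the vertical line through `z`, in terms of the displacement `v`. -/
theorem exists_norm_bfn_add_le (n : ℕ) {z : ℂ} {b : ℝ} (hz : 0 < z.re) (hb : z.re < b) :
    ∃ C : ℝ, 0 ≤ C ∧ ∀ (w : ℂ) (v : ℝ), w.re = b →
      ‖bfn (z + Complex.I * v) w‖ ≤ C * (1 + |w.im|) ^ n / (1 + |v|) ^ n := by
  obtain ⟨C, hC0, hC⟩ := exists_norm_bfn_le_pow n hz hb
  refine ⟨C * (1 + |z.im|) ^ n, by positivity, fun w v hw => ?_⟩
  refine (hC _ w (by simp) hw).trans ?_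
  rw [div_le_div_iff₀ (by positivity) (by positivity)]
  have h : (1 + |v|) ^ n ≤ (1 + |z.im|) ^ n * (1 + |z.im + v|) ^ n := by
    rw [← mul_pow]; exact pow_le_pow_left₀ (by positivity) (one_add_abs_le_mul _ _) n
  have h2 : (z + Complex.I * v).im = z.im + v := by simp
  rw [h2]
  calc C * (1 + |w.im|) ^ n * (1 + |v|) ^ n
      ≤ C * (1 + |w.im|) ^ n * ((1 + |z.im|) ^ n * (1 + |z.im + v|) ^ n) := by gcongr
    _ = _ := by ring

theorem integrable_one_add_abs_pow : Integrable fun v : ℝ => 1 / (1 + |v|) ^ 2 := by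
  have h := integrable_inv_one_add_sq.const_mul 2
  refine h.mono' (Measurable.aestronglyMeasurable (by fun_prop)) (Filter.Eventually.of_forall fun v => ?_)
  rw [Real.norm_of_nonneg (by positivity), one_div, ← div_eq_mul_inv, inv_eq_one_div,
    div_le_div_iff₀ (by positivity) (by positivity)]
  nlinarith [abs_nonneg v, sq_abs v]

theorem integrable_bfn_line {z w : ℂ} (hz : 0 < z.re) (hb : z.re < w.re) :
    Integrable fun v : ℝ => bfn (z + Complex.I * v) w := by
  obtain ⟨C, -, hC⟩ := exists_norm_bfn_add_le 2 hz hb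
  refine (integrable_one_add_abs_pow.const_mul (C * (1 + |w.im|) ^ 2)).mono'
    (Measurable.aestronglyMeasurable (Measurable.bfn (by fun_prop) (by fun_prop)))
    (Filter.Eventually.of_forall fun v => ?_)
  simpa [div_eq_mul_inv] using hC w v rfl

/-! ### Barnes' first lemma and its iteration -/

/-- The substitution `t ↦ t / (1 + t)` turns Euler's integral into a Mellin transform. -/
theorem betaKernel_substitution :
    (∀ t ∈ Set.Ioi (0 : ℝ), HasDerivWithinAt (fun t : ℝ => t / (1 + t)) (1 / (1 + t) ^ 2)
      (Set.Ioi 0) t) ∧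
    Set.InjOn (fun t : ℝ => t / (1 + t)) (Set.Ioi 0) ∧
    (fun t : ℝ => t / (1 + t)) '' Set.Ioi 0 = Set.Ioo 0 1 := by
  refine ⟨fun t ht => ?_, fun t ht u hu h => ?_, ?_⟩
  · have ht' : (0 : ℝ) < t := ht
    have h := ((hasDerivAt_id t).div ((hasDerivAt_id t).const_add 1)
      (by simp only [id]; positivity)).hasDerivWithinAt (s := Set.Ioi 0)
    exact h.congr_deriv (by simp)
  · have ht' : (0 : ℝ) < t := ht
    have hu' : (0 : ℝ) < u := hu
    simp only at h
    rw [div_eq_div_iff (by positivity) (by positivity)] at h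
    linarith
  · ext x
    constructor
    · rintro ⟨t, ht, rfl⟩
      have ht' : (0 : ℝ) < t := ht
      refine ⟨by positivity, ?_⟩
      simp only
      rw [div_lt_one (by positivity)]; linarith
    · rintro ⟨h0, h1⟩
      have h2 : 0 < 1 - x := by linarith
      refine ⟨x / (1 - x), div_pos h0 h2, ?_⟩
      simp only
      field_simp
      ring

/-- The integrand of Euler's integral after the substitution `t ↦ t / (1 + t)`, with its Jacobian. -/
theorem betaKernel_eq {t : ℝ} (ht : 0 < t) (s p : ℂ) :
    |1 / (1 + t) ^ 2| • (((t / (1 + t) : ℝ) : ℂ) ^ (s - 1) *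
      (1 - ((t / (1 + t) : ℝ) : ℂ)) ^ (p - s - 1)) =
    (t : ℂ) ^ (s - 1) • ((1 + t : ℝ) : ℂ) ^ (-p) := by
  have h1 : 0 < 1 + t := by linarith
  have h1c : ((1 + t : ℝ) : ℂ) ≠ 0 := by exact_mod_cast h1.ne'
  have h2 : (1 - ((t / (1 + t) : ℝ) : ℂ)) = (((1 + t)⁻¹ : ℝ) : ℂ) := by
    rw [← Complex.ofReal_one, ← Complex.ofReal_sub]
    congr 1
    field_simp
    ring
  have h3 : ((1 + t : ℝ) : ℂ) ^ (-p) = ((1 + t : ℝ) : ℂ) ^ (-(s - 1)) *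
      ((1 + t : ℝ) : ℂ) ^ (-(p - s - 1)) * ((1 + t : ℝ) : ℂ) ^ (-2 : ℂ) := by
    rw [← Complex.cpow_add _ _ h1c, ← Complex.cpow_add _ _ h1c]
    ring_nf
  have h4 : ((1 + t : ℝ) : ℂ) ^ (-2 : ℂ) = ((1 / (1 + t) ^ 2 : ℝ) : ℂ) := by
    rw [Complex.cpow_neg, ← Nat.cast_ofNat (R := ℂ) (n := 2), Complex.cpow_natCast]
    push_cast; simp
  rw [abs_of_pos (by positivity), h2, div_eq_mul_inv t, Complex.ofReal_mul,
    Complex.mul_cpow_ofReal_nonneg ht.le (by positivity), h3, h4, Complex.ofReal_inv,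
    Complex.inv_cpow _ _ (by rw [Complex.arg_ofReal_of_nonneg h1.le]; exact Real.pi_pos.ne),
    Complex.inv_cpow _ _ (by rw [Complex.arg_ofReal_of_nonneg h1.le]; exact Real.pi_pos.ne),
    Complex.cpow_neg _ (s - 1), Complex.cpow_neg _ (p - s - 1), Complex.real_smul, smul_eq_mul]
  ring

theorem mellinConvergent_betaKernel {s p : ℂ} (hs : 0 < s.re) (hp : s.re < p.re) :
    MellinConvergent (fun t : ℝ => ((1 + t : ℝ) : ℂ) ^ (-p)) s := by
  obtain ⟨hd, hi, him⟩ := betaKernel_substitution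
  have h := Complex.betaIntegral_convergent (u := s) (v := p - s) hs (by simpa using hp)
  rw [intervalIntegrable_iff_integrableOn_Ioo_of_le zero_le_one, ← him,
    integrableOn_image_iff_integrableOn_abs_deriv_smul measurableSet_Ioi hd hi] at h
  exact h.congr_fun (fun t ht => betaKernel_eq ht s p) measurableSet_Ioi

/-- `B[s; p]` is the Mellin transform of `(1 + t) ^ (-p)`. -/
theorem mellin_betaKernel {s p : ℂ} (hs : 0 < s.re) (hp : s.re < p.re) :
    mellin (fun t : ℝ => ((1 + t : ℝ) : ℂ) ^ (-p)) s = bfn s p := by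
  obtain ⟨hd, hi, him⟩ := betaKernel_substitution
  rw [bfn_eq_betaIntegral hs hp, Complex.betaIntegral,
    intervalIntegral.integral_of_le zero_le_one, integral_Ioc_eq_integral_Ioo, ← him,
    integral_image_eq_integral_abs_deriv_smul measurableSet_Ioi hd hi, mellin]
  exact (setIntegral_congr_fun measurableSet_Ioi fun t ht => betaKernel_eq ht s p).symm

/-- Mellin inversion of `t ↦ (1 + t) ^ (-p)`, whose Mellin transform is `s ↦ B[s; p]`. -/
theorem integral_cpow_mul_bfn {a : ℝ} {p : ℂ} (ha : 0 < a) (hp : a < p.re) {t : ℝ} (ht : 0 < t) :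
    ∫ y : ℝ, (t : ℂ) ^ (-(a + Complex.I * y : ℂ)) * bfn (a + Complex.I * y) p =
      2 * Real.pi * ((1 + t : ℝ) : ℂ) ^ (-p) := by
  have hre : ∀ y : ℝ, (a + y * Complex.I : ℂ).re = a := fun y => by simp
  have hm : ∀ y : ℝ, mellin (fun t : ℝ => ((1 + t : ℝ) : ℂ) ^ (-p)) (a + y * Complex.I) =
      bfn (a + Complex.I * y) p := fun y => by
    rw [mellin_betaKernel (by rw [hre]; exact ha) (by rw [hre]; exact hp), mul_comm]
  have h := mellinInv_mellin_eq a (fun t : ℝ => ((1 + t : ℝ) : ℂ) ^ (-p)) ht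
    (mellinConvergent_betaKernel (by simpa using ha) (by simpa using hp))
    (by
      unfold Complex.VerticalIntegrable
      simp_rw [hm]
      exact integrable_bfn_line (by simpa using ha) (by simpa using hp))
    (ContinuousAt.cpow (by fun_prop) continuousAt_const
      (Or.inl (by rw [Complex.ofReal_re]; linarith)))
  unfold mellinInv at h
  simp_rw [hm] at h
  rw [← h]
  simp only [Complex.real_smul, smul_eq_mul]
  push_cast
  rw [← mul_assoc, mul_one_div_cancel (by simp), one_mul]
  simp_rw [mul_comm Complex.I]

/-- **Barnes' first lemma**: the convolution of two Beta functions on a vertical line. -/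
theorem integral_bfn_mul_bfn {a : ℝ} {p q T : ℂ} (ha : 0 < a) (hp : a < p.re) (hT : a < T.re)
    (hq : T.re - a < q.re) :
    ∫ y : ℝ, bfn (a + Complex.I * y) p * bfn (T - (a + Complex.I * y)) q =
      2 * Real.pi * bfn T (p + q) := by
  set g : ℝ → ℂ := fun t => (t : ℂ) ^ (T - a - 1) • ((1 + t : ℝ) : ℂ) ^ (-q) with hg
  have hgi : IntegrableOn g (Set.Ioi 0) :=
    mellinConvergent_betaKernel (s := T - a) (by simpa using hT) (by simpa using hq)
  have h1 : ∀ y : ℝ, bfn (T - (a + Complex.I * y)) q =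
      ∫ t in Set.Ioi (0 : ℝ), (t : ℂ) ^ (-(Complex.I * y)) * g t := fun y => by
    rw [← mellin_betaKernel (by simpa using hT) (by simpa using hq), mellin]
    refine setIntegral_congr_fun measurableSet_Ioi fun t ht => ?_
    have ht0 : (t : ℂ) ≠ 0 := by exact_mod_cast (ne_of_gt ht)
    simp only [hg, smul_eq_mul, ← mul_assoc]
    rw [← Complex.cpow_add _ _ ht0]
    ring_nf
  simp_rw [h1, ← integral_const_mul]
  rw [integral_integral_swap]
  · have h2 : ∀ t ∈ Set.Ioi (0 : ℝ),
        ∫ y : ℝ, bfn (a + Complex.I * y) p * ((t : ℂ) ^ (-(Complex.I * y)) * g t) =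
        2 * Real.pi * ((t : ℂ) ^ (T - 1) • ((1 + t : ℝ) : ℂ) ^ (-(p + q))) := fun t ht => by
      have ht0 : (t : ℂ) ≠ 0 := by exact_mod_cast (ne_of_gt ht)
      have ht1 : ((1 + t : ℝ) : ℂ) ≠ 0 := by
        have : (0 : ℝ) < 1 + t := by have : (0:ℝ) < t := ht; linarith
        exact_mod_cast this.ne'
      have h3 : ∀ y : ℝ, bfn (a + Complex.I * y) p * ((t : ℂ) ^ (-(Complex.I * y)) * g t) =
          ((t : ℂ) ^ (-(a + Complex.I * y : ℂ)) * bfn (a + Complex.I * y) p) *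
            ((t : ℂ) ^ (a : ℂ) * g t) := fun y => by
        rw [show (-(Complex.I * y) : ℂ) = -(a + Complex.I * y) + a by ring,
          Complex.cpow_add _ _ ht0]
        ring
      simp_rw [h3]
      rw [integral_mul_const, integral_cpow_mul_bfn ha hp ht]
      simp only [hg, smul_eq_mul]
      rw [show T - 1 = (a : ℂ) + (T - a - 1) by ring, Complex.cpow_add _ _ ht0, neg_add,
        Complex.cpow_add _ _ ht1]
      ring
    rw [setIntegral_congr_fun measurableSet_Ioi h2, integral_const_mul,
      ← mellin_betaKernel (by linarith) (by simp; linarith), mellin]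
  · have hb := integrable_bfn_line (z := a) (w := p) (by simpa using ha) (by simpa using hp)
    have hgm : Measurable g := by
      simp only [hg]; fun_prop
    refine (hb.mul_prod hgi).mono ?_ ?_
    · refine Measurable.aestronglyMeasurable ?_
      refine Measurable.mul (Measurable.bfn (by fun_prop) (by fun_prop)) ?_
      exact Measurable.mul (by fun_prop) (hgm.comp measurable_snd)
    · have h0 : ∀ᵐ z : ℝ × ℝ ∂(volume.prod (volume.restrict (Set.Ioi 0))), z.2 ∈ Set.Ioi (0 : ℝ) :=
        Measure.quasiMeasurePreserving_snd.ae (ae_restrict_mem measurableSet_Ioi)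
      filter_upwards [h0] with z hz
      simp only [Function.uncurry, norm_mul]
      rw [Complex.norm_cpow_eq_rpow_re_of_pos hz]
      simp

/-! ### Lebesgue measure on coordinate subspaces and on hyperplanes -/

/-- The sums of the coordinates of `w` in `I` over the fibres of `π`. -/
def fiberSum {α β : Type} [DecidableEq β] (I : Finset α) (π : α → β) (w : α → ℝ) (b : β) : ℝ :=
  ∑ q ∈ I.filter (fun q => π q = b), w q

theorem measurable_fiberSum {α β : Type} [DecidableEq β] (I : Finset α) (π : α → β) : Measurable (fiberSum I π) :=
  measurable_pi_lambda _ fun _ => Finset.measurable_sum _ fun q _ => measurable_pi_apply q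

section CoordVolume

variable {α β : Type} [Fintype α] [DecidableEq α] [Fintype β] [DecidableEq β]

/-- Lebesgue measure on the coordinate subspace `ℝ^I ⊆ ℝ^α`, as a measure on the ambient space:
the coordinates outside `I` are almost surely zero. -/
noncomputable def coordVolume (I : Finset α) : Measure (α → ℝ) :=
  Measure.pi fun q => if q ∈ I then volume else Measure.dirac 0

instance coordVolume_factor_sigmaFinite (I : Finset α) (q : α) :
    SigmaFinite (if q ∈ I then volume else Measure.dirac 0 : Measure ℝ) := by
  split_ifs <;> infer_instance

instance (I : Finset α) : SigmaFinite (coordVolume I) := by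
  unfold coordVolume; infer_instance

theorem coordVolume_ae (I : Finset α) : ∀ᵐ w ∂coordVolume I, ∀ q ∉ I, w q = 0 := by
  rw [ae_all_iff]
  intro q
  by_cases hq : q ∈ I
  · simp [hq]
  · have h : ∀ᵐ x ∂(if q ∈ I then volume else Measure.dirac 0 : Measure ℝ), x = 0 := by
      simp [hq, ae_dirac_eq]
    have := (Measure.quasiMeasurePreserving_eval
      (μ := fun q : α => (if q ∈ I then volume else Measure.dirac 0 : Measure ℝ)) q).ae h
    exact this.mono fun w hw _ => hw

theorem coordVolume_univ : coordVolume (Finset.univ : Finset α) = volume := by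
  simp [coordVolume, volume_pi]

/-- For disjoint sets of coordinates the measure on their union is a convolution, so that integrals can
be iterated. -/
theorem coordVolume_union {I I' : Finset α} (h : Disjoint I I') :
    coordVolume (I ∪ I') =
      ((coordVolume I).prod (coordVolume I')).map fun p => p.1 + p.2 := by
  have h1 := (measurePreserving_arrowProdEquivProdArrow ℝ ℝ α
    (fun q => if q ∈ I then volume else Measure.dirac 0)
    (fun q => if q ∈ I' then volume else Measure.dirac 0)).map_eq
  have h2 : ∀ q, SigmaFinite (((if q ∈ I then volume else Measure.dirac 0 : Measure ℝ).prod
      (if q ∈ I' then volume else Measure.dirac 0)).map fun p => p.1 + p.2) ∧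
      ((if q ∈ I then volume else Measure.dirac 0 : Measure ℝ).prod
      (if q ∈ I' then volume else Measure.dirac 0)).map (fun p => p.1 + p.2) =
      if q ∈ I ∪ I' then volume else Measure.dirac 0 := fun q => by
    have : ((if q ∈ I then volume else Measure.dirac 0 : Measure ℝ).prod
      (if q ∈ I' then volume else Measure.dirac 0)).map (fun p => p.1 + p.2) =
      if q ∈ I ∪ I' then volume else Measure.dirac 0 := by
      by_cases hI : q ∈ I
      · have hI' : q ∉ I' := Finset.disjoint_left.mp h hI
        simp only [hI, hI', if_true, if_false, Finset.mem_union, or_false, Measure.prod_dirac]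
        rw [Measure.map_map (by fun_prop) (by fun_prop)]
        simp [Function.comp_def]
      · by_cases hI' : q ∈ I'
        · simp only [hI, hI', if_true, if_false, Finset.mem_union, or_true, Measure.dirac_prod]
          rw [Measure.map_map (by fun_prop) (by fun_prop)]
          simp [Function.comp_def]
        · simp only [hI, hI', if_false, Finset.mem_union, or_self, Measure.dirac_prod_dirac]
          rw [Measure.map_dirac' (by fun_prop)]
          simp
    exact ⟨this ▸ inferInstance, this⟩
  have := fun q => (h2 q).1
  have h3 := Measure.pi_map_pi (μ := fun q : α => (if q ∈ I then volume else Measure.dirac 0 :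
    Measure ℝ).prod (if q ∈ I' then volume else Measure.dirac 0))
    (f := fun _ p => p.1 + p.2) (fun q => by fun_prop)
  rw [coordVolume, coordVolume, coordVolume, ← h1, Measure.map_map (by fun_prop) (by fun_prop)]
  rw [show (fun q => if q ∈ I ∪ I' then (volume : Measure ℝ) else Measure.dirac 0) =
    fun q => _ from funext fun q => (h2 q).2.symm, ← h3]
  rfl

theorem coordVolume_map_add {I : Finset α} {c : α → ℝ} (hc : ∀ q ∉ I, c q = 0) :
    (coordVolume I).map (fun w => w + c) = coordVolume I := by
  have h2 : ∀ q, (if q ∈ I then volume else Measure.dirac 0 : Measure ℝ).map (fun x => x + c q) =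
      if q ∈ I then volume else Measure.dirac 0 := fun q => by
    by_cases hq : q ∈ I
    · simp [hq, map_add_right_eq_self]
    · simp only [hq, if_false]
      rw [Measure.map_dirac' (by fun_prop), hc q hq, add_zero]
  have : ∀ q, SigmaFinite ((if q ∈ I then volume else Measure.dirac 0 : Measure ℝ).map
    (fun x => x + c q)) := fun q => by rw [h2 q]; infer_instance
  have h3 := Measure.pi_map_pi (μ := fun q : α => (if q ∈ I then volume else Measure.dirac 0 :
    Measure ℝ)) (f := fun q x => x + c q) (fun q => by fun_prop)
  simp_rw [h2] at h3
  exact h3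

/-- An injective relabelling of the coordinates preserves the measure. -/
theorem coordVolume_map_fiberSum {I : Finset α} {s : α → β} (hs : Set.InjOn s I) :
    (coordVolume I).map (fiberSum I s) = coordVolume (I.image s) := by
  have hval : ∀ (w : α → ℝ) q, q ∈ I → fiberSum I s w (s q) = w q := fun w q hq => by
    rw [fiberSum, Finset.sum_eq_single q]
    · intro p hp hpq
      rw [Finset.mem_filter] at hp
      exact absurd (hs hp.1 hq hp.2) hpq
    · intro h; exact absurd (Finset.mem_filter.mpr ⟨hq, rfl⟩ : q ∈ I.filter fun p => s p = s q) h
  have hval0 : ∀ (w : α → ℝ) b, b ∉ I.image s → fiberSum I s w b = 0 := fun w b hb => by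
    rw [fiberSum, Finset.filter_eq_empty_iff.mpr, Finset.sum_empty]
    intro q hq h
    exact hb (Finset.mem_image.mpr ⟨q, hq, h⟩)
  refine (Measure.pi_eq fun S hS => ?_).symm
  rw [Measure.map_apply (measurable_fiberSum I s) (MeasurableSet.univ_pi hS)]
  have hprod : ∏ b, (if b ∈ I.image s then volume else Measure.dirac 0 : Measure ℝ) (S b) =
      (∏ b ∈ Finset.univ.filter (· ∉ I.image s), Measure.dirac 0 (S b)) *
        ∏ q ∈ I, volume (S (s q)) := by
    rw [← Finset.prod_image (s := I) (g := s) (f := fun b => volume (S b)) hs,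
      ← Finset.prod_filter_mul_prod_filter_not Finset.univ (· ∉ I.image s)]
    congr 1
    · refine Finset.prod_congr rfl fun b hb => ?_
      rw [if_neg (Finset.mem_filter.mp hb).2]
    · have : Finset.univ.filter (fun b => ¬ b ∉ I.image s) = I.image s := by ext; simp
      rw [this]
      exact Finset.prod_congr rfl fun b hb => by rw [if_pos hb]
  rw [hprod]
  by_cases h0 : ∀ b ∉ I.image s, (0 : ℝ) ∈ S b
  · have hpre : fiberSum I s ⁻¹' Set.univ.pi S =
        Set.univ.pi fun q => if q ∈ I then S (s q) else Set.univ := by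
      ext w
      simp only [Set.mem_preimage, Set.mem_univ_pi]
      constructor
      · intro h q
        split_ifs with hq
        · rw [← hval w q hq]; exact h _
        · trivial
      · intro h b
        by_cases hb : b ∈ I.image s
        · obtain ⟨q, hq, rfl⟩ := Finset.mem_image.mp hb
          rw [hval w q hq]
          have := h q
          rwa [if_pos hq] at this
        · rw [hval0 w b hb]; exact h0 b hb
    rw [hpre, coordVolume, Measure.pi_pi]
    have h1 : ∏ b ∈ Finset.univ.filter (· ∉ I.image s), Measure.dirac (0 : ℝ) (S b) = 1 :=
      Finset.prod_eq_one fun b hb => by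
        rw [Measure.dirac_apply' _ (hS b)]
        simp [h0 b (Finset.mem_filter.mp hb).2]
    rw [h1, one_mul, ← Finset.prod_subset (Finset.subset_univ I)]
    · exact Finset.prod_congr rfl fun q hq => by rw [if_pos hq, if_pos hq]
    · intro q _ hq
      rw [if_neg hq, if_neg hq]; simp
  · push Not at h0
    obtain ⟨b, hb, hb0⟩ := h0
    have hpre : fiberSum I s ⁻¹' Set.univ.pi S = ∅ := by
      ext w
      simp only [Set.mem_preimage, Set.mem_univ_pi, Set.mem_empty_iff_false, iff_false]
      intro h
      have := h b
      rw [hval0 w b hb] at this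
      exact hb0 this
    rw [hpre, measure_empty, Finset.prod_eq_zero (i := b) (by simpa using hb), zero_mul]
    rw [Measure.dirac_apply' _ (hS b)]
    simp [hb0]

theorem coordVolume_singleton (q : α) :
    coordVolume {q} = (volume : Measure ℝ).map fun x => Pi.single q x := by
  have h := coordVolume_map_fiberSum (I := (Finset.univ : Finset Unit)) (s := fun _ => q)
    (fun _ _ _ _ _ => rfl)
  have h2 := (volume_preserving_funUnique Unit ℝ).symm.map_eq
  have h3 : Finset.univ.image (fun _ : Unit => q) = {q} := by simp
  rw [coordVolume_univ, h3, ← h2, Measure.map_map (measurable_fiberSum _ _) (by fun_prop)] at h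
  rw [← h]
  congr 1
  funext x p
  by_cases hp : p = q
  · subst hp; simp [fiberSum]
  · simp [fiberSum, hp, Ne.symm hp]

theorem lintegral_coordVolume_union {I I' : Finset α} (h : Disjoint I I') {f : (α → ℝ) → ENNReal}
    (hf : Measurable f) :
    ∫⁻ w, f w ∂coordVolume (I ∪ I') =
      ∫⁻ v, ∫⁻ w, f (v + w) ∂coordVolume I' ∂coordVolume I := by
  rw [coordVolume_union h, lintegral_map hf (by fun_prop), lintegral_prod _ (by fun_prop)]

/-- A product of functions of disjoint groups of coordinates has as integral the product of the
integrals. -/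
theorem integral_coordVolume_prod {ι : Type} [DecidableEq ι] (J : Finset ι) (π : α → ι)
    (g : ι → (α → ℝ) → ℂ) (hg : ∀ j ∈ J, Measurable (g j)) :
    ∀ I : Finset α, (∀ q ∈ I, π q ∈ J) →
      (∀ j ∈ J, ∀ w w' : α → ℝ, (∀ q, π q = j → w q = w' q) → g j w = g j w') →
      ∫ w, ∏ j ∈ J, g j w ∂coordVolume I =
        ∏ j ∈ J, ∫ w, g j w ∂coordVolume (I.filter fun q => π q = j) := by
  induction J using Finset.induction_on with
  | empty =>
    intro I hI _
    have : I = ∅ := Finset.eq_empty_of_forall_notMem fun q hq => by simpa using hI q hq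
    subst this
    simp [coordVolume, measureReal_def]
  | insert j J hj ih =>
    intro I hI hdep
    have hunion : I.filter (fun q => π q = j) ∪ I.filter (fun q => π q ≠ j) = I :=
      Finset.filter_union_filter_not_eq _ _
    have hdisj : Disjoint (I.filter fun q => π q = j) (I.filter fun q => π q ≠ j) :=
      Finset.disjoint_filter_filter_not _ _ _
    have hgJ : Measurable fun w => ∏ j ∈ J, g j w :=
      Finset.measurable_prod _ fun i hi => hg i (Finset.mem_insert_of_mem hi)
    have hgj := hg j (Finset.mem_insert_self j J)
    rw [Finset.prod_insert hj]
    simp_rw [Finset.prod_insert hj]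
    conv_lhs => rw [← hunion]
    rw [coordVolume_union hdisj, integral_map (by fun_prop)
      (show Measurable fun w => g j w * ∏ i ∈ J, g i w from hgj.mul hgJ).aestronglyMeasurable]
    have hae1 := (Measure.quasiMeasurePreserving_fst
      (μ := coordVolume (I.filter fun q => π q = j))
      (ν := coordVolume (I.filter fun q => π q ≠ j))).ae
      (coordVolume_ae (I.filter fun q => π q = j))
    have hae2 := (Measure.quasiMeasurePreserving_snd
      (μ := coordVolume (I.filter fun q => π q = j))
      (ν := coordVolume (I.filter fun q => π q ≠ j))).ae
      (coordVolume_ae (I.filter fun q => π q ≠ j))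
    have hcongr : ∀ᵐ p ∂((coordVolume (I.filter fun q => π q = j)).prod
        (coordVolume (I.filter fun q => π q ≠ j))),
        g j (p.1 + p.2) * ∏ i ∈ J, g i (p.1 + p.2) = g j p.1 * ∏ i ∈ J, g i p.2 := by
      filter_upwards [hae1, hae2] with p h1 h2
      congr 1
      · refine hdep j (Finset.mem_insert_self _ _) _ _ fun q hq => ?_
        have := h2 q (by simp [hq])
        simp [this]
      · refine Finset.prod_congr rfl fun i hi => ?_
        refine hdep i (Finset.mem_insert_of_mem hi) _ _ fun q hq => ?_
        have hij : i ≠ j := fun h => hj (h ▸ hi)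
        have := h1 q (by simp [hq, hij])
        simp [this]
    rw [integral_congr_ae hcongr, integral_prod_mul (f := g j) (g := fun w => ∏ i ∈ J, g i w),
      ih (fun i hi => hg i (Finset.mem_insert_of_mem hi)) (I.filter fun q => π q ≠ j)
        (fun q hq => by
          rw [Finset.mem_filter] at hq
          exact (Finset.mem_insert.mp (hI q hq.1)).resolve_left hq.2)
        (fun i hi => hdep i (Finset.mem_insert_of_mem hi))]
    congr 1
    refine Finset.prod_congr rfl fun i hi => ?_
    have hij : i ≠ j := fun h => hj (h ▸ hi)
    congr 2
    ext q
    simp only [Finset.mem_filter]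
    constructor
    · rintro ⟨⟨h1, _⟩, h2⟩; exact ⟨h1, h2⟩
    · rintro ⟨h1, h2⟩; exact ⟨⟨h1, h2 ▸ hij⟩, h2⟩

/-- Decay of second order in every coordinate suffices for absolute convergence. -/
theorem integrable_coordVolume_of_le {I : Finset α} {f : (α → ℝ) → ℂ}
    (hf : AEStronglyMeasurable f (coordVolume I)) (C : ℝ)
    (h : ∀ᵐ w ∂coordVolume I, ‖f w‖ ≤ C * ∏ q ∈ I, 1 / (1 + |w q|) ^ 2) :
    Integrable f (coordVolume I) := by
  have h1 : Integrable (fun w : α → ℝ => ∏ q, if q ∈ I then 1 / (1 + |w q|) ^ 2 else 1)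
      (coordVolume I) := by
    refine Integrable.fintype_prod (f := fun q (x : ℝ) => if q ∈ I then 1 / (1 + |x|) ^ 2 else 1)
      fun q => ?_
    by_cases hq : q ∈ I
    · simpa [hq] using integrable_one_add_abs_pow
    · simp [hq]
  refine (h1.const_mul C).mono' hf (h.mono fun w hw => hw.trans (le_of_eq ?_))
  rw [Finset.prod_ite_mem, Finset.univ_inter]

end CoordVolume

section HyperVolume

variable {α β : Type} [Fintype α] [DecidableEq α] [Fintype β] [DecidableEq β]

theorem measurable_single_real {α : Type} [DecidableEq α] (q : α) :
    Measurable fun x : ℝ => (Pi.single q x : α → ℝ) := by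
  refine measurable_pi_lambda _ fun p => ?_
  by_cases hp : p = q
  · subst hp
    simp only [Pi.single_eq_same]
    fun_prop
  · simp only [Pi.single_eq_of_ne hp]
    fun_prop

/-- Change the coordinate `q₀` of `w` so that the coordinates in `Q` sum to zero. -/
def tieOff {α : Type} [DecidableEq α] (Q : Finset α) (q₀ : α) (w : α → ℝ) : α → ℝ :=
  w - Pi.single q₀ (∑ p ∈ Q, w p)

theorem measurable_tieOff {α : Type} [DecidableEq α] (Q : Finset α) (q₀ : α) :
    Measurable (tieOff Q q₀) := by
  unfold tieOff
  refine measurable_id.sub ?_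
  refine measurable_pi_lambda _ fun p => ?_
  by_cases hp : p = q₀
  · subst hp
    simp only [Pi.single_eq_same]
    fun_prop
  · simp only [Pi.single_eq_of_ne hp]
    fun_prop

theorem tieOff_of_ne {α : Type} [DecidableEq α] (Q : Finset α) {q₀ q : α} (w : α → ℝ)
    (h : q ≠ q₀) : tieOff Q q₀ w q = w q := by
  simp [tieOff, h]

theorem sum_tieOff {α : Type} [DecidableEq α] {Q : Finset α} {q₀ : α} (h : q₀ ∈ Q) (w : α → ℝ) :
    ∑ p ∈ Q, tieOff Q q₀ w p = 0 := by
  simp [tieOff, Finset.sum_sub_distrib, Finset.sum_pi_single', h]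

/-- Lebesgue measure on the hyperplane `∑_{q ∈ Q} w q = 0` of `ℝ^Q`, parametrized by the
coordinates other than `q₀`. -/
noncomputable def hyperVolume (Q : Finset α) (q₀ : α) : Measure (α → ℝ) :=
  (coordVolume (Q.erase q₀)).map (tieOff Q q₀)

instance (Q : Finset α) (q₀ : α) : SFinite (hyperVolume Q q₀) := by
  unfold hyperVolume; infer_instance

theorem hyperVolume_ae {Q : Finset α} {q₀ : α} (h : q₀ ∈ Q) :
    ∀ᵐ w ∂hyperVolume Q q₀, (∀ q ∉ Q, w q = 0) ∧ ∑ q ∈ Q, w q = 0 := by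
  have hm : MeasurableSet {w : α → ℝ | (∀ q ∉ Q, w q = 0) ∧ ∑ q ∈ Q, w q = 0} := by
    have h1 : {w : α → ℝ | (∀ q ∉ Q, w q = 0) ∧ ∑ q ∈ Q, w q = 0} =
        (⋂ q, ⋂ (_ : q ∉ Q), (fun w : α → ℝ => w q) ⁻¹' {0}) ∩
          (fun w : α → ℝ => ∑ q ∈ Q, w q) ⁻¹' {0} := by
      ext w; simp
    rw [h1]
    refine MeasurableSet.inter (MeasurableSet.iInter fun q => MeasurableSet.iInter fun _ => ?_) ?_
    · exact measurable_pi_apply q (measurableSet_singleton 0)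
    · exact (Finset.measurable_sum Q fun q _ => measurable_pi_apply q) (measurableSet_singleton 0)
  rw [hyperVolume, ae_map_iff (measurable_tieOff Q q₀).aemeasurable hm]
  filter_upwards [coordVolume_ae (Q.erase q₀)] with w hw
  refine ⟨fun q hq => ?_, sum_tieOff h w⟩
  have hne : q ≠ q₀ := fun e => hq (e ▸ h)
  rw [tieOff_of_ne _ _ hne]
  exact hw q fun h' => hq (Finset.mem_of_mem_erase h')

/-- The measure on the hyperplane does not depend on the variable that is solved for. -/
theorem hyperVolume_eq {Q : Finset α} {q₀ q₁ : α} (h₀ : q₀ ∈ Q) (h₁ : q₁ ∈ Q) :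
    hyperVolume Q q₀ = hyperVolume Q q₁ := by
  rcases eq_or_ne q₀ q₁ with rfl | hne
  · rfl
  set I := (Q.erase q₀).erase q₁ with hI
  have hQ0 : Q.erase q₀ = I ∪ {q₁} := by
    rw [hI, Finset.union_comm, ← Finset.insert_eq, Finset.insert_erase]
    simp [h₁, hne.symm]
  have hQ1 : Q.erase q₁ = I ∪ {q₀} := by
    rw [hI, Finset.erase_right_comm, Finset.union_comm, ← Finset.insert_eq, Finset.insert_erase]
    simp [h₀, hne]
  have hq0I : q₀ ∉ I := by simp [hI]
  have hq1I : q₁ ∉ I := by simp [hI]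
  refine Measure.ext_of_lintegral _ fun f hf => ?_
  have hf0 : Measurable fun w => f (tieOff Q q₀ w) := hf.comp (measurable_tieOff _ _)
  have hf1 : Measurable fun w => f (tieOff Q q₁ w) := hf.comp (measurable_tieOff _ _)
  rw [hyperVolume, hyperVolume, lintegral_map hf (measurable_tieOff _ _),
    lintegral_map hf (measurable_tieOff _ _), hQ0, hQ1,
    lintegral_coordVolume_union (Finset.disjoint_singleton_right.mpr hq1I) hf0,
    lintegral_coordVolume_union (Finset.disjoint_singleton_right.mpr hq0I) hf1]
  refine lintegral_congr fun v => ?_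
  have hm0 : Measurable fun w : α → ℝ => f (tieOff Q q₀ (v + w)) :=
    (hf.comp (measurable_tieOff _ _)).comp (by fun_prop)
  have hm1 : Measurable fun w : α → ℝ => f (tieOff Q q₁ (v + w)) :=
    (hf.comp (measurable_tieOff _ _)).comp (by fun_prop)
  rw [coordVolume_singleton, coordVolume_singleton, lintegral_map hm0 (measurable_single_real q₁),
    lintegral_map hm1 (measurable_single_real q₀)]
  rw [← lintegral_sub_left_eq_self (fun x : ℝ => f (tieOff Q q₀ (v + (Pi.single q₁ x : α → ℝ))))
    (-∑ p ∈ Q, v p)]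
  refine lintegral_congr fun x => congrArg f ?_
  have hs0 : ∑ p ∈ Q, (Pi.single q₀ x : α → ℝ) p = x := by
    rw [Finset.sum_pi_single', if_pos h₀]
  have hs1 : ∑ p ∈ Q, (Pi.single q₁ (-∑ p ∈ Q, v p - x) : α → ℝ) p = -∑ p ∈ Q, v p - x := by
    rw [Finset.sum_pi_single', if_pos h₁]
  funext p
  simp only [tieOff, Pi.add_apply, Finset.sum_add_distrib, hs0, hs1, Pi.sub_apply]
  by_cases hp0 : p = q₀
  · subst hp0; simp [hne]; ring
  · by_cases hp1 : p = q₁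
    · subst hp1; simp [hne.symm]; ring
    · simp [hp0, hp1]

/-- On a hyperplane, decay is needed only in the independent coordinates, those other than `q₀`. -/
theorem integrable_hyperVolume_of_le {Q : Finset α} {q₀ : α} (h₀ : q₀ ∈ Q) {f : (α → ℝ) → ℂ}
    (hf : Measurable f) (C : ℝ)
    (h : ∀ w : α → ℝ, (∀ q ∉ Q, w q = 0) → ∑ q ∈ Q, w q = 0 →
      ‖f w‖ ≤ C * ∏ q ∈ Q.erase q₀, 1 / (1 + |w q|) ^ 2) :
    Integrable f (hyperVolume Q q₀) := by
  rw [hyperVolume, integrable_map_measure hf.aestronglyMeasurable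
    (measurable_tieOff Q q₀).aemeasurable]
  refine integrable_coordVolume_of_le (hf.comp (measurable_tieOff Q q₀)).aestronglyMeasurable C ?_
  filter_upwards [coordVolume_ae (Q.erase q₀)] with w hw
  refine (h (tieOff Q q₀ w) (fun q hq => ?_) (sum_tieOff h₀ w)).trans (le_of_eq ?_)
  · have hne : q ≠ q₀ := fun e => hq (e ▸ h₀)
    rw [tieOff_of_ne _ _ hne]
    exact hw q fun h' => hq (Finset.mem_of_mem_erase h')
  · congr 1
    exact Finset.prod_congr rfl fun q hq => by
      rw [tieOff_of_ne _ _ (Finset.ne_of_mem_erase hq)]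

/-- The point of `ℝ^Q` whose sums over the fibres of `π : Q → J` are the numbers `U j`, and whose
coordinates other than those of the representatives `r j` are given by `v`. -/
def fiberPoint {α β : Type} [DecidableEq α] [DecidableEq β] (Q : Finset α) (J : Finset β) (π : α → β) (r : β → α) (U : β → ℝ) (v : α → ℝ) :
    α → ℝ :=
  v + ∑ j ∈ J, Pi.single (r j) (U j - fiberSum Q π v j)

theorem measurable_fiberPoint {α β : Type} [DecidableEq α] [DecidableEq β] (Q : Finset α) (J : Finset β) (π : α → β) (r : β → α) :
    Measurable fun p : (β → ℝ) × (α → ℝ) => fiberPoint Q J π r p.1 p.2 := by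
  unfold fiberPoint
  refine measurable_snd.add (Finset.measurable_sum _ fun j _ => ?_)
  refine (measurable_single_real (r j)).comp (Measurable.sub (by fun_prop) ?_)
  exact ((measurable_pi_apply j).comp (measurable_fiberSum Q π)).comp measurable_snd

/-- Disintegration of the measure on the hyperplane of `ℝ^Q` along the sums over the fibres of a
map `π : Q → J`. -/
theorem hyperVolume_fiber {Q : Finset α} {J : Finset β} {π : α → β} {r : β → α}
    (hπ : ∀ q ∈ Q, π q ∈ J) (hr : ∀ j ∈ J, r j ∈ Q ∧ π (r j) = j) {j₀ : β} (hj₀ : j₀ ∈ J) :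
    hyperVolume Q (r j₀) = ((hyperVolume J j₀).prod (coordVolume (Q \ J.image r))).map
      fun p => fiberPoint Q J π r p.1 p.2 := by
  have hinj : Set.InjOn r J := fun i hi j hj h => by rw [← (hr i hi).2, h, (hr j hj).2]
  have hinj' : Set.InjOn r (J.erase j₀ : Finset β) := hinj.mono fun i hi => by
    simp only [Finset.coe_erase, Set.mem_sdiff] at hi; exact hi.1
  set I := Q \ J.image r with hI
  have hQ : Q.erase (r j₀) = I ∪ (J.erase j₀).image r := by
    ext q
    simp only [hI, Finset.mem_erase, Finset.mem_union, Finset.mem_sdiff, Finset.mem_image]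
    constructor
    · rintro ⟨h1, h2⟩
      by_cases h : ∃ a ∈ J, r a = q
      · obtain ⟨a, ha, rfl⟩ := h
        exact Or.inr ⟨a, ⟨fun e => h1 (e ▸ rfl), ha⟩, rfl⟩
      · exact Or.inl ⟨h2, h⟩
    · rintro (⟨h1, h2⟩ | ⟨a, ⟨h1, h2⟩, rfl⟩)
      · exact ⟨fun e => h2 ⟨j₀, hj₀, e.symm⟩, h1⟩
      · exact ⟨fun e => h1 (hinj h2 hj₀ e), (hr a h2).1⟩
  have hdisj : Disjoint I ((J.erase j₀).image r) := by
    rw [Finset.disjoint_left]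
    intro q hq hq'
    rw [hI, Finset.mem_sdiff] at hq
    exact hq.2 (Finset.image_subset_image (Finset.erase_subset _ _) hq')
  refine Measure.ext_of_lintegral _ fun f hf => ?_
  have hft : Measurable fun w => f (tieOff Q (r j₀) w) := hf.comp (measurable_tieOff Q (r j₀))
  have hff : Measurable fun p : (β → ℝ) × (α → ℝ) => f (fiberPoint Q J π r p.1 p.2) :=
    hf.comp (measurable_fiberPoint Q J π r)
  rw [lintegral_map hf (measurable_fiberPoint Q J π r),
    lintegral_prod_symm' _ hff, hyperVolume,
    lintegral_map hf (measurable_tieOff _ _), hQ, lintegral_coordVolume_union hdisj hft]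
  refine lintegral_congr_ae ?_
  filter_upwards [coordVolume_ae I] with v hv
  have hm : Measurable fun w : α → ℝ => f (tieOff Q (r j₀) (v + w)) :=
    hft.comp (by fun_prop)
  have hm2 : Measurable fun U : β → ℝ => f (fiberPoint Q J π r U v) :=
    hff.comp measurable_prodMk_right
  set c : β → ℝ := fun j => if j ∈ J.erase j₀ then -fiberSum Q π v j else 0 with hc
  have hadd : Measurable fun w : β → ℝ => w + c := by fun_prop
  have hm3 : Measurable fun w : β → ℝ =>
      f (tieOff Q (r j₀) (v + fiberSum (J.erase j₀) r w)) :=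
    hm.comp (measurable_fiberSum _ _)
  rw [← coordVolume_map_fiberSum hinj', lintegral_map hm (measurable_fiberSum _ _), hyperVolume,
    lintegral_map hm2 (measurable_tieOff _ _),
    ← coordVolume_map_add (I := J.erase j₀) (c := c) (fun q hq => if_neg hq),
    lintegral_map hm3 hadd,
    coordVolume_map_add (I := J.erase j₀) (c := c) (fun q hq => if_neg hq)]
  refine lintegral_congr_ae ?_
  filter_upwards [coordVolume_ae (J.erase j₀)] with u hu
  refine congrArg f ?_
  have hu0 : u j₀ = 0 := hu j₀ (by simp)
  have hfs : ∀ (w : β → ℝ) j, j ∈ J → fiberSum (J.erase j₀) r w (r j) =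
      if j = j₀ then 0 else w j := fun w j hj => by
    unfold fiberSum
    split_ifs with h
    · subst h
      rw [Finset.filter_eq_empty_iff.mpr, Finset.sum_empty]
      intro i hi e
      rw [Finset.mem_erase] at hi
      exact hi.1 (hinj hi.2 hj e)
    · rw [Finset.sum_eq_single j]
      · intro i hi hij
        rw [Finset.mem_filter, Finset.mem_erase] at hi
        exact absurd (hinj hi.1.2 hj hi.2) hij
      · intro h'
        exact absurd (Finset.mem_filter.mpr ⟨Finset.mem_erase.mpr ⟨h, hj⟩, rfl⟩ :
          j ∈ (J.erase j₀).filter fun i => r i = r j) h'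
  have hfs0 : ∀ (w : β → ℝ) q, q ∉ J.image r → fiberSum (J.erase j₀) r w q = 0 := fun w q hq => by
    rw [fiberSum, Finset.filter_eq_empty_iff.mpr, Finset.sum_empty]
    intro i hi e
    exact hq (Finset.mem_image.mpr ⟨i, Finset.mem_of_mem_erase hi, e⟩)
  -- the sum over all of `Q` splits into the sums over the fibres
  have hsumv : ∑ q ∈ Q, v q = ∑ j ∈ J, fiberSum Q π v j := by
    unfold fiberSum
    rw [Finset.sum_fiberwise_of_maps_to hπ]
  have hsum : ∑ q ∈ Q, fiberSum (J.erase j₀) r (u + c) q = ∑ j ∈ J.erase j₀, (u + c) j := by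
    unfold fiberSum
    rw [Finset.sum_fiberwise_of_maps_to]
    intro i hi
    exact (hr i (Finset.mem_of_mem_erase hi)).1
  have hsumu : ∑ j ∈ J, u j = ∑ j ∈ J.erase j₀, u j := by
    rw [← Finset.sum_erase_add _ _ hj₀, hu0, add_zero]
  have hsumc : ∑ j ∈ J.erase j₀, c j = -∑ j ∈ J.erase j₀, fiberSum Q π v j := by
    rw [← Finset.sum_neg_distrib]
    exact Finset.sum_congr rfl fun j hj => if_pos hj
  have hfp : ∀ (W : β → ℝ) (q : α), (∑ j ∈ J, (Pi.single (r j) (W j) : α → ℝ)) q =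
      ∑ j ∈ J, if q = r j then W j else 0 := fun W q => by
    rw [Finset.sum_apply]
    exact Finset.sum_congr rfl fun j _ => by rw [Pi.single_apply]
  funext q
  simp only [tieOff, fiberPoint, Pi.sub_apply, Pi.add_apply, hfp]
  rw [Finset.sum_add_distrib, hsum, hsumv]
  by_cases hq : q ∈ J.image r
  · obtain ⟨j, hj, rfl⟩ := Finset.mem_image.mp hq
    have hvq : v (r j) = 0 := hv _ fun h => (Finset.mem_sdiff.mp h).2 hq
    rw [Finset.sum_eq_single_of_mem j hj fun i hi hij => if_neg fun e => hij (hinj hj hi e).symm,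
      if_pos rfl, hfs _ j hj, hvq]
    by_cases hjj : j = j₀
    · subst hjj
      simp only [Pi.add_apply, Finset.sum_add_distrib, hsumc, hsumu, hu0, if_true,
        Pi.single_eq_same]
      rw [← Finset.sum_erase_add _ _ hj]
      ring
    · have hrj : r j ≠ r j₀ := fun e => hjj (hinj hj hj₀ e)
      simp [hjj, hrj, hc, hj]
      ring
  · have hqj : ∀ j ∈ J, q ≠ r j := fun j hj e => hq (Finset.mem_image.mpr ⟨j, hj, e.symm⟩)
    rw [hfs0 _ q hq, Finset.sum_eq_zero fun j hj => if_neg (hqj j hj)]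
    simp [hqj j₀ hj₀]

end HyperVolume

/-- The collapse of an integral over a hyperplane of `ℝ^Q` along a map `π : Q → J`: an integrand
that is a product of functions of the coordinates in one fibre each, times a function of the sums
over the fibres, can be integrated over the fibres first. -/
theorem integral_hyperVolume_collapse {α β : Type} [Fintype α] [DecidableEq α] [Fintype β]
    [DecidableEq β] {Q : Finset α} {J : Finset β} {π : α → β}
    (hπ : ∀ q ∈ Q, π q ∈ J) (hsurj : ∀ j ∈ J, ∃ q ∈ Q, π q = j)
    {q₀ : α} {j₀ : β} (hq₀ : q₀ ∈ Q) (hj₀ : j₀ ∈ J)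
    {H : (β → ℝ) → ℂ} (hH : Measurable H) {f : β → (α → ℝ) → ℂ} (hf : ∀ j ∈ J, Measurable (f j))
    (hdep : ∀ j ∈ J, ∀ w w' : α → ℝ, (∀ q ∈ Q, π q = j → w q = w' q) → f j w = f j w')
    {Φ : β → ℝ → ℂ}
    (hΦ : ∀ j ∈ J, ∀ r ∈ Q.filter (fun q => π q = j), ∀ U : ℝ,
      ∫ w, f j (w + (Pi.single r U : α → ℝ)) ∂hyperVolume (Q.filter fun q => π q = j) r = Φ j U)
    (hint : Integrable (fun w => H (fiberSum Q π w) * ∏ j ∈ J, f j w) (hyperVolume Q q₀)) :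
    ∫ w, H (fiberSum Q π w) * ∏ j ∈ J, f j w ∂hyperVolume Q q₀ =
      ∫ U, H U * ∏ j ∈ J, Φ j (U j) ∂hyperVolume J j₀ := by
  classical
  have hex : ∀ j, ∃ q, j ∈ J → q ∈ Q ∧ π q = j := fun j => by
    by_cases hj : j ∈ J
    · obtain ⟨q, hq, h⟩ := hsurj j hj
      exact ⟨q, fun _ => ⟨hq, h⟩⟩
    · exact ⟨q₀, fun h => absurd h hj⟩
  choose r hr using hex
  have hinj : Set.InjOn r J := fun i hi j hj h => by rw [← (hr i hi).2, h, (hr j hj).2]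
  have hrq : ∀ j ∈ J, ∀ q, π q = j → q ≠ r j → q ∉ J.image r := fun j hj q hq hne h => by
    obtain ⟨i, hi, rfl⟩ := Finset.mem_image.mp h
    rw [(hr i hi).2] at hq
    exact hne (hq ▸ rfl)
  have hgm : Measurable fun w => H (fiberSum Q π w) * ∏ j ∈ J, f j w :=
    (hH.comp (measurable_fiberSum Q π)).mul (Finset.measurable_prod _ fun j hj => hf j hj)
  have hfp := measurable_fiberPoint Q J π r
  rw [hyperVolume_eq hq₀ (hr j₀ hj₀).1, hyperVolume_fiber hπ hr hj₀] at hint ⊢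
  rw [integrable_map_measure hgm.aestronglyMeasurable hfp.aemeasurable] at hint
  rw [integral_map hfp.aemeasurable hgm.aestronglyMeasurable,
    integral_prod _ (by simpa [Function.comp_def] using hint)]
  refine integral_congr_ae ?_
  filter_upwards [hyperVolume_ae hj₀] with U hU
  -- the coordinates of the point assembled from `U` and `v`
  have hpt : ∀ v : α → ℝ, (∀ q ∉ Q \ J.image r, v q = 0) → ∀ j ∈ J, ∀ q ∈ Q, π q = j →
      fiberPoint Q J π r U v q =
        (tieOff (Q.filter fun q => π q = j) (r j) v + (Pi.single (r j) (U j) : α → ℝ)) q := by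
    intro v hv j hj q hq hqj
    have hsum : (∑ i ∈ J, (Pi.single (r i) (U i - fiberSum Q π v i) : α → ℝ)) q =
        ∑ i ∈ J, if q = r i then U i - fiberSum Q π v i else 0 := by
      rw [Finset.sum_apply]
      exact Finset.sum_congr rfl fun i _ => by rw [Pi.single_apply]
    have hsum2 : (∑ i ∈ J, if q = r i then U i - fiberSum Q π v i else 0) =
        if q = r j then U j - fiberSum Q π v j else 0 := by
      refine Finset.sum_eq_single_of_mem j hj fun i hi hij => if_neg fun e => hij ?_
      rw [← hqj, e, (hr i hi).2]
    simp only [fiberPoint, tieOff, Pi.add_apply, Pi.sub_apply, hsum, hsum2, Pi.single_apply]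
    split_ifs with h
    · unfold fiberSum; ring
    · simp
  have hfs : ∀ v : α → ℝ, (∀ q ∉ Q \ J.image r, v q = 0) →
      fiberSum Q π (fiberPoint Q J π r U v) = U := by
    intro v hv
    funext j
    by_cases hj : j ∈ J
    · have hmem : r j ∈ Q.filter fun q => π q = j := Finset.mem_filter.mpr (hr j hj)
      have : fiberSum Q π (fiberPoint Q J π r U v) j = ∑ q ∈ Q.filter (fun q => π q = j),
          (tieOff (Q.filter fun q => π q = j) (r j) v + (Pi.single (r j) (U j) : α → ℝ)) q :=
        Finset.sum_congr rfl fun q hq =>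
          hpt v hv j hj q (Finset.mem_filter.mp hq).1 (Finset.mem_filter.mp hq).2
      rw [this]
      simp only [Pi.add_apply, Finset.sum_add_distrib]
      rw [sum_tieOff hmem, Finset.sum_pi_single', if_pos hmem, zero_add]
    · rw [hU.1 j hj]
      unfold fiberSum
      refine Finset.sum_eq_zero fun q hq => ?_
      rw [Finset.mem_filter] at hq
      exact absurd (hq.2 ▸ hπ q hq.1) hj
  set g : β → (α → ℝ) → ℂ := fun j v =>
    f j (tieOff (Q.filter fun q => π q = j) (r j) v + (Pi.single (r j) (U j) : α → ℝ)) with hg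
  have hgj : ∀ j ∈ J, Measurable (g j) := fun j hj =>
    (hf j hj).comp ((measurable_tieOff _ _).add_const _)
  have hae : ∀ᵐ v ∂coordVolume (Q \ J.image r),
      H (fiberSum Q π (fiberPoint Q J π r U v)) * ∏ j ∈ J, f j (fiberPoint Q J π r U v) =
        H U * ∏ j ∈ J, g j v := by
    filter_upwards [coordVolume_ae (Q \ J.image r)] with v hv
    rw [hfs v hv]
    congr 1
    exact Finset.prod_congr rfl fun j hj => hdep j hj _ _ (hpt v hv j hj)
  rw [integral_congr_ae hae, integral_const_mul,
    integral_coordVolume_prod J π g hgj (Q \ J.image r)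
      (fun q hq => hπ q (Finset.mem_sdiff.mp hq).1)]
  · congr 1
    refine Finset.prod_congr rfl fun j hj => ?_
    have hset : (Q \ J.image r).filter (fun q => π q = j) =
        (Q.filter fun q => π q = j).erase (r j) := by
      ext q
      simp only [Finset.mem_filter, Finset.mem_sdiff, Finset.mem_erase]
      constructor
      · rintro ⟨⟨h1, h2⟩, h3⟩
        exact ⟨fun e => h2 (e ▸ Finset.mem_image_of_mem r hj), h1, h3⟩
      · rintro ⟨h1, h2, h3⟩
        exact ⟨⟨h2, hrq j hj q h3 h1⟩, h3⟩
    have hm : Measurable fun w => f j (w + (Pi.single (r j) (U j) : α → ℝ)) :=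
      (hf j hj).comp (by fun_prop)
    rw [hset, ← hΦ j hj (r j) (Finset.mem_filter.mpr (hr j hj)) (U j), hyperVolume,
      integral_map (measurable_tieOff _ _).aemeasurable hm.aestronglyMeasurable]
  · intro j hj w w' hww
    refine hdep j hj _ _ fun q hq hqj => ?_
    by_cases h : q = r j
    · subst h
      have hmem : r j ∈ Q.filter fun q => π q = j := Finset.mem_filter.mpr ⟨hq, hqj⟩
      simp only [tieOff, Pi.add_apply, Pi.sub_apply, Pi.single_eq_same]
      rw [Finset.sum_congr rfl fun p hp => hww p (Finset.mem_filter.mp hp).2, hww _ hqj]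
    · simp [tieOff, h, hww q hqj]

/-! ### Integrals of products of Beta functions -/

/-- The convolution integral of two Beta functions over an arbitrary vertical line through `z`. -/
theorem integral_bfn_convolution {z c p q : ℂ} (hz : 0 < z.re) (hzp : z.re < p.re)
    (hc : 0 < c.re) (hcq : c.re < q.re) :
    ∫ x : ℝ, bfn (z + Complex.I * x) p * bfn (c - Complex.I * x) q =
      2 * Real.pi * bfn (c + z) (p + q) := by
  rw [← integral_bfn_mul_bfn (a := z.re) (T := c + z) hz hzp (by simpa using hc)
    (by simpa using hcq), ← integral_add_right_eq_self (fun y : ℝ =>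
      bfn (z.re + Complex.I * y) p * bfn (c + z - (z.re + Complex.I * y)) q) z.im]
  congr 1
  funext x
  have h : (z.re : ℂ) + Complex.I * ((x + z.im : ℝ) : ℂ) = z + Complex.I * x := by
    conv_rhs => rw [← Complex.re_add_im z]
    push_cast; ring
  rw [h]
  ring_nf

section

variable {α : Type} [Fintype α] [DecidableEq α]

/-- Rapid decay of a product of Beta functions in each displacement `w q`, with a bound that is
uniform in the imaginary parts of the second arguments up to a polynomial factor. -/
theorem exists_prod_norm_bfn_le {α : Type} (n : ℕ) (P : Finset α) {z : α → ℂ} {ρ : α → ℝ}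
    (hz : ∀ q ∈ P, 0 < (z q).re) (hρ : ∀ q ∈ P, (z q).re < ρ q) :
    ∃ C : ℝ, 0 ≤ C ∧ ∀ (δ : α → ℂ) (w : α → ℝ), (∀ q ∈ P, (δ q).re = ρ q) →
      ∏ q ∈ P, ‖bfn (z q + Complex.I * w q) (δ q)‖ ≤
        C * ∏ q ∈ P, ((1 + |(δ q).im|) ^ n / (1 + |w q|) ^ n) := by
  have h : ∀ q, ∃ C : ℝ, 0 ≤ C ∧ (q ∈ P → ∀ (w : ℂ) (v : ℝ), w.re = ρ q →
      ‖bfn (z q + Complex.I * v) w‖ ≤ C * (1 + |w.im|) ^ n / (1 + |v|) ^ n) := fun q => by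
    by_cases hq : q ∈ P
    · obtain ⟨C, h0, h1⟩ := exists_norm_bfn_add_le n (hz q hq) (hρ q hq)
      exact ⟨C, h0, fun _ => h1⟩
    · exact ⟨0, le_rfl, fun h => absurd h hq⟩
  choose C hC0 hC using h
  refine ⟨∏ q ∈ P, C q, Finset.prod_nonneg fun q _ => hC0 q, fun δ w hδ => ?_⟩
  rw [← Finset.prod_mul_distrib]
  refine Finset.prod_le_prod (fun q _ => norm_nonneg _) fun q hq => ?_
  rw [← mul_div_assoc]
  exact hC q hq _ _ (hδ q hq)

/-- Barnes' first lemma, iterated over the independent coordinates `S`; the last Beta function carries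
the coordinate determined by the hyperplane. -/
theorem integral_coordVolume_prod_bfn (S : Finset α) {z b : α → ℂ}
    (hz : ∀ q ∈ S, 0 < (z q).re) (hb : ∀ q ∈ S, (z q).re < (b q).re) : ∀ {c d : ℂ},
    0 < c.re → c.re < d.re →
    ∫ w, (∏ q ∈ S, bfn (z q + Complex.I * w q) (b q)) * bfn (c - Complex.I * (∑ q ∈ S, w q : ℝ)) d
      ∂coordVolume S = (2 * Real.pi) ^ S.card * bfn (c + ∑ q ∈ S, z q) (d + ∑ q ∈ S, b q) := by
  induction S using Finset.induction_on with
  | empty => intro c d _ _; simp [coordVolume, measureReal_def]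
  | insert p S hp ih =>
    intro c d hc hd
    have hzS : ∀ q ∈ S, 0 < (z q).re := fun q hq => hz q (Finset.mem_insert_of_mem hq)
    have hbS : ∀ q ∈ S, (z q).re < (b q).re := fun q hq => hb q (Finset.mem_insert_of_mem hq)
    have hzp := hz p (Finset.mem_insert_self p S)
    have hbp := hb p (Finset.mem_insert_self p S)
    have hdisj : Disjoint S {p} := Finset.disjoint_singleton_right.mpr hp
    set F : (α → ℝ) → ℂ := fun w => (∏ q ∈ insert p S, bfn (z q + Complex.I * w q) (b q)) *
      bfn (c - Complex.I * (∑ q ∈ insert p S, w q : ℝ)) d with hF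
    have hFm : Measurable F := by
      refine (Finset.measurable_prod _ fun q _ => Measurable.bfn ?_ measurable_const).mul
        (Measurable.bfn ?_ measurable_const)
      · fun_prop
      · fun_prop
    have hFi : Integrable F (coordVolume (S ∪ {p})) := by
      obtain ⟨C, hC0, hC⟩ := exists_prod_norm_bfn_le 2 (insert p S) (ρ := fun q => (b q).re) hz hb
      obtain ⟨C', hC'⟩ := exists_norm_bfn_le hc hd
      rw [Finset.union_comm, ← Finset.insert_eq]
      refine integrable_coordVolume_of_le hFm.aestronglyMeasurable
        (C * (∏ q ∈ insert p S, (1 + |(b q).im|) ^ 2) * |C'|) (Filter.Eventually.of_forall fun w => ?_)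
      rw [hF, norm_mul, norm_prod]
      have h1 := hC b w fun q _ => rfl
      have h2 := (hC' (c - Complex.I * ((∑ q ∈ insert p S, w q : ℝ) : ℂ)) d
        (by simp only [Complex.sub_re, Complex.mul_re, Complex.I_re, Complex.I_im,
              Complex.ofReal_im, Complex.ofReal_re]; ring) rfl).trans (le_abs_self C')
      simp only [div_eq_mul_inv, Finset.prod_mul_distrib] at h1
      refine (mul_le_mul h1 h2 (norm_nonneg _) (by positivity)).trans (le_of_eq ?_)
      simp only [one_div]
      ring
    rw [coordVolume_union hdisj, integrable_map_measure hFm.aestronglyMeasurable (by fun_prop)] at hFi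
    replace hFi : Integrable (fun p : (α → ℝ) × (α → ℝ) => F (p.1 + p.2))
      ((coordVolume S).prod (coordVolume {p})) := hFi
    rw [Finset.insert_eq, Finset.union_comm, coordVolume_union hdisj, Finset.union_comm,
      ← Finset.insert_eq, integral_map (by fun_prop) hFm.aestronglyMeasurable, integral_prod _ hFi]
    have hae : ∀ᵐ v ∂coordVolume S, ∫ u, F (v + u) ∂coordVolume {p} =
        (2 * Real.pi) * ((∏ q ∈ S, bfn (z q + Complex.I * v q) (b q)) *
          bfn ((c + z p) - Complex.I * (∑ q ∈ S, v q : ℝ)) (d + b p)) := by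
      filter_upwards [coordVolume_ae S] with v hv
      have hm : Measurable fun u => F (v + u) := hFm.comp (by fun_prop)
      rw [coordVolume_singleton, integral_map (measurable_single_real p).aemeasurable
        hm.aestronglyMeasurable]
      have h1 : ∀ x : ℝ, F (v + (Pi.single p x : α → ℝ)) =
          (∏ q ∈ S, bfn (z q + Complex.I * v q) (b q)) *
            (bfn (z p + Complex.I * x) (b p) *
              bfn ((c - Complex.I * (∑ q ∈ S, v q : ℝ)) - Complex.I * x) d) := fun x => by
        have hS : ∀ q ∈ S, (v + (Pi.single p x : α → ℝ)) q = v q := fun q hq => by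
          have : q ≠ p := fun e => hp (e ▸ hq)
          simp [this]
        have hpx : (v + (Pi.single p x : α → ℝ)) p = x := by simp [hv p hp]
        simp only [hF]
        rw [Finset.prod_insert hp, Finset.sum_insert hp, hpx,
          Finset.prod_congr rfl fun q hq => by rw [hS q hq],
          Finset.sum_congr rfl fun q hq => by rw [hS q hq]]
        rw [show c - Complex.I * ((x + ∑ q ∈ S, v q : ℝ) : ℂ) =
          c - Complex.I * (∑ q ∈ S, v q : ℝ) - Complex.I * x by push_cast; ring]
        ring
      simp_rw [h1]
      have hre : (c - Complex.I * (∑ q ∈ S, v q : ℝ)).re = c.re := by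
        simp only [Complex.sub_re, Complex.mul_re, Complex.I_re, Complex.I_im, Complex.ofReal_im,
          Complex.ofReal_re]
        ring
      rw [integral_const_mul, integral_bfn_convolution hzp hbp (by rwa [hre]) (by rwa [hre])]
      rw [show c - Complex.I * (∑ q ∈ S, v q : ℝ) + z p = c + z p - Complex.I * (∑ q ∈ S, v q : ℝ)
        by ring, add_comm (b p) d]
      ring
    rw [integral_congr_ae hae, integral_const_mul, ih hzS hbS (c := c + z p) (d := d + b p)
      (by simp; linarith) (by simp; linarith), Finset.card_insert_of_notMem hp,
      Finset.sum_insert hp, Finset.sum_insert hp]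
    rw [pow_succ, add_assoc, add_assoc]
    ring

/-- The integral of a product of Beta functions over a hyperplane is a single Beta function. -/
theorem integral_hyperVolume_prod_bfn {P : Finset α} {r : α} (hr : r ∈ P) {z b : α → ℂ}
    (hz : ∀ q ∈ P, 0 < (z q).re) (hb : ∀ q ∈ P, (z q).re < (b q).re) (U : ℝ) :
    ∫ w, ∏ q ∈ P, bfn (z q + Complex.I * (w + Pi.single r U : α → ℝ) q) (b q) ∂hyperVolume P r =
      (2 * Real.pi) ^ (P.card - 1) * bfn (∑ q ∈ P, z q + Complex.I * U) (∑ q ∈ P, b q) := by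
  have hm : Measurable fun w : α → ℝ =>
      ∏ q ∈ P, bfn (z q + Complex.I * (w + Pi.single r U : α → ℝ) q) (b q) := by
    refine Finset.measurable_prod _ fun q _ => Measurable.bfn ?_ measurable_const
    simp only [Pi.add_apply]
    fun_prop
  rw [hyperVolume, integral_map (measurable_tieOff _ _).aemeasurable hm.aestronglyMeasurable]
  have hae : ∀ᵐ w ∂coordVolume (P.erase r),
      ∏ q ∈ P, bfn (z q + Complex.I * (tieOff P r w + Pi.single r U : α → ℝ) q) (b q) =
      (∏ q ∈ P.erase r, bfn (z q + Complex.I * w q) (b q)) *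
        bfn ((z r + Complex.I * U) - Complex.I * (∑ q ∈ P.erase r, w q : ℝ)) (b r) := by
    filter_upwards [coordVolume_ae (P.erase r)] with w hw
    rw [← Finset.prod_erase_mul _ _ hr]
    congr 1
    · refine Finset.prod_congr rfl fun q hq => ?_
      have := Finset.ne_of_mem_erase hq
      rw [Pi.add_apply, tieOff_of_ne _ _ this, Pi.single_eq_of_ne this, add_zero]
    · have hwr : w r = 0 := hw r (by simp)
      simp only [tieOff, Pi.add_apply, Pi.sub_apply, Pi.single_eq_same]
      rw [← Finset.sum_erase_add _ _ hr, hwr]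
      push_cast
      ring_nf
  rw [integral_congr_ae hae, integral_coordVolume_prod_bfn (P.erase r)
    (fun q hq => hz q (Finset.mem_of_mem_erase hq)) (fun q hq => hb q (Finset.mem_of_mem_erase hq))
    (by simpa using hz r hr) (by simpa using hb r hr), Finset.card_erase_of_mem hr,
    ← Finset.add_sum_erase _ _ hr, ← Finset.add_sum_erase _ _ hr]
  ring_nf

end

/-! ### Sums over pairs of legs -/

section Pairs

variable {Λ : Type} [DecidableEq Λ]

theorem mk_mem_pairs {A : Finset Λ} {i j : Λ} : s(i, j) ∈ pairs A ↔ i ∈ A ∧ j ∈ A ∧ i ≠ j := by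
  simp [pairs, and_assoc]

theorem pairs_insert {A : Finset Λ} {a : Λ} :
    pairs (insert a A) = pairs A ∪ (A.erase a).image fun i => s(a, i) := by
  ext q
  induction q using Sym2.ind with
  | _ i j =>
    simp only [mk_mem_pairs, Finset.mem_union, Finset.mem_image, Finset.mem_insert,
      Finset.mem_erase, Sym2.eq_iff]
    constructor
    · rintro ⟨rfl | hi, rfl | hj, hne⟩
      · exact absurd rfl hne
      · exact Or.inr ⟨j, ⟨hne.symm, hj⟩, Or.inl ⟨rfl, rfl⟩⟩
      · exact Or.inr ⟨i, ⟨hne, hi⟩, Or.inr ⟨rfl, rfl⟩⟩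
      · exact Or.inl ⟨hi, hj, hne⟩
    · rintro (⟨hi, hj, hne⟩ | ⟨k, ⟨hka, hk⟩, (⟨rfl, rfl⟩ | ⟨rfl, rfl⟩)⟩)
      · exact ⟨Or.inr hi, Or.inr hj, hne⟩
      · exact ⟨Or.inl rfl, Or.inr hk, hka.symm⟩
      · exact ⟨Or.inr hk, Or.inl rfl, hka⟩

theorem sum_sum_eq_pairs {M : Type} [CommSemiring M] (A : Finset Λ) (g : Sym2 Λ → M) :
    ∑ i ∈ A, ∑ j ∈ A, g s(i, j) = ∑ i ∈ A, g s(i, i) + 2 * ∑ q ∈ pairs A, g q := by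
  induction A using Finset.induction_on with
  | empty => simp [pairs]
  | insert a A ha ih =>
    have hdisj : Disjoint (pairs A) ((A.erase a).image fun i => s(a, i)) := by
      rw [Finset.disjoint_right]
      intro q hq hq'
      obtain ⟨i, -, rfl⟩ := Finset.mem_image.mp hq
      exact ha (mk_mem_pairs.mp hq').1
    rw [pairs_insert, Finset.sum_union hdisj, Finset.erase_eq_of_notMem ha, Finset.sum_image,
      Finset.sum_insert ha, Finset.sum_insert ha, Finset.sum_insert ha]
    · have h1 : ∑ i ∈ A, ∑ j ∈ insert a A, g s(i, j) =
          ∑ i ∈ A, g s(a, i) + ∑ i ∈ A, ∑ j ∈ A, g s(i, j) := by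
        rw [← Finset.sum_add_distrib]
        exact Finset.sum_congr rfl fun i _ => by rw [Finset.sum_insert ha, Sym2.eq_swap]
      rw [h1, ih]
      ring
    · exact fun i _ j _ h => Sym2.congr_right.mp h

theorem mandelstam_eq (A : Finset Λ) (δ : Sym2 Λ → ℂ) :
    mandelstam A δ = -∑ i ∈ A, ∑ j ∈ A, δ s(i, j) := by
  rw [mandelstam, sum_sum_eq_pairs, Finset.sum_neg_distrib]
  ring

theorem mandelstam_eq_sub {A : Finset Λ} {Δ : Λ → ℂ} {δ : Sym2 Λ → ℂ}
    (h : ∀ i ∈ A, δ s(i, i) = -Δ i) :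
    mandelstam A δ = ∑ i ∈ A, Δ i - 2 * ∑ q ∈ pairs A, δ q := by
  rw [mandelstam]
  congr 1
  exact Finset.sum_congr rfl fun i hi => by rw [h i hi, neg_neg]

/-- Complementary sets of legs have the same Mandelstam variable. -/
theorem IsMellin.mandelstam_compl {L X A B : Finset Λ} {Δ : Λ → ℂ} {δ : Sym2 Λ → ℂ}
    (h : IsMellin L X Δ δ) (hAB : Disjoint A B) (hL : A ∪ B = L) :
    mandelstam A δ = mandelstam B δ := by
  rw [mandelstam_eq, mandelstam_eq]
  have h1 : ∑ i ∈ A, ∑ j ∈ A, δ s(i, j) = -∑ i ∈ A, ∑ j ∈ B, δ s(i, j) := by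
    rw [← Finset.sum_neg_distrib]
    refine Finset.sum_congr rfl fun i hi => ?_
    have := h.row i (hL ▸ Finset.mem_union_left _ hi)
    rw [← hL, Finset.sum_union hAB] at this
    linear_combination this
  have h2 : ∑ i ∈ B, ∑ j ∈ B, δ s(i, j) = -∑ i ∈ B, ∑ j ∈ A, δ s(i, j) := by
    rw [← Finset.sum_neg_distrib]
    refine Finset.sum_congr rfl fun i hi => ?_
    have := h.row i (hL ▸ Finset.mem_union_right _ hi)
    rw [← hL, Finset.sum_union hAB] at this
    linear_combination this
  rw [h1, h2, Finset.sum_comm]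
  congr 2
  exact Finset.sum_congr rfl fun i _ => Finset.sum_congr rfl fun j _ => by rw [Sym2.eq_swap]

/-- The Mandelstam variable of the legs other than `a` is minus the diagonal entry of `a`. -/
theorem IsMellin.mandelstam_erase {L X : Finset Λ} {Δ : Λ → ℂ} {δ : Sym2 Λ → ℂ} {a : Λ}
    (h : IsMellin L X Δ δ) (ha : a ∈ L) : mandelstam (L.erase a) δ = -δ s(a, a) := by
  rw [h.mandelstam_compl (A := L.erase a) (B := {a}) (by simp)
    (by rw [Finset.union_comm, ← Finset.insert_eq, Finset.insert_erase ha]), mandelstam_eq]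
  simp

end Pairs

/-! ### Gluing integrals as integrals over a hyperplane -/

section Glue

variable {Λ : Type} [DecidableEq Λ]

/-- Displacements of the Mellin variables, from displacements of the integration variables: the
variable of an off-shell leg is one half of a diagonal entry. -/
noncomputable def spread (w : Sym2 Λ → ℝ) (q : Sym2 Λ) : ℝ := if q.IsDiag then 2 * w q else w q

/-- The point of the vertical contour through `τ` that is displaced by `w`. -/
noncomputable def contourAt (L : Finset Λ) (a : Λ) (τ : Sym2 Λ → ℂ) (w : Sym2 Λ → ℝ) (q : Sym2 Λ) : ℂ :=
  τ q + Complex.I *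
    ((if a ∈ q then
        -∑ i ∈ (L.erase a).filter (fun i => i ∈ q), ∑ j ∈ L.erase a, spread w s(i, j)
      else spread w q : ℝ) : ℂ)

/-- The arguments of the Beta functions of a gluing integral: the Mellin variables, and
`(Δ' b - s_b) / 2` for an off-shell leg `b`. -/
noncomputable def betaArg (Δ' : Λ → ℂ) (δ : Sym2 Λ → ℂ) (q : Sym2 Λ) : ℂ :=
  if q.IsDiag then (Sym2.lift ⟨fun i j => (Δ' i + Δ' j) / 2, fun i j => by
    show (Δ' i + Δ' j) / 2 = (Δ' j + Δ' i) / 2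
    rw [add_comm]⟩ q + δ q) / 2
  else δ q

theorem betaArg_diag (Δ' : Λ → ℂ) (δ : Sym2 Λ → ℂ) (b : Λ) :
    betaArg Δ' δ s(b, b) = (Δ' b + δ s(b, b)) / 2 := by
  simp [betaArg]

theorem betaArg_of_mem_pairs (Δ' : Λ → ℂ) (δ : Sym2 Λ → ℂ) {A : Finset Λ} {q : Sym2 Λ}
    (h : q ∈ pairs A) : betaArg Δ' δ q = δ q :=
  if_neg (Finset.mem_filter.mp h).2

/-- The integrand of a gluing integral as a function on the hyperplane of displacements. -/
noncomputable def lineIntegrand (Δ' : Λ → ℂ) (L X : Finset Λ) (a : Λ) (τ : Sym2 Λ → ℂ)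
    (M : (Sym2 Λ → ℂ) → ℂ) (δ : Sym2 Λ → ℂ) (w : Sym2 Λ → ℝ) : ℂ :=
  M (contourAt L a τ w) *
    ∏ q ∈ indexSet L X a, bfn (betaArg Δ' τ q + Complex.I * w q) (betaArg Δ' δ q)

theorem notMem_of_mem_pairs_erase {L : Finset Λ} {a : Λ} {q : Sym2 Λ}
    (h : q ∈ pairs (L.erase a)) : a ∉ q := by
  induction q using Sym2.ind with
  | _ i j =>
    obtain ⟨h1, h2, -⟩ := mk_mem_pairs.mp h
    rw [Sym2.mem_iff]
    rintro (rfl | rfl)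
    · exact Finset.notMem_erase a L h1
    · exact Finset.notMem_erase a L h2

theorem contourAt_of_mem_pairs {L : Finset Λ} {a : Λ} (τ : Sym2 Λ → ℂ) (w : Sym2 Λ → ℝ)
    {q : Sym2 Λ} (h : q ∈ pairs (L.erase a)) : contourAt L a τ w q = τ q + Complex.I * w q := by
  rw [contourAt, if_neg (notMem_of_mem_pairs_erase h), spread, if_neg (Finset.mem_filter.mp h).2]

theorem contourAt_diag {L : Finset Λ} {a b : Λ} (hb : b ≠ a) (τ : Sym2 Λ → ℂ) (w : Sym2 Λ → ℝ) :
    contourAt L a τ w s(b, b) = τ s(b, b) + Complex.I * (2 * w s(b, b)) := by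
  rw [contourAt, if_neg (by simpa using hb.symm), spread, if_pos (by simp)]
  push_cast; ring

theorem diag_notMem_pairs {A : Finset Λ} {b : Λ} : s(b, b) ∉ pairs A := by
  simp [mk_mem_pairs]

theorem indexSet_empty (L : Finset Λ) (a : Λ) : indexSet L ∅ a = pairs (L.erase a) := by
  simp [indexSet]

theorem prod_indexSet {M : Type} [CommMonoid M] (L X : Finset Λ) (a : Λ) (f : Sym2 Λ → M) :
    ∏ q ∈ indexSet L X a, f q = (∏ q ∈ pairs (L.erase a), f q) * ∏ b ∈ X, f s(b, b) := by
  rw [indexSet, Finset.prod_union, Finset.prod_image]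
  · intro b _ b' _ h
    simpa [Sym2.eq_iff] using h
  · rw [Finset.disjoint_right]
    intro q hq
    obtain ⟨b, -, rfl⟩ := Finset.mem_image.mp hq
    exact diag_notMem_pairs

theorem sum_indexSet {M : Type} [AddCommMonoid M] (L X : Finset Λ) (a : Λ) (f : Sym2 Λ → M) :
    ∑ q ∈ indexSet L X a, f q = ∑ q ∈ pairs (L.erase a), f q + ∑ b ∈ X, f s(b, b) := by
  rw [indexSet, Finset.sum_union, Finset.sum_image]
  · intro b _ b' _ h
    simpa [Sym2.eq_iff] using h
  · rw [Finset.disjoint_right]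
    intro q hq
    obtain ⟨b, -, rfl⟩ := Finset.mem_image.mp hq
    exact diag_notMem_pairs

theorem diag_mem_indexSet {L X : Finset Λ} {a b : Λ} : s(b, b) ∈ indexSet L X a ↔ b ∈ X := by
  simp [indexSet, diag_notMem_pairs]

theorem glueIntegrand_eq {Δ' : Λ → ℂ} {L X : Finset Λ} {a : Λ} (ha : a ∉ X) (τ : Sym2 Λ → ℂ)
    (q₀ : Sym2 Λ) (M : (Sym2 Λ → ℂ) → ℂ) (δ : Sym2 Λ → ℂ)
    (y : {q // q ∈ (indexSet L X a).erase q₀} → ℝ) :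
    glueIntegrand Δ' L X a τ q₀ M δ y =
      lineIntegrand Δ' L X a τ M δ (increment (indexSet L X a) q₀ y) := by
  have h : contourPoint L X a τ q₀ y = contourAt L a τ (increment (indexSet L X a) q₀ y) := rfl
  rw [glueIntegrand, lineIntegrand, h, mul_assoc, prod_indexSet]
  congr 2
  · exact Finset.prod_congr rfl fun q hq => by
      rw [contourAt_of_mem_pairs _ _ hq, betaArg_of_mem_pairs _ _ hq, betaArg_of_mem_pairs _ _ hq]
  · refine Finset.prod_congr rfl fun b hb => ?_
    rw [contourAt_diag (fun e : b = a => ha (e ▸ hb)), betaArg_diag, betaArg_diag]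
    congr 1
    ring

theorem contourAt_re (L : Finset Λ) (a : Λ) (τ : Sym2 Λ → ℂ) (w : Sym2 Λ → ℝ) (q : Sym2 Λ) :
    (contourAt L a τ w q).re = (τ q).re := by
  simp [contourAt]

theorem measurable_contourAt (L : Finset Λ) (a : Λ) (τ : Sym2 Λ → ℂ) :
    Measurable (contourAt L a τ) := by
  refine measurable_pi_lambda _ fun q => ?_
  have hs : ∀ q, Measurable fun w : Sym2 Λ → ℝ => spread w q := fun q => by
    unfold spread
    split_ifs <;> fun_prop
  unfold contourAt
  refine measurable_const.add (measurable_const.mul (Complex.measurable_ofReal.comp ?_))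
  split_ifs
  · exact (Finset.measurable_sum _ fun i _ => Finset.measurable_sum _ fun j _ => hs _).neg
  · exact hs q

/-- The displaced point satisfies the constraints of the Mellin variables. -/
theorem IsMellin.contourAt {L X : Finset Λ} {Δ : Λ → ℂ} {a : Λ} {τ : Sym2 Λ → ℂ}
    (h : IsMellin L X Δ τ) (haX : a ∉ X) (haL : a ∈ L) (hX : X ⊆ L) {w : Sym2 Λ → ℝ}
    (hw : ∀ q ∉ indexSet L X a, w q = 0) (hw0 : ∑ q ∈ indexSet L X a, w q = 0) :
    IsMellin L X Δ (contourAt L a τ w) := by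
  have hdiag : ∀ i, i ∉ X → spread w s(i, i) = 0 := fun i hi => by
    rw [spread, if_pos (by simp), hw _ (fun h' => hi (diag_mem_indexSet.mp h')), mul_zero]
  have hia : ∀ i ∈ L.erase a, Witten.contourAt L a τ w s(i, a) =
      τ s(i, a) + Complex.I * ((-∑ j ∈ L.erase a, spread w s(i, j) : ℝ) : ℂ) := fun i hi => by
    have hf : (L.erase a).filter (fun k => k ∈ s(i, a)) = {i} := by
      ext k
      simp only [Finset.mem_filter, Finset.mem_erase, Sym2.mem_iff, Finset.mem_singleton]
      constructor
      · rintro ⟨⟨h1, -⟩, h2 | h2⟩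
        · exact h2
        · exact absurd h2 h1
      · rintro rfl
        exact ⟨Finset.mem_erase.mp hi, Or.inl rfl⟩
    rw [Witten.contourAt, if_pos (by simp), hf, Finset.sum_singleton]
  have hij : ∀ i ∈ L.erase a, ∀ j ∈ L.erase a, Witten.contourAt L a τ w s(i, j) =
      τ s(i, j) + Complex.I * ((spread w s(i, j) : ℝ) : ℂ) := fun i hi j hj => by
    rw [Witten.contourAt, if_neg]
    rw [Sym2.mem_iff]
    rintro (rfl | rfl)
    · exact Finset.notMem_erase a L hi
    · exact Finset.notMem_erase a L hj
  have haa : Witten.contourAt L a τ w s(a, a) = τ s(a, a) := by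
    have hf : (L.erase a).filter (fun k => k ∈ s(a, a)) = ∅ := by
      refine Finset.filter_eq_empty_iff.mpr fun k hk => ?_
      simpa using Finset.ne_of_mem_erase hk
    rw [Witten.contourAt, if_pos (by simp), hf]
    simp
  refine ⟨fun i hi => ?_, fun i hi hiX => ?_⟩
  · have hrow := h.row i hi
    rw [← Finset.sum_erase_add _ _ haL] at hrow ⊢
    by_cases hia' : i = a
    · subst hia'
      have h1 : ∀ j ∈ L.erase i, Witten.contourAt L i τ w s(i, j) =
          τ s(i, j) + Complex.I * ((-∑ k ∈ L.erase i, spread w s(j, k) : ℝ) : ℂ) := fun j hj => by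
        rw [Sym2.eq_swap, hia j hj]
      have h2 : ∑ j ∈ L.erase i, ∑ k ∈ L.erase i, spread w s(j, k) = 0 := by
        rw [sum_sum_eq_pairs]
        have h3 : ∑ q ∈ pairs (L.erase i), spread w q = ∑ q ∈ pairs (L.erase i), w q :=
          Finset.sum_congr rfl fun q hq => if_neg (Finset.mem_filter.mp hq).2
        have h4 : ∑ j ∈ L.erase i, spread w s(j, j) = ∑ j ∈ X, spread w s(j, j) := by
          refine (Finset.sum_subset (fun j hj => Finset.mem_erase.mpr
            ⟨fun e : j = i => haX (e ▸ hj), hX hj⟩) fun j _ hj => hdiag j hj).symm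
        have h5 : ∑ j ∈ X, spread w s(j, j) = 2 * ∑ j ∈ X, w s(j, j) := by
          rw [Finset.mul_sum]
          exact Finset.sum_congr rfl fun j _ => if_pos (by simp)
        rw [sum_indexSet] at hw0
        rw [h3, h4, h5]
        linarith
      rw [Finset.sum_congr rfl h1, Finset.sum_add_distrib, haa, ← Finset.mul_sum,
        ← Complex.ofReal_sum, Finset.sum_neg_distrib, h2]
      simpa using hrow
    · have hi' : i ∈ L.erase a := Finset.mem_erase.mpr ⟨hia', hi⟩
      rw [Finset.sum_congr rfl (hij i hi'), hia i hi', Finset.sum_add_distrib, ← Finset.mul_sum]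
      push_cast
      linear_combination hrow
  · by_cases hia' : i = a
    · subst hia'
      rw [haa, h.diag i hi hiX]
    · have hi' : i ∈ L.erase a := Finset.mem_erase.mpr ⟨hia', hi⟩
      rw [hij i hi' i hi', hdiag i hiX, h.diag i hi hiX]
      simp

theorem measurable_betaArg (Δ' : Λ → ℂ) (q : Sym2 Λ) : Measurable fun δ => betaArg Δ' δ q := by
  unfold betaArg
  split_ifs <;> fun_prop

theorem measurable_lineIntegrand₂ {Δ' : Λ → ℂ} {L X : Finset Λ} {a : Λ} {τ : Sym2 Λ → ℂ}
    {M : (Sym2 Λ → ℂ) → ℂ} (hM : Measurable M) :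
    Measurable fun p : (Sym2 Λ → ℂ) × (Sym2 Λ → ℝ) => lineIntegrand Δ' L X a τ M p.1 p.2 := by
  unfold lineIntegrand
  refine (hM.comp ((measurable_contourAt L a τ).comp measurable_snd)).mul
    (Finset.measurable_prod _ fun q _ => Measurable.bfn ?_ ?_)
  · fun_prop
  · exact (measurable_betaArg Δ' q).comp measurable_fst

theorem measurable_lineIntegrand {Δ' : Λ → ℂ} {L X : Finset Λ} {a : Λ} {τ : Sym2 Λ → ℂ}
    {M : (Sym2 Λ → ℂ) → ℂ} (hM : Measurable M) (δ : Sym2 Λ → ℂ) :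
    Measurable (lineIntegrand Δ' L X a τ M δ) := by
  have h := (measurable_lineIntegrand₂ (Δ' := Δ') (L := L) (X := X) (a := a) (τ := τ) hM).comp
    (measurable_prodMk_left (x := δ))
  exact h

variable [Fintype Λ]

/-- The parametrization of the contour by independent variables carries Lebesgue measure to the
measure on the hyperplane. -/
theorem map_increment {Q : Finset (Sym2 Λ)} {q₀ : Sym2 Λ} (h : q₀ ∈ Q) :
    Measurable (increment Q q₀) ∧
    (volume : Measure ({q // q ∈ Q.erase q₀} → ℝ)).map (increment Q q₀) = hyperVolume Q q₀ := by
  have h1 := coordVolume_map_fiberSum (I := (Finset.univ : Finset {q // q ∈ Q.erase q₀}))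
    (s := Subtype.val) (Subtype.val_injective.injOn)
  have himg : (Finset.univ : Finset {q // q ∈ Q.erase q₀}).image Subtype.val = Q.erase q₀ := by
    ext q; simp
  rw [himg, coordVolume_univ] at h1
  have hext : ∀ (y : {q // q ∈ Q.erase q₀} → ℝ) q, fiberSum Finset.univ Subtype.val y q =
      if hq : q ∈ Q.erase q₀ then y ⟨q, hq⟩ else 0 := fun y q => by
    unfold fiberSum
    split_ifs with hq
    · rw [Finset.sum_eq_single ⟨q, hq⟩]
      · intro p hp hne
        exact absurd (Subtype.ext (Finset.mem_filter.mp hp).2) hne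
      · intro h'
        exact absurd (Finset.mem_filter.mpr ⟨Finset.mem_univ _, rfl⟩ :
          (⟨q, hq⟩ : {q // q ∈ Q.erase q₀}) ∈ Finset.univ.filter fun p => p.val = q) h'
    · refine Finset.sum_eq_zero fun p hp => absurd ?_ hq
      exact (Finset.mem_filter.mp hp).2 ▸ p.2
  have hsum : ∀ y : {q // q ∈ Q.erase q₀} → ℝ,
      ∑ q ∈ Q, fiberSum Finset.univ Subtype.val y q = ∑ p, y p := fun y => by
    unfold fiberSum
    rw [Finset.sum_fiberwise_of_maps_to]
    intro p _
    exact Finset.mem_of_mem_erase p.2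
  have hinc : increment Q q₀ = tieOff Q q₀ ∘ fiberSum Finset.univ Subtype.val := by
    funext y q
    rw [Function.comp_apply, tieOff, Pi.sub_apply, hsum, hext, increment]
    by_cases hq : q ∈ Q.erase q₀
    · simp [hq, Finset.ne_of_mem_erase hq]
    · by_cases hq' : q = q₀
      · subst hq'; simp
      · simp [hq, hq']
  constructor
  · rw [hinc]; exact (measurable_tieOff _ _).comp (measurable_fiberSum _ _)
  · rw [hinc, ← Measure.map_map (measurable_tieOff _ _) (measurable_fiberSum _ _), h1]
    rfl

/-- A gluing integral is an integral over a hyperplane.  The exponent of `2π` is the number of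
independent variables, one less than the number of coordinates. -/
theorem glueIntegral_eq {Δ' : Λ → ℂ} {L X : Finset Λ} {a : Λ} (ha : a ∉ X) {τ : Sym2 Λ → ℂ}
    {q₀ : Sym2 Λ} (hq₀ : q₀ ∈ indexSet L X a) {M : (Sym2 Λ → ℂ) → ℂ} (hM : Measurable M)
    (δ : Sym2 Λ → ℂ) :
    glueIntegral Δ' L X a τ q₀ M δ =
      (∫ w, lineIntegrand Δ' L X a τ M δ w ∂hyperVolume (indexSet L X a) q₀) /
        (2 * (Real.pi : ℂ)) ^ ((indexSet L X a).card - 1) := by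
  obtain ⟨hm, hv⟩ := map_increment hq₀
  rw [glueIntegral, ← hv, integral_map hm.aemeasurable
    (measurable_lineIntegrand hM δ).aestronglyMeasurable, Finset.card_erase_of_mem hq₀]
  simp_rw [glueIntegrand_eq ha]

theorem integrable_glueIntegrand_iff {Δ' : Λ → ℂ} {L X : Finset Λ} {a : Λ} (ha : a ∉ X)
    {τ : Sym2 Λ → ℂ} {q₀ : Sym2 Λ} (hq₀ : q₀ ∈ indexSet L X a) {M : (Sym2 Λ → ℂ) → ℂ}
    (hM : Measurable M) (δ : Sym2 Λ → ℂ) :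
    Integrable (glueIntegrand Δ' L X a τ q₀ M δ) ↔
      Integrable (lineIntegrand Δ' L X a τ M δ) (hyperVolume (indexSet L X a) q₀) := by
  obtain ⟨hm, hv⟩ := map_increment hq₀
  rw [← hv, integrable_map_measure (measurable_lineIntegrand hM δ).aestronglyMeasurable
    hm.aemeasurable]
  have : glueIntegrand Δ' L X a τ q₀ M δ =
      lineIntegrand Δ' L X a τ M δ ∘ increment (indexSet L X a) q₀ :=
    funext fun y => glueIntegrand_eq ha τ q₀ M δ y
  rw [this]

theorem measurable_glueIntegral {Δ' : Λ → ℂ} {L X : Finset Λ} {a : Λ} (ha : a ∉ X)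
    {τ : Sym2 Λ → ℂ} {q₀ : Sym2 Λ} (hq₀ : q₀ ∈ indexSet L X a) {M : (Sym2 Λ → ℂ) → ℂ}
    (hM : Measurable M) : Measurable (glueIntegral Δ' L X a τ q₀ M) := by
  have h : glueIntegral Δ' L X a τ q₀ M = fun δ =>
      (∫ w, lineIntegrand Δ' L X a τ M δ w ∂hyperVolume (indexSet L X a) q₀) /
        (2 * (Real.pi : ℂ)) ^ ((indexSet L X a).card - 1) :=
    funext fun δ => glueIntegral_eq ha hq₀ hM δ
  rw [h]
  exact ((measurable_lineIntegrand₂ hM).stronglyMeasurable.integral_prod_right'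
    (ν := hyperVolume (indexSet L X a) q₀)).measurable.div_const _

end Glue

/-! ### Growth and absolute convergence -/

section Growth

variable {Λ : Type} [DecidableEq Λ]

theorem one_add_sum_le_prod {α : Type} (S : Finset α) (x : α → ℝ) (hx : ∀ q, 0 ≤ x q) :
    1 + ∑ q ∈ S, x q ≤ ∏ q ∈ S, (1 + x q) := by
  classical
  induction S using Finset.induction_on with
  | empty => simp
  | insert p S hp ih =>
    rw [Finset.sum_insert hp, Finset.prod_insert hp]
    have : 0 ≤ ∑ q ∈ S, x q := Finset.sum_nonneg fun q _ => hx q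
    nlinarith [hx p]

/-- Polynomial growth along the vertical contour with real parts `ρ`, for functions of Mellin
variables in which the legs in `X` are off shell. -/
def GrowsAlong (L X : Finset Λ) (Δ : Λ → ℂ) (M : (Sym2 Λ → ℂ) → ℂ) (ρ : Sym2 Λ → ℝ) : Prop :=
  ∃ (C : ℝ) (N : ℕ), ∀ τ : Sym2 Λ → ℂ, IsMellin L X Δ τ → (∀ q ∈ L.sym2, (τ q).re = ρ q) →
    ‖M τ‖ ≤ C * (1 + ∑ q ∈ L.sym2, |(τ q).im|) ^ N

/-- Along the contour all matrix entries are bounded by the independent variables, those other than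
`q₀`; hence a bound by a power of the entries is one by a power of the product. -/
theorem exists_contourAt_im_le {L X : Finset Λ} {a : Λ} (τ : Sym2 Λ → ℂ) {q₀ : Sym2 Λ}
    (hq₀ : q₀ ∈ indexSet L X a) :
    ∃ K : ℝ, 0 ≤ K ∧ ∀ w : Sym2 Λ → ℝ, (∀ q ∉ indexSet L X a, w q = 0) →
      ∑ q ∈ indexSet L X a, w q = 0 →
      1 + ∑ q ∈ L.sym2, |(contourAt L a τ w q).im| ≤
        K * ∏ q ∈ (indexSet L X a).erase q₀, (1 + |w q|) := by
  set Q := indexSet L X a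
  set n : ℝ := (L.card : ℝ)
  set T : ℝ := ∑ q ∈ L.sym2, |(τ q).im| with hT
  have hT0 : 0 ≤ T := Finset.sum_nonneg fun q _ => abs_nonneg _
  set m : ℝ := (L.sym2.card : ℝ)
  have hm0 : 0 ≤ m := Nat.cast_nonneg _
  refine ⟨(1 + T + m * (2 * n ^ 2 + 2)) * 2, by positivity, fun w hw hw0 => ?_⟩
  set S : ℝ := ∑ q ∈ Q, |w q| with hS
  set S' : ℝ := ∑ q ∈ Q.erase q₀, |w q| with hS'
  have hS0 : 0 ≤ S := Finset.sum_nonneg fun q _ => abs_nonneg _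
  have hwS : ∀ q, |w q| ≤ S := fun q => by
    by_cases hq : q ∈ Q
    · exact Finset.single_le_sum (f := fun q => |w q|) (fun q _ => abs_nonneg _) hq
    · rw [hw q hq, abs_zero]; exact hS0
  have hsp : ∀ q, |spread w q| ≤ 2 * S := fun q => by
    unfold spread
    split_ifs
    · rw [abs_mul, abs_two]; linarith [hwS q]
    · linarith [hwS q]
  have hdisp : ∀ q, |(contourAt L a τ w q).im| ≤ |(τ q).im| + (2 * n ^ 2 + 2) * S := fun q => by
    have him : (contourAt L a τ w q).im = (τ q).im + (if a ∈ q then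
        -∑ i ∈ (L.erase a).filter (fun i => i ∈ q), ∑ j ∈ L.erase a, spread w s(i, j)
        else spread w q) := by simp [contourAt]
    rw [him]
    refine (abs_add_le _ _).trans (add_le_add le_rfl ?_)
    split_ifs
    · rw [abs_neg]
      calc |∑ i ∈ (L.erase a).filter (fun i => i ∈ q), ∑ j ∈ L.erase a, spread w s(i, j)|
          ≤ ∑ i ∈ (L.erase a).filter (fun i => i ∈ q), ∑ j ∈ L.erase a, |spread w s(i, j)| :=
            (Finset.abs_sum_le_sum_abs _ _).trans
              (Finset.sum_le_sum fun i _ => Finset.abs_sum_le_sum_abs _ _)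
        _ ≤ ∑ i ∈ L, ∑ j ∈ L, |spread w s(i, j)| := by
            refine (Finset.sum_le_sum_of_subset_of_nonneg (t := L)
              ((Finset.filter_subset _ _).trans (Finset.erase_subset _ _)) fun i _ _ =>
              Finset.sum_nonneg fun j _ => abs_nonneg _).trans ?_
            exact Finset.sum_le_sum fun i _ => Finset.sum_le_sum_of_subset_of_nonneg
              (Finset.erase_subset _ _) fun j _ _ => abs_nonneg _
        _ ≤ ∑ i ∈ L, ∑ j ∈ L, 2 * S :=
            Finset.sum_le_sum fun i _ => Finset.sum_le_sum fun j _ => hsp _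
        _ = 2 * n ^ 2 * S := by simp [n]; ring
        _ ≤ (2 * n ^ 2 + 2) * S := by nlinarith
    · have := hsp q
      nlinarith [sq_nonneg n]
  have h1 : ∑ q ∈ L.sym2, |(contourAt L a τ w q).im| ≤ T + m * ((2 * n ^ 2 + 2) * S) := by
    refine (Finset.sum_le_sum fun q _ => hdisp q).trans (le_of_eq ?_)
    rw [Finset.sum_add_distrib, Finset.sum_const, nsmul_eq_mul]
  have h2 : S ≤ 2 * S' := by
    have h3 : S = S' + |w q₀| := (Finset.sum_erase_add _ _ hq₀).symm
    have h4 : w q₀ = -∑ q ∈ Q.erase q₀, w q := by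
      rw [← Finset.sum_erase_add _ _ hq₀] at hw0; linarith
    have h5 : |w q₀| ≤ S' := by
      rw [h4, abs_neg]; exact Finset.abs_sum_le_sum_abs _ _
    linarith
  have h6 : 1 + S' ≤ ∏ q ∈ Q.erase q₀, (1 + |w q|) :=
    one_add_sum_le_prod _ (fun q => |w q|) fun q => abs_nonneg _
  have hc : 0 ≤ m * (2 * n ^ 2 + 2) := by positivity
  calc 1 + ∑ q ∈ L.sym2, |(contourAt L a τ w q).im|
      ≤ (1 + T + m * (2 * n ^ 2 + 2)) * (1 + S) := by nlinarith
    _ ≤ (1 + T + m * (2 * n ^ 2 + 2)) * (2 * ∏ q ∈ Q.erase q₀, (1 + |w q|)) := by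
        refine mul_le_mul_of_nonneg_left ?_ (by positivity)
        linarith
    _ = _ := by ring

theorem betaArg_re {Δ' : Λ → ℂ} {δ : Sym2 Λ → ℂ} {q : Sym2 Λ} {ρ : Sym2 Λ → ℝ}
    (h : (δ q).re = ρ q) : (betaArg Δ' δ q).re = (betaArg Δ' (fun q => (ρ q : ℂ)) q).re := by
  unfold betaArg
  split_ifs <;> simp [h]

theorem betaArg_re_lt {Δ' : Λ → ℂ} {δ : Sym2 Λ → ℂ} {q : Sym2 Λ} {ρ : Sym2 Λ → ℝ}
    (h : (δ q).re < ρ q) : (betaArg Δ' δ q).re < (betaArg Δ' (fun q => (ρ q : ℂ)) q).re := by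
  unfold betaArg
  split_ifs
  · simpa using (by linarith)
  · simpa using h

theorem IsContour.betaArg_pos {Δ Δ' : Λ → ℂ} {L X : Finset Λ} {a : Λ} {τ : Sym2 Λ → ℂ}
    {q₀ : Sym2 Λ} (h : IsContour Δ Δ' L X a τ q₀) : ∀ q ∈ indexSet L X a,
    0 < (betaArg Δ' τ q).re := by
  intro q hq
  rw [indexSet, Finset.mem_union] at hq
  rcases hq with hq | hq
  · rw [betaArg_of_mem_pairs _ _ hq]; exact h.pos q hq
  · obtain ⟨b, hb, rfl⟩ := Finset.mem_image.mp hq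
    rw [betaArg_diag]
    have := h.pos_off b hb
    simpa using this

theorem IsContour.mem_indexSet {Δ Δ' : Λ → ℂ} {L X : Finset Λ} {a : Λ} {τ : Sym2 Λ → ℂ}
    {q₀ : Sym2 Λ} (h : IsContour Δ Δ' L X a τ q₀) : q₀ ∈ indexSet L X a :=
  Finset.mem_union_left _ h.mem

/-- The integrand of a gluing integral is bounded by a polynomial in the outer variables times an
integrable function of the displacements: the polynomial growth of `M` is beaten by the rapid decay
of the Beta functions. -/
theorem exists_norm_lineIntegrand_le {Δ Δ' : Λ → ℂ} {L X : Finset Λ} {a : Λ} {τ : Sym2 Λ → ℂ}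
    {q₀ : Sym2 Λ} (h : IsContour Δ Δ' L X a τ q₀) (haX : a ∉ X) (haL : a ∈ L) (hX : X ⊆ L)
    {M : (Sym2 Λ → ℂ) → ℂ} (hM : GrowsAlong L X Δ M fun q => (τ q).re) {ρ : Sym2 Λ → ℝ}
    (hρ : ∀ q ∈ indexSet L X a, (τ q).re < ρ q) :
    ∃ (C : ℝ) (N : ℕ), 0 ≤ C ∧ ∀ (δ : Sym2 Λ → ℂ) (w : Sym2 Λ → ℝ),
      (∀ q ∈ indexSet L X a, (δ q).re = ρ q) → (∀ q ∉ indexSet L X a, w q = 0) →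
      ∑ q ∈ indexSet L X a, w q = 0 →
      ‖lineIntegrand Δ' L X a τ M δ w‖ ≤
        C * (∏ q ∈ indexSet L X a, (1 + |(betaArg Δ' δ q).im|) ^ N) *
          ∏ q ∈ (indexSet L X a).erase q₀, 1 / (1 + |w q|) ^ 2 := by
  have hq₀ := h.mem_indexSet
  obtain ⟨K, hK0, hK⟩ := exists_contourAt_im_le (L := L) (X := X) (a := a) τ hq₀
  obtain ⟨C, N, hC⟩ := hM
  set Q := indexSet L X a
  obtain ⟨C', hC'0, hC'⟩ := exists_prod_norm_bfn_le (N + 2) Q (z := betaArg Δ' τ)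
    (ρ := fun q => (betaArg Δ' (fun q => (ρ q : ℂ)) q).re) h.betaArg_pos
    fun q hq => betaArg_re_lt (hρ q hq)
  refine ⟨|C| * K ^ N * C', N + 2, by positivity, fun δ w hδ hw hw0 => ?_⟩
  have h1 := hC _ (h.mellin.contourAt haX haL hX hw hw0) fun q _ => contourAt_re L a τ w q
  have h2 : ‖M (contourAt L a τ w)‖ ≤ |C| * (K * ∏ q ∈ Q.erase q₀, (1 + |w q|)) ^ N := by
    refine h1.trans ((mul_le_mul_of_nonneg_right (le_abs_self C) ?_).trans
      (mul_le_mul_of_nonneg_left (pow_le_pow_left₀ ?_ (hK w hw hw0) N) (abs_nonneg C)))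
    · positivity
    · positivity
  have h3 := hC' (betaArg Δ' δ) w fun q hq => betaArg_re (hδ q hq)
  rw [lineIntegrand, norm_mul, norm_prod]
  refine (mul_le_mul h2 h3 (Finset.prod_nonneg fun q _ => norm_nonneg _) (by positivity)).trans ?_
  have h4 : ∏ q ∈ Q, ((1 + |(betaArg Δ' δ q).im|) ^ (N + 2) / (1 + |w q|) ^ (N + 2)) =
      (∏ q ∈ Q, (1 + |(betaArg Δ' δ q).im|) ^ (N + 2)) *
        ((∏ q ∈ Q.erase q₀, 1 / (1 + |w q|) ^ (N + 2)) * (1 / (1 + |w q₀|) ^ (N + 2))) := by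
    rw [Finset.prod_erase_mul _ _ hq₀, ← Finset.prod_mul_distrib]
    exact Finset.prod_congr rfl fun q _ => by rw [mul_one_div]
  have h5 : (∏ q ∈ Q.erase q₀, (1 + |w q|)) ^ N * ∏ q ∈ Q.erase q₀, 1 / (1 + |w q|) ^ (N + 2) =
      ∏ q ∈ Q.erase q₀, 1 / (1 + |w q|) ^ 2 := by
    rw [← Finset.prod_pow, ← Finset.prod_mul_distrib]
    refine Finset.prod_congr rfl fun q _ => ?_
    have : (1 + |w q|) ≠ 0 := by positivity
    rw [pow_add]
    field_simp
  have h6 : 1 / (1 + |w q₀|) ^ (N + 2) ≤ 1 := by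
    rw [div_le_one (by positivity)]
    exact one_le_pow₀ (by linarith [abs_nonneg (w q₀)])
  rw [h4, mul_pow]
  calc |C| * (K ^ N * (∏ q ∈ Q.erase q₀, (1 + |w q|)) ^ N) *
        (C' * ((∏ q ∈ Q, (1 + |(betaArg Δ' δ q).im|) ^ (N + 2)) *
        ((∏ q ∈ Q.erase q₀, 1 / (1 + |w q|) ^ (N + 2)) * (1 / (1 + |w q₀|) ^ (N + 2)))))
      = |C| * K ^ N * C' * (∏ q ∈ Q, (1 + |(betaArg Δ' δ q).im|) ^ (N + 2)) *
        ((∏ q ∈ Q.erase q₀, (1 + |w q|)) ^ N * ∏ q ∈ Q.erase q₀, 1 / (1 + |w q|) ^ (N + 2)) *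
        (1 / (1 + |w q₀|) ^ (N + 2)) := by ring
    _ ≤ |C| * K ^ N * C' * (∏ q ∈ Q, (1 + |(betaArg Δ' δ q).im|) ^ (N + 2)) *
        ((∏ q ∈ Q.erase q₀, (1 + |w q|)) ^ N * ∏ q ∈ Q.erase q₀, 1 / (1 + |w q|) ^ (N + 2)) * 1 :=
        mul_le_mul_of_nonneg_left h6 (by positivity)
    _ = _ := by rw [mul_one, h5]

/-- Gluing integrals depend only on the Mellin variables of the legs that are not glued. -/
theorem glueIntegral_congr {Δ' : Λ → ℂ} {L X : Finset Λ} {a : Λ} (haX : a ∉ X) (τ : Sym2 Λ → ℂ)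
    (q₀ : Sym2 Λ) (M : (Sym2 Λ → ℂ) → ℂ) {δ δ' : Sym2 Λ → ℂ}
    (h : ∀ q ∈ indexSet L X a, δ q = δ' q) :
    glueIntegral Δ' L X a τ q₀ M δ = glueIntegral Δ' L X a τ q₀ M δ' := by
  unfold glueIntegral
  congr 2
  funext y
  rw [glueIntegrand_eq haX, glueIntegrand_eq haX, lineIntegrand, lineIntegrand]
  congr 1
  exact Finset.prod_congr rfl fun q hq => by unfold betaArg; rw [h q hq]

variable [Fintype Λ]

theorem integrable_lineIntegrand {Δ Δ' : Λ → ℂ} {L X : Finset Λ} {a : Λ} {τ : Sym2 Λ → ℂ}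
    {q₀ : Sym2 Λ} (h : IsContour Δ Δ' L X a τ q₀) (haX : a ∉ X) (haL : a ∈ L) (hX : X ⊆ L)
    {M : (Sym2 Λ → ℂ) → ℂ} (hMm : Measurable M) (hM : GrowsAlong L X Δ M fun q => (τ q).re)
    {δ : Sym2 Λ → ℂ} (hδ : Below (indexSet L X a) τ δ) :
    Integrable (lineIntegrand Δ' L X a τ M δ) (hyperVolume (indexSet L X a) q₀) := by
  obtain ⟨C, N, -, hC⟩ := exists_norm_lineIntegrand_le h haX haL hX hM
    (ρ := fun q => (δ q).re) hδ
  exact integrable_hyperVolume_of_le h.mem_indexSet (measurable_lineIntegrand hMm δ) _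
    fun w hw hw0 => hC δ w (fun _ _ => rfl) hw hw0

theorem integrable_glueIntegrand {Δ Δ' : Λ → ℂ} {L X : Finset Λ} {a : Λ} {τ : Sym2 Λ → ℂ}
    {q₀ : Sym2 Λ} (h : IsContour Δ Δ' L X a τ q₀) (haX : a ∉ X) (haL : a ∈ L) (hX : X ⊆ L)
    {M : (Sym2 Λ → ℂ) → ℂ} (hMm : Measurable M) (hM : GrowsAlong L X Δ M fun q => (τ q).re)
    {δ : Sym2 Λ → ℂ} (hδ : Below (indexSet L X a) τ δ) :
    Integrable (glueIntegrand Δ' L X a τ q₀ M δ) :=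
  (integrable_glueIntegrand_iff haX h.mem_indexSet hMm δ).mpr
    (integrable_lineIntegrand h haX haL hX hMm hM hδ)

/-- A gluing integral grows at most polynomially in the outer variables. -/
theorem exists_norm_glueIntegral_le {Δ Δ' : Λ → ℂ} {L X : Finset Λ} {a : Λ} {τ : Sym2 Λ → ℂ}
    {q₀ : Sym2 Λ} (h : IsContour Δ Δ' L X a τ q₀) (haX : a ∉ X) (haL : a ∈ L) (hX : X ⊆ L)
    {M : (Sym2 Λ → ℂ) → ℂ} (hMm : Measurable M) (hM : GrowsAlong L X Δ M fun q => (τ q).re)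
    {ρ : Sym2 Λ → ℝ} (hρ : ∀ q ∈ indexSet L X a, (τ q).re < ρ q) :
    ∃ (C : ℝ) (N : ℕ), 0 ≤ C ∧ ∀ δ : Sym2 Λ → ℂ, (∀ q ∈ indexSet L X a, (δ q).re = ρ q) →
      ‖glueIntegral Δ' L X a τ q₀ M δ‖ ≤
        C * (1 + ∑ q ∈ indexSet L X a, |(δ q).im|) ^ N := by
  have hq₀ := h.mem_indexSet
  obtain ⟨C, N, hC0, hC⟩ := exists_norm_lineIntegrand_le h haX haL hX hM hρ
  set Q := indexSet L X a
  set g : (Sym2 Λ → ℝ) → ℝ := fun w => ∏ q ∈ Q.erase q₀, 1 / (1 + |w q|) ^ 2 with hg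
  have hgi : Integrable g (hyperVolume Q q₀) := by
    have hgm : Measurable g := by fun_prop
    have h1 : Integrable (fun w => (g w : ℂ)) (hyperVolume Q q₀) :=
      integrable_hyperVolume_of_le hq₀ (Complex.measurable_ofReal.comp hgm) 1 fun w _ _ => by
        rw [Complex.norm_real, Real.norm_of_nonneg (Finset.prod_nonneg fun q _ => by positivity),
          one_mul]
    exact h1.re
  set d : Sym2 Λ → ℝ := fun q => (betaArg Δ' 0 q).im with hd
  have him : ∀ (δ : Sym2 Λ → ℂ) q, |(betaArg Δ' δ q).im| ≤ |d q| + |(δ q).im| := fun δ q => by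
    simp only [hd, betaArg]
    split_ifs
    · have h2 : ∀ x y : ℂ, ((x + y) / 2).im = x.im / 2 + y.im / 2 := fun x y => by
        simp; ring
      rw [h2, h2]
      refine (abs_add_le _ _).trans ?_
      simp only [Pi.zero_apply, Complex.zero_im, zero_div, add_zero]
      have : |(δ q).im / 2| ≤ |(δ q).im| := by
        rw [abs_div, abs_two]; linarith [abs_nonneg (δ q).im]
      linarith
    · simp
  set D : ℝ := ∏ q ∈ Q, (1 + |d q|)
  have hD0 : 0 ≤ D := Finset.prod_nonneg fun q _ => by positivity
  set I : ℝ := ∫ w, g w ∂hyperVolume Q q₀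
  have hI0 : 0 ≤ I := integral_nonneg fun w => Finset.prod_nonneg fun q _ => by positivity
  refine ⟨C * D ^ N * I / ‖(2 * (Real.pi : ℂ)) ^ (Q.card - 1)‖, Q.card * N, by positivity,
    fun δ hδ => ?_⟩
  have h1 : ∏ q ∈ Q, (1 + |(betaArg Δ' δ q).im|) ^ N ≤
      D ^ N * (1 + ∑ q ∈ Q, |(δ q).im|) ^ (Q.card * N) := by
    rw [Finset.prod_pow, pow_mul, ← mul_pow]
    refine pow_le_pow_left₀ (Finset.prod_nonneg fun q _ => by positivity) ?_ N
    rw [← Finset.prod_const, ← Finset.prod_mul_distrib]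
    refine Finset.prod_le_prod (fun q _ => by positivity) fun q hq => ?_
    have h2 : |(δ q).im| ≤ ∑ q ∈ Q, |(δ q).im| :=
      Finset.single_le_sum (f := fun q => |(δ q).im|) (fun q _ => abs_nonneg _) hq
    nlinarith [him δ q, abs_nonneg (d q), abs_nonneg (δ q).im]
  rw [glueIntegral_eq haX hq₀ hMm, norm_div]
  have h3 : ‖∫ w, lineIntegrand Δ' L X a τ M δ w ∂hyperVolume Q q₀‖ ≤
      C * (D ^ N * (1 + ∑ q ∈ Q, |(δ q).im|) ^ (Q.card * N)) * I := by
    have h4 : ‖∫ w, lineIntegrand Δ' L X a τ M δ w ∂hyperVolume Q q₀‖ ≤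
        ∫ w, C * (∏ q ∈ Q, (1 + |(betaArg Δ' δ q).im|) ^ N) * g w ∂hyperVolume Q q₀ := by
      refine norm_integral_le_of_norm_le (hgi.const_mul _) ?_
      filter_upwards [hyperVolume_ae hq₀] with w hw
      exact hC δ w hδ hw.1 hw.2
    rw [integral_const_mul] at h4
    exact h4.trans (mul_le_mul_of_nonneg_right (mul_le_mul_of_nonneg_left h1 hC0) hI0)
  rw [div_mul_eq_mul_div]
  gcongr
  exact h3.trans (le_of_eq (by ring))

end Growth

/-! ### Reproducing property of gluing integrals -/

section Reproduce

variable {Λ : Type} [DecidableEq Λ]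

/-- The product of the kernels of two successive gluing integrals: the intermediate variable `τ` is left
in one Beta function only. -/
theorem bfn_mul_bfn {σ τ δ : ℂ} (hτ : 0 < τ.re) (hδσ : σ.re < δ.re) :
    bfn σ τ * bfn τ δ = bfn σ δ * bfn (τ - σ) (δ - σ) := by
  have h1 : Complex.Gamma τ ≠ 0 := Complex.Gamma_ne_zero_of_re_pos hτ
  have h2 : Complex.Gamma (δ - σ) ≠ 0 :=
    Complex.Gamma_ne_zero_of_re_pos (by simpa using hδσ)
  simp only [bfn, sub_sub_sub_cancel_right]
  field_simp

/-- The point displaced from `z` in the imaginary direction by `w`. -/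
def shift {α : Type} (z : α → ℂ) (w : α → ℝ) (q : α) : ℂ := z q + Complex.I * w q

theorem measurable_shift {α : Type} (z : α → ℂ) : Measurable (shift z) :=
  measurable_pi_lambda _ fun q => by unfold shift; fun_prop

theorem shift_re {α : Type} (z : α → ℂ) (w : α → ℝ) (q : α) : (shift z w q).re = (z q).re := by
  simp [shift]

theorem lineIntegrand_empty (Δ' : Λ → ℂ) (L : Finset Λ) (a : Λ) (τ : Sym2 Λ → ℂ)
    (M : (Sym2 Λ → ℂ) → ℂ) (δ : Sym2 Λ → ℂ) (w : Sym2 Λ → ℝ) :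
    lineIntegrand Δ' L ∅ a τ M δ w =
      M (contourAt L a τ w) * ∏ q ∈ pairs (L.erase a), bfn (shift τ w q) (δ q) := by
  rw [lineIntegrand, indexSet_empty]
  congr 1
  exact Finset.prod_congr rfl fun q hq => by
    rw [betaArg_of_mem_pairs _ _ hq, betaArg_of_mem_pairs _ _ hq, shift]

variable [Fintype Λ]

/-- `N`, a function of the variables in `P`, is reproduced up to a Beta function of the sum of the
variables when it is integrated against the product of the Beta functions over a hyperplane. -/
structure Reproduces (P : Finset (Sym2 Λ)) (N : (Sym2 Λ → ℂ) → ℂ) (u : ℂ) (z : Sym2 Λ → ℂ) :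
    Prop where
  measurable : Measurable N
  depends : ∀ δ δ' : Sym2 Λ → ℂ, (∀ q ∈ P, δ q = δ' q) → N δ = N δ'
  integral : ∀ δ : Sym2 Λ → ℂ, Below P z δ → ∀ r ∈ P, ∀ U : ℝ,
    ∫ w, N (shift z (w + Pi.single r U)) *
      ∏ q ∈ P, bfn (shift z (w + Pi.single r U) q) (δ q) ∂hyperVolume P r =
    (2 * Real.pi) ^ (P.card - 1) * N δ * bfn (∑ q ∈ P, z q - u + Complex.I * U) (∑ q ∈ P, δ q - u)

/-- The constant function is reproduced: this is the iterated Barnes lemma. -/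
theorem reproduces_one {P : Finset (Sym2 Λ)} {z : Sym2 Λ → ℂ} (hz : ∀ q ∈ P, 0 < (z q).re) :
    Reproduces P (fun _ => 1) 0 z where
  measurable := measurable_const
  depends _ _ _ := rfl
  integral δ hδ r hr U := by
    simpa [shift] using integral_hyperVolume_prod_bfn hr hz hδ U

/-- A gluing integral is reproduced by a further one.  After Fubini's theorem the integral over the
outer variables, at fixed inner ones, is an iterated Barnes integral whose value depends on the inner
variables only through the kernel `∏ B[σ; δ]` and the fixed sum of the `σ`. -/
theorem reproduces_glueIntegral {Δ Δ' : Λ → ℂ} {L : Finset Λ} {k : Λ} {σ : Sym2 Λ → ℂ}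
    {q₁ : Sym2 Λ} (h : IsContour Δ Δ' L ∅ k σ q₁) (hk : k ∈ L) {M : (Sym2 Λ → ℂ) → ℂ}
    (hMm : Measurable M) (hM : GrowsAlong L ∅ Δ M fun q => (σ q).re) {z : Sym2 Λ → ℂ}
    (hz : Below (pairs (L.erase k)) σ z) :
    Reproduces (pairs (L.erase k)) (glueIntegral Δ' L ∅ k σ q₁ M)
      (∑ q ∈ pairs (L.erase k), σ q) z where
  measurable := measurable_glueIntegral (by simp) h.mem_indexSet hMm
  depends δ δ' hδ := glueIntegral_congr (by simp) σ q₁ M (by rwa [indexSet_empty])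
  integral δ hδ r hr U := by
    have hq₁ := h.mem_indexSet
    have hglue := fun δ => glueIntegral_eq (Δ' := Δ') (L := L) (a := k) (τ := σ) (by simp) hq₁ hMm δ
    have hpos := h.pos
    rw [indexSet_empty] at hq₁
    set P := pairs (L.erase k) with hP
    simp only [indexSet_empty, ← hP] at hglue
    set c : ℂ := (2 * (Real.pi : ℂ)) ^ (P.card - 1) with hc
    have hc0 : c ≠ 0 := by simp [hc]
    set z' : Sym2 Λ → ℂ := shift z (Pi.single r U) with hz'
    have hz're : ∀ q, (z' q).re = (z q).re := fun q => shift_re _ _ _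
    have hshift : ∀ w, shift z (w + (Pi.single r U : Sym2 Λ → ℝ)) = shift z' w := fun w => by
      funext q; simp only [hz', shift, Pi.add_apply]; push_cast; ring
    set G : (Sym2 Λ → ℝ) → (Sym2 Λ → ℝ) → ℂ := fun w v =>
      lineIntegrand Δ' L ∅ k σ M (shift z' w) v * ∏ q ∈ P, bfn (shift z' w q) (δ q) with hG
    have hGm : Measurable (Function.uncurry G) := by
      refine Measurable.mul ?_ (Finset.measurable_prod _ fun q _ => Measurable.bfn ?_ measurable_const)
      · have h1 := (measurable_lineIntegrand₂ (Δ' := Δ') (L := L) (X := ∅) (a := k) (τ := σ)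
          hMm).comp (((measurable_shift z').comp (measurable_fst (α := Sym2 Λ → ℝ)
            (β := Sym2 Λ → ℝ))).prodMk measurable_snd)
        exact h1
      · exact (measurable_pi_apply q).comp ((measurable_shift z').comp measurable_fst)
    -- the outer kernel decays faster than the growth, of order `N`, of the inner integrand in `w`
    have hGi : Integrable (Function.uncurry G) ((hyperVolume P r).prod (hyperVolume P q₁)) := by
      obtain ⟨C, N, hC0, hC⟩ := exists_norm_lineIntegrand_le h (by simp) hk (by simp) hM
        (ρ := fun q => (z' q).re) (by
          rw [indexSet_empty]
          intro q hq
          rw [hz're]; exact hz q hq)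
      rw [indexSet_empty, ← hP] at hC
      obtain ⟨C', hC'0, hC'⟩ := exists_prod_norm_bfn_le (N + 2) P (z := z')
        (ρ := fun q => (δ q).re) (fun q hq => by rw [hz're]; exact (hpos q hq).trans (hz q hq))
        (fun q hq => by rw [hz're]; exact hδ q hq)
      set g : Sym2 Λ → (Sym2 Λ → ℝ) → ℂ := fun p w =>
        ((∏ q ∈ P.erase p, 1 / (1 + |w q|) ^ 2 : ℝ) : ℂ) with hg
      have hgi : ∀ p ∈ P, Integrable (g p) (hyperVolume P p) := fun p hp => by
        refine integrable_hyperVolume_of_le hp (Complex.measurable_ofReal.comp (by fun_prop)) 1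
          fun w _ _ => ?_
        rw [hg, Complex.norm_real, one_mul,
          Real.norm_of_nonneg (Finset.prod_nonneg fun q _ => by positivity)]
      set D : ℝ := C * C' * (∏ q ∈ P, (1 + |(δ q).im|) ^ (N + 2)) *
        ∏ q ∈ P, (1 + |(z' q).im|) ^ N with hD
      refine (((hgi r hr).mul_prod (hgi q₁ hq₁)).norm.const_mul D).mono'
        hGm.aestronglyMeasurable ?_
      have hae1 := (Measure.quasiMeasurePreserving_fst (μ := hyperVolume P r)
        (ν := hyperVolume P q₁)).ae (hyperVolume_ae hr)
      have hae2 := (Measure.quasiMeasurePreserving_snd (μ := hyperVolume P r)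
        (ν := hyperVolume P q₁)).ae (hyperVolume_ae hq₁)
      filter_upwards [hae1, hae2] with p hp1 hp2
      obtain ⟨w, v⟩ := p
      have h1 := hC (shift z' w) v (fun q _ => shift_re _ _ _) hp2.1 hp2.2
      have h2 := hC' δ w fun _ _ => rfl
      have hbeta : ∏ q ∈ P, (1 + |(betaArg Δ' (shift z' w) q).im|) ^ N ≤
          (∏ q ∈ P, (1 + |(z' q).im|) ^ N) * ∏ q ∈ P, (1 + |w q|) ^ N := by
        rw [← Finset.prod_mul_distrib]
        refine Finset.prod_le_prod (fun q _ => by positivity) fun q hq => ?_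
        rw [betaArg_of_mem_pairs _ _ hq, ← mul_pow]
        refine pow_le_pow_left₀ (by positivity) ?_ N
        have : (shift z' w q).im = (z' q).im + w q := by simp [shift]
        rw [this]
        nlinarith [abs_add_le (z' q).im (w q), abs_nonneg (z' q).im, abs_nonneg (w q)]
      have hw : (∏ q ∈ P, (1 + |w q|) ^ N) *
          ∏ q ∈ P, ((1 + |(δ q).im|) ^ (N + 2) / (1 + |w q|) ^ (N + 2)) ≤
          (∏ q ∈ P, (1 + |(δ q).im|) ^ (N + 2)) * ∏ q ∈ P.erase r, 1 / (1 + |w q|) ^ 2 := by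
        have h3 : (∏ q ∈ P, (1 + |w q|) ^ N) *
            ∏ q ∈ P, ((1 + |(δ q).im|) ^ (N + 2) / (1 + |w q|) ^ (N + 2)) =
            (∏ q ∈ P, (1 + |(δ q).im|) ^ (N + 2)) * ∏ q ∈ P, 1 / (1 + |w q|) ^ 2 := by
          rw [← Finset.prod_mul_distrib, ← Finset.prod_mul_distrib]
          refine Finset.prod_congr rfl fun q _ => ?_
          have : (1 + |w q|) ≠ 0 := by positivity
          rw [pow_add (1 + |w q|)]
          field_simp
        rw [h3, ← Finset.prod_erase_mul P (fun q => 1 / (1 + |w q|) ^ 2) hr]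
        refine mul_le_mul_of_nonneg_left ?_ (Finset.prod_nonneg fun q _ => by positivity)
        refine mul_le_of_le_one_right (Finset.prod_nonneg fun q _ => by positivity) ?_
        rw [div_le_one (by positivity)]
        exact one_le_pow₀ (by linarith [abs_nonneg (w r)])
      simp only [Function.uncurry, hG]
      rw [norm_mul, norm_prod, norm_mul, hg, Complex.norm_real, Complex.norm_real,
        Real.norm_of_nonneg (Finset.prod_nonneg fun q _ => by positivity),
        Real.norm_of_nonneg (Finset.prod_nonneg fun q _ => by positivity)]
      set gr : ℝ := ∏ q ∈ P.erase r, 1 / (1 + |w q|) ^ 2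
      set gq : ℝ := ∏ q ∈ P.erase q₁, 1 / (1 + |v q|) ^ 2
      have hgq : 0 ≤ gq := Finset.prod_nonneg fun q _ => by positivity
      set Bz : ℝ := ∏ q ∈ P, (1 + |(z' q).im|) ^ N
      have hBz : 0 ≤ Bz := Finset.prod_nonneg fun q _ => by positivity
      set Bw : ℝ := ∏ q ∈ P, (1 + |w q|) ^ N
      have hBw : 0 ≤ Bw := Finset.prod_nonneg fun q _ => by positivity
      set Bd : ℝ := ∏ q ∈ P, ((1 + |(δ q).im|) ^ (N + 2) / (1 + |w q|) ^ (N + 2))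
      have hBd : 0 ≤ Bd := Finset.prod_nonneg fun q _ => by positivity
      calc ‖lineIntegrand Δ' L ∅ k σ M (shift z' w) v‖ *
            ∏ q ∈ P, ‖bfn (shift z' w q) (δ q)‖
          ≤ (C * (Bz * Bw) * gq) * (C' * Bd) := by
            refine mul_le_mul (h1.trans ?_) h2 (Finset.prod_nonneg fun q _ => norm_nonneg _)
              (by positivity)
            exact mul_le_mul_of_nonneg_right (mul_le_mul_of_nonneg_left hbeta hC0) hgq
        _ = C * C' * Bz * gq * (Bw * Bd) := by ring
        _ ≤ C * C' * Bz * gq * ((∏ q ∈ P, (1 + |(δ q).im|) ^ (N + 2)) * gr) :=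
            mul_le_mul_of_nonneg_left hw (by positivity)
        _ = D * (gr * gq) := by rw [hD]; ring
    have hstep : ∀ w, glueIntegral Δ' L ∅ k σ q₁ M (shift z' w) *
        ∏ q ∈ P, bfn (shift z' w q) (δ q) = (∫ v, G w v ∂hyperVolume P q₁) / c := fun w => by
      rw [hglue, hG, integral_mul_const]
      ring
    simp_rw [hshift, hstep]
    rw [integral_div, integral_integral_swap hGi]
    -- at fixed inner variables the outer integral is an iterated Barnes integral
    have hinner : ∀ᵐ v ∂hyperVolume P q₁, ∫ w, G w v ∂hyperVolume P r =
        (c * bfn (∑ q ∈ P, z q - ∑ q ∈ P, σ q + Complex.I * U) (∑ q ∈ P, δ q - ∑ q ∈ P, σ q)) *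
          lineIntegrand Δ' L ∅ k σ M δ v := by
      filter_upwards [hyperVolume_ae hq₁] with v hv
      have h1 : ∀ w, G w v = lineIntegrand Δ' L ∅ k σ M δ v *
          ∏ q ∈ P, bfn ((z q - shift σ v q) + Complex.I * (w + (Pi.single r U : Sym2 Λ → ℝ)) q)
            (δ q - shift σ v q) := fun w => by
        rw [hG]
        simp only
        rw [lineIntegrand_empty, lineIntegrand_empty, mul_assoc, mul_assoc,
          ← Finset.prod_mul_distrib, ← Finset.prod_mul_distrib]
        congr 1
        refine Finset.prod_congr rfl fun q hq => ?_
        rw [bfn_mul_bfn (by rw [shift_re, hz're]; exact (hpos q hq).trans (hz q hq))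
          (by rw [shift_re]; exact (hz q hq).trans (hδ q hq))]
        congr 2
        simp only [hz', shift, Pi.add_apply]
        push_cast; ring
      simp_rw [h1]
      rw [integral_const_mul, integral_hyperVolume_prod_bfn hr
        (fun q hq => by
          rw [Complex.sub_re, shift_re]; linarith [hz q hq])
        (fun q hq => by
          rw [Complex.sub_re, Complex.sub_re]; linarith [hδ q hq])]
      have h2 : ∑ q ∈ P, shift σ v q = ∑ q ∈ P, σ q := by
        simp only [shift, Finset.sum_add_distrib]
        rw [← Finset.mul_sum, ← Complex.ofReal_sum, hv.2]
        simp
      rw [Finset.sum_sub_distrib, Finset.sum_sub_distrib, h2]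
      ring
    rw [integral_congr_ae hinner, integral_const_mul, hglue]
    field_simp

/-- If each block `j` of the variables `Q`, the fibre of `π` over `j`, carries a factor `N j` that is
reproduced, and the rest `H` of the integrand depends only on the sums over the blocks, then the
factors come out at `δ` and an integral over the sums remains. -/
theorem integral_of_reproduces {β : Type} [Fintype β] [DecidableEq β] {Q : Finset (Sym2 Λ)}
    {J : Finset β} {π : Sym2 Λ → β} (hπ : ∀ q ∈ Q, π q ∈ J) (hsurj : ∀ j ∈ J, ∃ q ∈ Q, π q = j)
    {q₀ : Sym2 Λ} {j₀ : β} (hq₀ : q₀ ∈ Q) (hj₀ : j₀ ∈ J) {z δ : Sym2 Λ → ℂ} (hδ : Below Q z δ)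
    {H : (β → ℝ) → ℂ} (hH : Measurable H) {N : β → (Sym2 Λ → ℂ) → ℂ} {u : β → ℂ}
    (hN : ∀ j ∈ J, Reproduces (Q.filter fun q => π q = j) (N j) (u j) z)
    (hint : Integrable (fun w => (H (fiberSum Q π w) * ∏ j ∈ J, N j (shift z w)) *
      ∏ q ∈ Q, bfn (shift z w q) (δ q)) (hyperVolume Q q₀)) :
    (∫ w, (H (fiberSum Q π w) * ∏ j ∈ J, N j (shift z w)) *
      ∏ q ∈ Q, bfn (shift z w q) (δ q) ∂hyperVolume Q q₀) / (2 * (Real.pi : ℂ)) ^ (Q.card - 1) =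
    (∏ j ∈ J, N j δ) * ((∫ U, H U * ∏ j ∈ J,
      bfn (∑ q ∈ Q.filter (fun q => π q = j), z q - u j + Complex.I * U j)
        (∑ q ∈ Q.filter (fun q => π q = j), δ q - u j) ∂hyperVolume J j₀) /
      (2 * (Real.pi : ℂ)) ^ (J.card - 1)) := by
  set f : β → (Sym2 Λ → ℝ) → ℂ := fun j w => N j (shift z w) *
    ∏ q ∈ Q.filter (fun q => π q = j), bfn (shift z w q) (δ q) with hf
  have hprod : ∀ w, (H (fiberSum Q π w) * ∏ j ∈ J, N j (shift z w)) *
      ∏ q ∈ Q, bfn (shift z w q) (δ q) = H (fiberSum Q π w) * ∏ j ∈ J, f j w := fun w => by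
    rw [hf]
    simp only
    rw [Finset.prod_mul_distrib, Finset.prod_fiberwise_of_maps_to hπ, mul_assoc]
  simp_rw [hprod] at hint ⊢
  rw [integral_hyperVolume_collapse hπ hsurj hq₀ hj₀ hH (f := f) _ _
    (Φ := fun j U => (2 * Real.pi) ^ ((Q.filter fun q => π q = j).card - 1) * N j δ *
      bfn (∑ q ∈ Q.filter (fun q => π q = j), z q - u j + Complex.I * U)
        (∑ q ∈ Q.filter (fun q => π q = j), δ q - u j)) _ hint]
  · have hcard : ∑ j ∈ J, ((Q.filter fun q => π q = j).card - 1) + (J.card - 1) = Q.card - 1 := by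
      have h1 : ∑ j ∈ J, (Q.filter fun q => π q = j).card = Q.card :=
        (Finset.card_eq_sum_card_fiberwise hπ).symm
      have h2 : ∀ j ∈ J, 1 ≤ (Q.filter fun q => π q = j).card := fun j hj => by
        obtain ⟨q, hq, hqj⟩ := hsurj j hj
        exact Finset.card_pos.mpr ⟨q, Finset.mem_filter.mpr ⟨hq, hqj⟩⟩
      have h3 : ∑ j ∈ J, ((Q.filter fun q => π q = j).card - 1) + J.card = Q.card := by
        rw [← h1, Finset.card_eq_sum_ones, ← Finset.sum_add_distrib]
        exact Finset.sum_congr rfl fun j hj => Nat.sub_add_cancel (h2 j hj)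
      have h4 : 1 ≤ J.card := Finset.card_pos.mpr ⟨j₀, hj₀⟩
      omega
    have hsplit : ∀ U : β → ℝ, H U * ∏ j ∈ J, ((2 * Real.pi) ^
        ((Q.filter fun q => π q = j).card - 1) * N j δ *
        bfn (∑ q ∈ Q.filter (fun q => π q = j), z q - u j + Complex.I * U j)
          (∑ q ∈ Q.filter (fun q => π q = j), δ q - u j)) =
        ((2 * (Real.pi : ℂ)) ^ (∑ j ∈ J, ((Q.filter fun q => π q = j).card - 1)) *
          ∏ j ∈ J, N j δ) * (H U * ∏ j ∈ J,
        bfn (∑ q ∈ Q.filter (fun q => π q = j), z q - u j + Complex.I * U j)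
          (∑ q ∈ Q.filter (fun q => π q = j), δ q - u j)) := fun U => by
      rw [Finset.prod_mul_distrib, Finset.prod_mul_distrib, Finset.prod_pow_eq_pow_sum]
      ring
    simp_rw [hsplit]
    rw [integral_const_mul, ← hcard, pow_add]
    have hp : (2 * (Real.pi : ℂ)) ≠ 0 := by simp
    field_simp
  · intro j hj
    refine ((hN j hj).measurable.comp (measurable_shift z)).mul
      (Finset.measurable_prod _ fun q _ => Measurable.bfn ?_ measurable_const)
    exact (measurable_pi_apply q).comp (measurable_shift z)
  · intro j hj w w' hw
    have h1 : ∀ q ∈ Q.filter (fun q => π q = j), shift z w q = shift z w' q := fun q hq => by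
      rw [Finset.mem_filter] at hq
      rw [shift, shift, hw q hq.1 hq.2]
    rw [hf]
    simp only
    rw [(hN j hj).depends _ _ h1]
    congr 1
    exact Finset.prod_congr rfl fun q hq => by rw [h1 q hq]
  · intro j hj r hr U
    exact (hN j hj).integral δ (fun q hq => hδ q (Finset.mem_filter.mp hq).1) r hr U

end Reproduce

/-! ### Vertices that glue several components -/

section Growth

variable {Λ : Type} {L X : Finset Λ} {Δ : Λ → ℂ} {ρ : Sym2 Λ → ℝ}

theorem GrowsAlong.mul {M M' : (Sym2 Λ → ℂ) → ℂ} (h : GrowsAlong L X Δ M ρ)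
    (h' : GrowsAlong L X Δ M' ρ) : GrowsAlong L X Δ (fun τ => M τ * M' τ) ρ := by
  obtain ⟨C, N, hC⟩ := h
  obtain ⟨C', N', hC'⟩ := h'
  refine ⟨|C| * |C'|, N + N', fun τ hτ hρ => ?_⟩
  have hS : 0 ≤ 1 + ∑ q ∈ L.sym2, |(τ q).im| :=
    add_nonneg zero_le_one (Finset.sum_nonneg fun q _ => abs_nonneg _)
  rw [norm_mul, pow_add]
  calc ‖M τ‖ * ‖M' τ‖ ≤ (|C| * (1 + ∑ q ∈ L.sym2, |(τ q).im|) ^ N) *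
        (|C'| * (1 + ∑ q ∈ L.sym2, |(τ q).im|) ^ N') :=
        mul_le_mul ((hC τ hτ hρ).trans (mul_le_mul_of_nonneg_right (le_abs_self C) (by positivity)))
          ((hC' τ hτ hρ).trans (mul_le_mul_of_nonneg_right (le_abs_self C') (by positivity)))
          (norm_nonneg _) (by positivity)
    _ = _ := by ring

theorem GrowsAlong.of_bounded {M : (Sym2 Λ → ℂ) → ℂ} {C : ℝ}
    (h : ∀ τ, IsMellin L X Δ τ → (∀ q ∈ L.sym2, (τ q).re = ρ q) → ‖M τ‖ ≤ C) :
    GrowsAlong L X Δ M ρ :=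
  ⟨C, 0, fun τ hτ hρ => by simpa using h τ hτ hρ⟩

theorem GrowsAlong.prod {ι : Type} (s : Finset ι) {M : ι → (Sym2 Λ → ℂ) → ℂ}
    (h : ∀ i ∈ s, GrowsAlong L X Δ (M i) ρ) : GrowsAlong L X Δ (fun τ => ∏ i ∈ s, M i τ) ρ := by
  classical
  induction s using Finset.induction_on with
  | empty => exact GrowsAlong.of_bounded (C := 1) fun τ _ _ => by simp
  | insert i s hi ih =>
    simp_rw [Finset.prod_insert hi]
    exact (h i (Finset.mem_insert_self i s)).mul
      (ih fun j hj => h j (Finset.mem_insert_of_mem hj))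

theorem GrowsAlong.glueIntegral [DecidableEq Λ] [Fintype Λ] {Δ₀ Δ' : Λ → ℂ} {L' X' : Finset Λ}
    {a : Λ} {τ : Sym2 Λ → ℂ} {q₀ : Sym2 Λ} (h : IsContour Δ₀ Δ' L' X' a τ q₀) (haX : a ∉ X')
    (haL : a ∈ L') (hX : X' ⊆ L') {M : (Sym2 Λ → ℂ) → ℂ} (hMm : Measurable M)
    (hM : GrowsAlong L' X' Δ₀ M fun q => (τ q).re)
    (hρ : ∀ q ∈ indexSet L' X' a, (τ q).re < ρ q) (hL : indexSet L' X' a ⊆ L.sym2) :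
    GrowsAlong L X Δ (Witten.glueIntegral Δ' L' X' a τ q₀ M) ρ := by
  obtain ⟨C, N, hC0, hC⟩ := exists_norm_glueIntegral_le h haX haL hX hMm hM hρ
  refine ⟨C, N, fun δ _ hδ => (hC δ fun q hq => hδ q (hL hq)).trans ?_⟩
  gcongr

end Growth

theorem pairs_mono {Λ : Type} [DecidableEq Λ] {A B : Finset Λ} (h : A ⊆ B) : pairs A ⊆ pairs B :=
  Finset.filter_subset_filter _ (Finset.sym2_mono h)

theorem pairs_subset_sym2 {Λ : Type} [DecidableEq Λ] {A B : Finset Λ} (h : A ⊆ B) :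
    pairs A ⊆ B.sym2 :=
  (Finset.filter_subset _ _).trans (Finset.sym2_mono h)

section Contact

theorem growsAlong_contact {Λ : Type} (h : ℂ) (Δ : Λ → ℂ) (L L' X : Finset Λ) (Δ' : Λ → ℂ)
    (ρ : Sym2 Λ → ℝ) : GrowsAlong L' X Δ' (contact h Δ L) ρ :=
  GrowsAlong.of_bounded (C := ‖Complex.Gamma ((∑ i ∈ L, Δ i) / 2 - h)‖) fun _ _ _ => le_rfl

variable {Λ : Type} [DecidableEq Λ]

/-- As a function of `s`, the factor `K₂` is a single Beta function. -/
theorem kernelTwo_eq (h c D s : ℂ) :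
    kernelTwo h c D s = Complex.Gamma ((D - h + c) / 2) * bfn ((D - h - c) / 2) ((D - s) / 2) := by
  rw [kernelTwo, bfn, show (D - s) / 2 - (D - h - c) / 2 = (h + c - s) / 2 by ring]
  ring

/-- The fixed sum of the integration variables of a gluing integral, determined by the dimension of the
glued leg. -/
theorem IsContour.two_mul_sum_pairs {Δ Δ' : Λ → ℂ} {L : Finset Λ} {l : Λ} {ν : Sym2 Λ → ℂ}
    {p : Sym2 Λ} (hν : IsContour Δ Δ' L ∅ l ν p) (hl : l ∈ L) :
    ∑ q ∈ pairs (L.erase l), ν q = (∑ i ∈ L.erase l, Δ i - Δ l) / 2 := by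
  have h1 := hν.mellin.mandelstam_erase hl
  rw [mandelstam_eq_sub (Δ := Δ) fun i hi =>
    hν.mellin.diag i (Finset.mem_of_mem_erase hi) (by simp), hν.mellin.diag l hl (by simp)] at h1
  linear_combination (-1 / 2) * h1

variable [Fintype Λ]

/-- The gluing integral of a contact diagram. -/
theorem glueIntegral_contact {Δ Δ' : Λ → ℂ} {L : Finset Λ} {l : Λ} {ν : Sym2 Λ → ℂ} {p : Sym2 Λ}
    {h c : ℂ} (hν : IsContour Δ Δ' L ∅ l ν p) (hl : l ∈ L) (hΔ : Δ l = h + c) {δ : Sym2 Λ → ℂ}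
    (hdiag : ∀ i ∈ L.erase l, δ s(i, i) = -Δ i) (hδ : Below (pairs (L.erase l)) ν δ) :
    glueIntegral Δ' L ∅ l ν p (contact h Δ L) δ =
      kernelTwo h c (∑ i ∈ L.erase l, Δ i) (mandelstam (L.erase l) δ) := by
  rw [glueIntegral_eq (M := contact h Δ L) (by simp) hν.mem_indexSet measurable_const]
  have hp := hν.mem
  simp_rw [lineIntegrand_empty, indexSet_empty]
  have hI := (reproduces_one hν.pos).integral δ hδ p hp 0
  simp only [Pi.single_zero, add_zero, one_mul, mul_one, Complex.ofReal_zero, mul_zero, sub_zero]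
    at hI
  simp only [contact]
  rw [integral_const_mul, hI, kernelTwo_eq, hν.two_mul_sum_pairs hl, mandelstam_eq_sub hdiag,
    ← Finset.sum_erase_add L _ hl, hΔ]
  have hp0 : (2 * (Real.pi : ℂ)) ^ ((pairs (L.erase l)).card - 1) ≠ 0 := by simp
  rw [show (∑ i ∈ L.erase l, Δ i + (h + c)) / 2 - h = (∑ i ∈ L.erase l, Δ i - h + c) / 2 by ring,
    show (∑ i ∈ L.erase l, Δ i - (h + c)) / 2 = (∑ i ∈ L.erase l, Δ i - h - c) / 2 by ring,
    show (∑ i ∈ L.erase l, Δ i - (∑ i ∈ L.erase l, Δ i - 2 * ∑ q ∈ pairs (L.erase l), δ q)) / 2 =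
      ∑ q ∈ pairs (L.erase l), δ q by ring]
  field_simp

end Contact

section Option

variable {κ : Type} [Fintype κ]

/-- Integration over the hyperplane of `ℝ^(κ ∪ {none})`, solved for the coordinate `none`. -/
theorem integral_hyperVolume_option [DecidableEq κ] {G : (Option κ → ℝ) → ℂ} (hG : Measurable G) :
    ∫ U, G U ∂hyperVolume (Finset.univ : Finset (Option κ)) none =
      ∫ x : κ → ℝ, G fun o => o.elim (-∑ a, x a) x := by
  have himg : (Finset.univ : Finset (Option κ)).erase none = Finset.univ.image some := by
    ext o; cases o <;> simp
  have hinj : Set.InjOn (some : κ → Option κ) (Finset.univ : Finset κ) :=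
    (Option.some_injective κ).injOn
  have hGt : Measurable fun w => G (tieOff Finset.univ none w) := hG.comp (measurable_tieOff _ _)
  rw [hyperVolume, integral_map (measurable_tieOff _ _).aemeasurable hG.aestronglyMeasurable, himg,
    ← coordVolume_map_fiberSum hinj, coordVolume_univ,
    integral_map (measurable_fiberSum _ _).aemeasurable
      hGt.aestronglyMeasurable]
  congr 1
  funext x
  congr 1
  have hs : ∀ a, fiberSum Finset.univ some x (some a) = x a := fun a => by
    unfold fiberSum
    rw [Finset.sum_eq_single a]
    · intro b hb hne
      exact absurd (Option.some_injective _ (Finset.mem_filter.mp hb).2) hne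
    · intro h'
      exact absurd (Finset.mem_filter.mpr ⟨Finset.mem_univ _, rfl⟩ :
        a ∈ Finset.univ.filter fun b => some b = some a) h'
  have hn : fiberSum Finset.univ some x none = 0 := by
    unfold fiberSum
    exact Finset.sum_eq_zero fun b hb => by simp at hb
  funext o
  cases o with
  | none => simp [tieOff, Fintype.sum_option, hs, hn]
  | some a => simp [tieOff, hs]

/-- Rescaling by `-2` and translating each variable. -/
theorem integral_comp_sub_two_mul (f : (κ → ℝ) → ℂ) (c : κ → ℝ) :
    ∫ x : κ → ℝ, f (fun a => c a - 2 * x a) = (1 / 2) ^ Fintype.card κ * ∫ y, f y := by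
  have h1 := Measure.integral_comp_smul (volume : Measure (κ → ℝ)) (fun y => f (c + y)) (-2)
  have h2 : ∫ y, f (c + y) = ∫ y, f y := integral_add_left_eq_self f c
  rw [h2] at h1
  have h3 : ∀ x : κ → ℝ, (fun a => c a - 2 * x a) = c + (-2 : ℝ) • x := fun x => by
    funext a; simp; ring
  simp_rw [h3]
  rw [h1, Module.finrank_fintype_fun_eq_card, abs_inv, abs_pow]
  simp [Complex.real_smul]

end Option

section Components

variable {Λ κ : Type} [Fintype κ]

/-- The integrand over the Mandelstam variables `t a` of the components that are joined at a vertex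
of total boundary dimension `D₀`, when the leg of dimension `d₀` at that vertex is glued. -/
noncomputable def componentIntegrand (K : (κ → ℂ) → ℂ) (d₀ : ℂ) (d : κ → ℂ) (D₀ s₀ : ℂ)
    (s t : κ → ℂ) : ℂ :=
  K t * bfn ((D₀ - d₀ + ∑ a, t a) / 2) ((D₀ - s₀ + ∑ a, s a) / 2) *
    ∏ a, bfn ((d a - t a) / 2) ((d a - s a) / 2)

/-- The Beta functions of the components decay in every variable; the kernel and the remaining Beta
function need only be bounded. -/
theorem integrable_componentIntegrand {K : (κ → ℂ) → ℂ} (hKm : Measurable K) {d₀ : ℂ} {d : κ → ℂ}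
    {D₀ s₀ : ℂ} {s : κ → ℂ} {θ : κ → ℝ} {C : ℝ}
    (hK : ∀ t : κ → ℂ, (∀ a, (t a).re = θ a) → ‖K t‖ ≤ C)
    (h0 : 0 < ((D₀ - d₀) / 2).re + ∑ a, θ a / 2)
    (h1 : ((D₀ - d₀) / 2).re + ∑ a, θ a / 2 < ((D₀ - s₀ + ∑ a, s a) / 2).re)
    (h2 : ∀ a, θ a < (d a).re) (h3 : ∀ a, (s a).re < θ a) :
    Integrable fun y : κ → ℝ => componentIntegrand K d₀ d D₀ s₀ s fun a => θ a + y a * Complex.I := by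
  classical
  obtain ⟨C0, hC0⟩ := exists_norm_bfn_le h0 h1
  obtain ⟨C1, hC10, hC1⟩ := exists_prod_norm_bfn_le 2 Finset.univ
    (z := fun a => (d a - θ a) / 2) (ρ := fun a => ((d a - s a) / 2).re)
    (fun a _ => by have := h2 a; simp; linarith) (fun a _ => by have := h3 a; simp; linarith)
  have hm : Measurable fun y : κ → ℝ =>
      componentIntegrand K d₀ d D₀ s₀ s fun a => θ a + y a * Complex.I := by
    have ht : Measurable fun (y : κ → ℝ) (a : κ) => (θ a + y a * Complex.I : ℂ) :=
      measurable_pi_lambda _ fun a => by fun_prop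
    unfold componentIntegrand
    refine ((hKm.comp ht).mul (Measurable.bfn ?_ measurable_const)).mul
      (Finset.measurable_prod _ fun a _ => Measurable.bfn ?_ measurable_const)
    · fun_prop
    · fun_prop
  rw [← coordVolume_univ]
  refine integrable_coordVolume_of_le hm.aestronglyMeasurable
    (|C| * |C0| * (C1 * (∏ a, ((1 + |((d a - s a) / 2).im|) ^ 2 * 4))))
    (Filter.Eventually.of_forall fun y => ?_)
  have hre : ∀ a, ((θ a + y a * Complex.I : ℂ)).re = θ a := fun a => by simp
  have e1 := (hK _ hre).trans (le_abs_self C)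
  have e2 : ‖bfn ((D₀ - d₀ + ∑ a, (θ a + y a * Complex.I : ℂ)) / 2)
      ((D₀ - s₀ + ∑ a, s a) / 2)‖ ≤ |C0| := by
    refine (hC0 _ _ ?_ rfl).trans (le_abs_self C0)
    rw [add_div, Complex.add_re, Finset.sum_div, Complex.re_sum]
    congr 1
    exact Finset.sum_congr rfl fun a _ => by simp
  have e3 : ∏ a, ‖bfn ((d a - (θ a + y a * Complex.I)) / 2) ((d a - s a) / 2)‖ ≤
      C1 * ((∏ a, ((1 + |((d a - s a) / 2).im|) ^ 2 * 4)) * ∏ a, 1 / (1 + |y a|) ^ 2) := by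
    have e4 := hC1 (fun a => (d a - s a) / 2) (fun a => -y a / 2) fun a _ => rfl
    have e5 : ∀ a, (d a - θ a) / 2 + Complex.I * ((-y a / 2 : ℝ) : ℂ) =
        (d a - (θ a + y a * Complex.I)) / 2 := fun a => by push_cast; ring
    simp_rw [e5] at e4
    refine e4.trans (mul_le_mul_of_nonneg_left ?_ hC10)
    rw [← Finset.prod_mul_distrib]
    refine Finset.prod_le_prod (fun a _ => by positivity) fun a _ => ?_
    rw [mul_one_div, div_le_div_iff₀ (by positivity) (by positivity), mul_assoc]
    refine mul_le_mul_of_nonneg_left ?_ (by positivity)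
    have e6 : |(-y a / 2)| = |y a| / 2 := by rw [abs_div, abs_neg, abs_two]
    rw [e6]
    nlinarith [abs_nonneg (y a)]
  rw [componentIntegrand, norm_mul, norm_mul, norm_prod]
  refine (mul_le_mul (mul_le_mul e1 e2 (norm_nonneg _) (abs_nonneg _)) e3
    (Finset.prod_nonneg fun a _ => norm_nonneg _) (by positivity)).trans (le_of_eq (by ring))

end Components

section Components

variable {Λ κ : Type} [DecidableEq Λ] [Fintype κ]

/-- Two legs at a vertex with at least two branches that lie in different branches. -/
theorem exists_cross_pair {A : κ → Finset Λ} {E₀ : Finset Λ}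
    (hA : Pairwise fun a b => Disjoint (A a) (A b)) (hAE : ∀ a, Disjoint (A a) E₀)
    (hne : ∀ a, (A a).Nonempty) (hcard : 2 ≤ Fintype.card κ + E₀.card) :
    ∃ q ∈ pairs (Finset.univ.biUnion A ∪ E₀), ∀ a, q ∉ pairs (A a) := by
  have hmemA : ∀ a, ∀ i ∈ A a, i ∈ Finset.univ.biUnion A ∪ E₀ := fun a i hi =>
    Finset.mem_union_left _ (Finset.mem_biUnion.mpr ⟨a, Finset.mem_univ a, hi⟩)
  have hmemE : ∀ i ∈ E₀, i ∈ Finset.univ.biUnion A ∪ E₀ := fun i hi => Finset.mem_union_right _ hi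
  rcases lt_or_ge 1 E₀.card with h2 | h2
  · obtain ⟨i, hi, j, hj, hij⟩ := Finset.one_lt_card.mp h2
    refine ⟨s(i, j), mk_mem_pairs.mpr ⟨hmemE i hi, hmemE j hj, hij⟩, fun a h => ?_⟩
    exact Finset.disjoint_left.mp (hAE a) (mk_mem_pairs.mp h).1 hi
  · rcases Finset.eq_empty_or_nonempty E₀ with h0 | ⟨e, he⟩
    · rw [h0, Finset.card_empty, add_zero] at hcard
      obtain ⟨a, b, hab⟩ := Fintype.one_lt_card_iff.mp hcard
      obtain ⟨i, hi⟩ := hne a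
      obtain ⟨j, hj⟩ := hne b
      have hij : i ≠ j := fun e => Finset.disjoint_left.mp (hA hab) hi (e ▸ hj)
      refine ⟨s(i, j), mk_mem_pairs.mpr ⟨hmemA a i hi, hmemA b j hj, hij⟩, fun c h => ?_⟩
      obtain ⟨h1, h3, -⟩ := mk_mem_pairs.mp h
      have hca : c = a := by
        by_contra hne'
        exact Finset.disjoint_left.mp (hA hne') h1 hi
      have hcb : c = b := by
        by_contra hne'
        exact Finset.disjoint_left.mp (hA hne') h3 hj
      exact hab (hca.symm.trans hcb)
    · have : 0 < Fintype.card κ := by omega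
      obtain ⟨a⟩ := Fintype.card_pos_iff.mp this
      obtain ⟨i, hi⟩ := hne a
      have hie : i ≠ e := fun h => Finset.disjoint_left.mp (hAE a) hi (h ▸ he)
      refine ⟨s(i, e), mk_mem_pairs.mpr ⟨hmemA a i hi, hmemE e he, hie⟩, fun c h => ?_⟩
      exact Finset.disjoint_left.mp (hAE c) (mk_mem_pairs.mp h).2.1 he

variable [Fintype Λ]

/-- Gluing the free leg of a vertex that joins several components: the integrals over the Mellin
variables inside the components reproduce the components, those over the remaining variables can be
done for fixed Mandelstam variables, and one integral for each component is left. -/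
theorem glueIntegral_components {Δ : Λ → ℂ} {A : κ → Finset Λ} {E₀ : Finset Λ} {k₀ : Λ}
    {τ : Sym2 Λ → ℂ} {q₀ : Sym2 Λ}
    (hA : Pairwise fun a b => Disjoint (A a) (A b)) (hAE : ∀ a, Disjoint (A a) E₀)
    (hk₀ : k₀ ∉ Finset.univ.biUnion A ∪ E₀)
    (hne : ∀ a, (pairs (A a)).Nonempty) (hcard : 2 ≤ Fintype.card κ + E₀.card)
    (hτ : IsContour Δ 0 (Finset.univ.biUnion A ∪ insert k₀ E₀) ∅ k₀ τ q₀)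
    {N : κ → (Sym2 Λ → ℂ) → ℂ} {u d : κ → ℂ} (hN : ∀ a, Reproduces (pairs (A a)) (N a) (u a) τ)
    (hu : ∀ a, u a = (∑ i ∈ A a, Δ i - d a) / 2) {K : (κ → ℂ) → ℂ} (hKm : Measurable K)
    {M₀ : (Sym2 Λ → ℂ) → ℂ} (hM₀m : Measurable M₀)
    (hM₀g : GrowsAlong (Finset.univ.biUnion A ∪ insert k₀ E₀) ∅ Δ M₀ fun q => (τ q).re)
    (hM₀ : ∀ τ', IsMellin (Finset.univ.biUnion A ∪ insert k₀ E₀) ∅ Δ τ' →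
      (∀ q, (τ' q).re = (τ q).re) →
      M₀ τ' = K (fun a => mandelstam (A a) τ') * ∏ a, N a τ')
    {δ : Sym2 Λ → ℂ} (hdiag : ∀ i ∈ Finset.univ.biUnion A ∪ E₀, δ s(i, i) = -Δ i)
    (hδ : Below (pairs (Finset.univ.biUnion A ∪ E₀)) τ δ) :
    glueIntegral 0 (Finset.univ.biUnion A ∪ insert k₀ E₀) ∅ k₀ τ q₀ M₀ δ =
      (∏ a, N a δ) * ((1 / 2) ^ Fintype.card κ *
        ((∫ y : κ → ℝ, componentIntegrand K (Δ k₀) d (∑ i ∈ E₀, Δ i)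
          (mandelstam (Finset.univ.biUnion A ∪ E₀) δ) (fun a => mandelstam (A a) δ)
          fun a => (mandelstam (A a) τ).re + y a * Complex.I) /
        (2 * (Real.pi : ℂ)) ^ Fintype.card κ)) := by
  classical
  set B := Finset.univ.biUnion A ∪ E₀ with hB
  set L := Finset.univ.biUnion A ∪ insert k₀ E₀ with hL
  have hLB : L = insert k₀ B := by rw [hL, hB, Finset.union_insert]
  have hLe : L.erase k₀ = B := by rw [hLB, Finset.erase_insert hk₀]
  have hk₀L : k₀ ∈ L := hLB ▸ Finset.mem_insert_self _ _
  have hAB : ∀ a, A a ⊆ B := fun a i hi =>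
    Finset.mem_union_left _ (Finset.mem_biUnion.mpr ⟨a, Finset.mem_univ a, hi⟩)
  have hBL : B ⊆ L := hLB ▸ Finset.subset_insert _ _
  have hq₀ := hτ.mem
  rw [hLe] at hq₀
  have hpos := hτ.pos
  rw [hLe] at hpos
  have hint := integrable_lineIntegrand hτ (by simp) hk₀L (by simp) hM₀m hM₀g (δ := δ)
    (by rwa [indexSet_empty, hLe])
  rw [glueIntegral_eq (by simp) hτ.mem_indexSet hM₀m]
  have hidx : indexSet L ∅ k₀ = pairs B := by rw [indexSet_empty, hLe]
  rw [hidx] at hint ⊢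
  -- the component to which a pair of legs belongs
  set π : Sym2 Λ → Option κ := fun q => if h : ∃ a, q ∈ pairs (A a) then some h.choose else none
    with hπ
  have hπs : ∀ a q, π q = some a ↔ q ∈ pairs (A a) := fun a q => by
    have huniq : ∀ b, q ∈ pairs (A b) → q ∈ pairs (A a) → b = a := fun b hb ha => by
      by_contra hne'
      induction q using Sym2.ind with
      | _ i j =>
        exact Finset.disjoint_left.mp (hA hne') (mk_mem_pairs.mp hb).1 (mk_mem_pairs.mp ha).1
    constructor
    · intro h
      simp only [hπ] at h
      split_ifs at h with h1
      · rw [Option.some.injEq] at h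
        exact h ▸ h1.choose_spec
    · intro h
      have h1 : ∃ a, q ∈ pairs (A a) := ⟨a, h⟩
      simp only [hπ, dif_pos h1]
      rw [huniq _ h1.choose_spec h]
  have hπn : ∀ q, π q = none ↔ ∀ a, q ∉ pairs (A a) := fun q => by
    rw [Option.eq_none_iff_forall_ne_some]
    exact forall_congr' fun a => not_congr (hπs a q)
  have hfib : ∀ a, (pairs B).filter (fun q => π q = some a) = pairs (A a) := fun a => by
    ext q
    rw [Finset.mem_filter, hπs]
    exact ⟨fun h => h.2, fun h => ⟨pairs_mono (hAB a) h, h⟩⟩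
  have hneA : ∀ a, (A a).Nonempty := fun a => by
    obtain ⟨q, hq⟩ := hne a
    induction q using Sym2.ind with
    | _ i j => exact ⟨i, (mk_mem_pairs.mp hq).1⟩
  -- the sum of the displacements in the component `a` moves its Mandelstam variable by `-2i` times it
  set H : (Option κ → ℝ) → ℂ := fun U =>
    K fun a => mandelstam (A a) τ - 2 * (Complex.I * U (some a)) with hH
  have hHm : Measurable H := hKm.comp (measurable_pi_lambda _ fun a => by fun_prop)
  set N' : Option κ → (Sym2 Λ → ℂ) → ℂ := fun o => o.elim (fun _ => 1) N with hN'
  set u' : Option κ → ℂ := fun o => o.elim 0 u with hu'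
  have hRep : ∀ o ∈ (Finset.univ : Finset (Option κ)),
      Reproduces ((pairs B).filter fun q => π q = o) (N' o) (u' o) τ := by
    intro o _
    cases o with
    | none => exact reproduces_one fun q hq => hpos q (Finset.mem_filter.mp hq).1
    | some a => rw [hfib]; exact hN a
  have hline : ∀ᵐ w ∂hyperVolume (pairs B) q₀, lineIntegrand 0 L ∅ k₀ τ M₀ δ w =
      (H (fiberSum (pairs B) π w) * ∏ o, N' o (shift τ w)) *
        ∏ q ∈ pairs B, bfn (shift τ w q) (δ q) := by
    filter_upwards [hyperVolume_ae hq₀] with w hw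
    have hmel := hτ.mellin.contourAt (w := w) (by simp) hk₀L (by simp)
      (by rw [hidx]; exact hw.1) (by rw [hidx]; exact hw.2)
    rw [lineIntegrand_empty, hLe, hM₀ _ hmel fun q => contourAt_re L k₀ τ w q]
    congr 1
    have hc : ∀ q ∈ pairs B, contourAt L k₀ τ w q = shift τ w q := fun q hq => by
      rw [contourAt_of_mem_pairs _ _ (by rwa [hLe]), shift]
    have hmand : ∀ a, mandelstam (A a) (contourAt L k₀ τ w) =
        mandelstam (A a) τ - 2 * (Complex.I * fiberSum (pairs B) π w (some a)) := fun a => by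
      rw [mandelstam_eq_sub (Δ := Δ) fun i hi => hmel.diag i (hBL (hAB a hi)) (by simp),
        mandelstam_eq_sub (Δ := Δ) fun i hi => hτ.mellin.diag i (hBL (hAB a hi)) (by simp),
        fiberSum, hfib, Finset.sum_congr rfl fun q hq => hc q (pairs_mono (hAB a) hq)]
      have hs : ∑ q ∈ pairs (A a), shift τ w q =
          ∑ q ∈ pairs (A a), τ q + Complex.I * ∑ q ∈ pairs (A a), (w q : ℂ) := by
        rw [Finset.mul_sum, ← Finset.sum_add_distrib]
        rfl
      rw [hs]
      push_cast; ring
    rw [Fintype.prod_option]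
    simp only [hN', Option.elim_none, Option.elim_some, one_mul, hH]
    simp_rw [hmand]
    congr 1
    exact Finset.prod_congr rfl fun a _ =>
      (hN a).depends _ _ fun q hq => hc q (pairs_mono (hAB a) hq)
  rw [integral_congr_ae hline, integral_of_reproduces (π := π) (J := Finset.univ) (j₀ := none)
    (fun _ _ => Finset.mem_univ _) _ hq₀ (Finset.mem_univ _) hδ hHm hRep (hint.congr hline)]
  · rw [Fintype.prod_option]
    simp only [hN', hu', Option.elim_none, Option.elim_some, one_mul]
    congr 1
    rw [Finset.card_univ, Fintype.card_option, Nat.add_sub_cancel, integral_hyperVolume_option]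
    · rw [← mul_div_assoc]
      congr 1
      rw [← integral_comp_sub_two_mul _ fun a => (mandelstam (A a) τ).im]
      congr 1
      funext x
      have hsplit : ∀ g : Sym2 Λ → ℂ, ∑ q ∈ (pairs B).filter (fun q => π q = none), g q =
          ∑ q ∈ pairs B, g q - ∑ a, ∑ q ∈ pairs (A a), g q := fun g => by
        rw [← Finset.sum_fiberwise_of_maps_to (s := pairs B) (t := Finset.univ) (g := π)
          (fun _ _ => Finset.mem_univ _), Fintype.sum_option]
        simp_rw [hfib]
        ring
      have hEq : ∀ a, ((mandelstam (A a) τ).re : ℂ) +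
          (((mandelstam (A a) τ).im - 2 * x a : ℝ) : ℂ) * Complex.I =
          mandelstam (A a) τ - 2 * (Complex.I * x a) := fun a => by
        conv_rhs => rw [← Complex.re_add_im (mandelstam (A a) τ)]
        push_cast; ring
      simp only [hH, componentIntegrand, hEq]
      rw [Fintype.prod_option, ← mul_assoc]
      simp only [Option.elim_none, Option.elim_some, hfib, hsplit]
      have hτB := hτ.two_mul_sum_pairs hk₀L
      rw [hLe] at hτB
      have hτA : ∀ a, mandelstam (A a) τ = ∑ i ∈ A a, Δ i - 2 * ∑ q ∈ pairs (A a), τ q :=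
        fun a => mandelstam_eq_sub fun i hi => hτ.mellin.diag i (hBL (hAB a hi)) (by simp)
      have hδA : ∀ a, mandelstam (A a) δ = ∑ i ∈ A a, Δ i - 2 * ∑ q ∈ pairs (A a), δ q :=
        fun a => mandelstam_eq_sub fun i hi => hdiag i (hAB a hi)
      have hδB : mandelstam B δ = ∑ i ∈ B, Δ i - 2 * ∑ q ∈ pairs B, δ q :=
        mandelstam_eq_sub hdiag
      have hsumB : ∑ i ∈ B, Δ i = ∑ a, ∑ i ∈ A a, Δ i + ∑ i ∈ E₀, Δ i := by
        rw [hB, Finset.sum_union, Finset.sum_biUnion]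
        · exact fun a _ b _ hab => hA hab
        · rw [Finset.disjoint_biUnion_left]; exact fun a _ => hAE a
      congr 1
      · congr 2
        · rw [hτB, hsumB]
          simp_rw [hτA]
          simp only [Finset.sum_sub_distrib, ← Finset.mul_sum]
          push_cast
          ring
        · rw [hδB, hsumB]
          simp_rw [hδA]
          simp only [Finset.sum_sub_distrib, ← Finset.mul_sum]
          ring
      · refine Finset.prod_congr rfl fun a _ => ?_
        rw [hτA, hδA, hu]
        congr 1 <;> ring
    · refine hHm.mul (Finset.measurable_prod _ fun o _ => Measurable.bfn ?_ measurable_const)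
      fun_prop
  · intro o _
    cases o with
    | none =>
      obtain ⟨q, hq, hq'⟩ := exists_cross_pair hA hAE hneA hcard
      exact ⟨q, hq, (hπn q).mpr hq'⟩
    | some a =>
      obtain ⟨q, hq⟩ := hne a
      exact ⟨q, pairs_mono (hAB a) hq, (hπs a q).mpr hq⟩

end Components

/-! ### The kernel of a vertex that glues several components -/

section Kernel

/-- In the right half-plane the Gamma function is bounded by its value at the real part. -/
theorem norm_Gamma_le {z : ℂ} (hz : 0 < z.re) : ‖Complex.Gamma z‖ ≤ Real.Gamma z.re := by
  rw [Complex.Gamma_eq_integral hz, Complex.GammaIntegral, Real.Gamma_eq_integral hz]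
  refine (norm_integral_le_integral_norm _).trans (le_of_eq ?_)
  refine setIntegral_congr_fun measurableSet_Ioi fun x hx => ?_
  rw [norm_mul, Complex.norm_real, Complex.norm_cpow_eq_rpow_re_of_pos hx, Complex.sub_re,
    Complex.one_re, Real.norm_of_nonneg (Real.exp_pos _).le]

/-- Quadratic decay of the Gamma function on a vertical line. -/
theorem exists_norm_Gamma_le {x : ℝ} (hx : 0 < x) :
    ∃ C : ℝ, 0 ≤ C ∧ ∀ z : ℂ, z.re = x → ‖Complex.Gamma z‖ ≤ C * (1 / (1 + |z.im|) ^ 2) := by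
  refine ⟨(1 / x + 1) ^ 2 * Real.Gamma (x + 2), ?_, fun z hz => ?_⟩
  · have := Real.Gamma_pos_of_pos (by linarith : 0 < x + 2)
    positivity
  · have hz0 : z ≠ 0 := ne_zero_of_re_pos (hz ▸ hx)
    have hz1 : z + 1 ≠ 0 := ne_zero_of_re_pos (by rw [Complex.add_re, hz, Complex.one_re]; linarith)
    have h1 : Complex.Gamma (z + 2) = (z + 1) * z * Complex.Gamma z := by
      rw [show z + 2 = z + 1 + 1 by ring, Complex.Gamma_add_one _ hz1, Complex.Gamma_add_one _ hz0]
      ring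
    have h2 : ‖Complex.Gamma (z + 2)‖ ≤ Real.Gamma (x + 2) := by
      have h3 : (z + 2).re = x + 2 := by simp [hz]
      exact h3 ▸ norm_Gamma_le (h3 ▸ by linarith)
    have hb : ∀ y : ℂ, x ≤ y.re → y.im = z.im → 1 + |z.im| ≤ (1 / x + 1) * ‖y‖ := fun y hy hi => by
      have e1 : x ≤ ‖y‖ := hy.trans ((le_abs_self _).trans (Complex.abs_re_le_norm y))
      have e2 : |z.im| ≤ ‖y‖ := hi ▸ Complex.abs_im_le_norm y
      have e3 : 1 ≤ 1 / x * ‖y‖ := by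
        rw [one_div, ← div_eq_inv_mul, le_div_iff₀ hx]; linarith
      linarith
    have h4 := hb z hz.ge rfl
    have h5 := hb (z + 1) (by rw [Complex.add_re, hz, Complex.one_re]; linarith) (by simp)
    rw [h1, norm_mul, norm_mul] at h2
    have h6 : (1 + |z.im|) ^ 2 ≤ ((1 / x + 1) * ‖z + 1‖) * ((1 / x + 1) * ‖z‖) := by
      rw [pow_two]
      exact mul_le_mul h5 h4 (by positivity) (by positivity)
    rw [mul_one_div, le_div_iff₀ (by positivity)]
    calc ‖Complex.Gamma z‖ * (1 + |z.im|) ^ 2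
        ≤ ‖Complex.Gamma z‖ * (((1 / x + 1) * ‖z + 1‖) * ((1 / x + 1) * ‖z‖)) :=
          mul_le_mul_of_nonneg_left h6 (norm_nonneg _)
      _ = (1 / x + 1) ^ 2 * (‖z + 1‖ * ‖z‖ * ‖Complex.Gamma z‖) := by ring
      _ ≤ _ := mul_le_mul_of_nonneg_left h2 (by positivity)

variable {κ : Type} [Fintype κ]

/-- The Gamma functions of each component that depend on its Mandelstam variable combine into a Beta
function. -/
theorem forestIntegrand_eq (h : ℂ) (c : κ → ℂ) (D : ℂ) (t w : κ → ℂ) :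
    forestIntegrand h c D t w =
      Complex.Gamma ((D + ((Fintype.card κ : ℂ) - 2) * h + ∑ a, c a) / 2 + ∑ a, w a) *
        ∏ a, Complex.Gamma (-w a) * bfn (-c a - w a) ((h - c a - t a) / 2) := by
  rw [forestIntegrand]
  congr 1
  refine Finset.prod_congr rfl fun a _ => ?_
  rw [bfn, show (h - c a - t a) / 2 - (-c a - w a) = (h + c a - t a) / 2 + w a by ring]
  ring

theorem measurable_forestIntegrand (h : ℂ) (c : κ → ℂ) (D : ℂ) (ω : κ → ℝ) :
    Measurable fun p : (κ → ℂ) × (κ → ℝ) =>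
      forestIntegrand h c D p.1 fun a => ω a + p.2 a * Complex.I := by
  simp_rw [forestIntegrand_eq]
  refine (measurable_Gamma.comp (by fun_prop)).mul (Finset.measurable_prod _ fun a _ => ?_)
  exact (measurable_Gamma.comp (by fun_prop)).mul (Measurable.bfn (by fun_prop) (by fun_prop))

theorem measurable_forestKernel (h : ℂ) (c : κ → ℂ) (D : ℂ) (ω : κ → ℝ) :
    Measurable (forestKernel h c D ω) := by
  unfold forestKernel
  exact (measurable_forestIntegrand h c D ω).stronglyMeasurable.integral_prod_right.measurable.div_const _

/-- The kernel is bounded on vertical lines. -/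
theorem exists_norm_forestKernel_le {h : ℂ} {c : κ → ℂ} {D : ℂ} {ω θ : κ → ℝ}
    (hω : ∀ a, ω a < 0 ∧ ω a < (-c a).re ∧ 0 < ((h + c a - θ a) / 2).re + ω a)
    (hD : 0 < ((D + ((Fintype.card κ : ℂ) - 2) * h + ∑ a, c a) / 2).re + ∑ a, ω a) :
    ∃ C : ℝ, ∀ t : κ → ℂ, (∀ a, (t a).re = θ a) → ‖forestKernel h c D ω t‖ ≤ C := by
  set x := ((D + ((Fintype.card κ : ℂ) - 2) * h + ∑ a, c a) / 2).re + ∑ a, ω a with hx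
  have hΓ : ∀ a, ∃ C : ℝ, 0 ≤ C ∧ ∀ z : ℂ, z.re = -ω a →
      ‖Complex.Gamma z‖ ≤ C * (1 / (1 + |z.im|) ^ 2) := fun a =>
    exists_norm_Gamma_le (by linarith [(hω a).1])
  choose C hC0 hC using hΓ
  have hB : ∀ a, ∃ B : ℝ, ∀ x y : ℂ, x.re = (-c a).re - ω a → y.re = ((h - c a - θ a) / 2).re →
      ‖bfn x y‖ ≤ B := fun a =>
    exists_norm_bfn_le (by linarith [(hω a).2.1]) (by
      have := (hω a).2.2
      simp at this ⊢; linarith)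
  choose B hB using hB
  classical
  have hg : Integrable fun y : κ → ℝ => (((∏ a, 1 / (1 + |y a|) ^ 2 : ℝ)) : ℂ) := by
    rw [← coordVolume_univ]
    refine integrable_coordVolume_of_le (Complex.measurable_ofReal.comp
      (by fun_prop)).aestronglyMeasurable 1 (Filter.Eventually.of_forall fun y => ?_)
    rw [Complex.norm_real, one_mul, Real.norm_of_nonneg (Finset.prod_nonneg fun q _ => by positivity)]
  refine ⟨∫ y : κ → ℝ, Real.Gamma x * (∏ a, C a * |B a|) *
    ‖(((∏ a, 1 / (1 + |y a|) ^ 2 : ℝ)) : ℂ)‖, fun t ht => ?_⟩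
  rw [forestKernel, norm_div]
  refine (div_le_self (norm_nonneg _) ?_).trans ?_
  · rw [norm_pow]
    refine one_le_pow₀ ?_
    rw [norm_mul, Complex.norm_real, Real.norm_of_nonneg Real.pi_pos.le]
    simp only [Complex.norm_ofNat]
    linarith [Real.pi_gt_three]
  · refine norm_integral_le_of_norm_le (hg.norm.const_mul _) (Filter.Eventually.of_forall fun y => ?_)
    rw [forestIntegrand_eq, norm_mul, norm_prod, Complex.norm_real,
      Real.norm_of_nonneg (Finset.prod_nonneg fun q _ => by positivity), mul_assoc,
      ← Finset.prod_mul_distrib]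
    have h1 : ((D + ((Fintype.card κ : ℂ) - 2) * h + ∑ a, c a) / 2 +
        ∑ a, ((ω a : ℂ) + y a * Complex.I)).re = x := by
      rw [Complex.add_re, Complex.re_sum, hx]
      congr 1
      exact Finset.sum_congr rfl fun a _ => by simp
    refine mul_le_mul (h1 ▸ norm_Gamma_le (h1 ▸ hD))
      (Finset.prod_le_prod (fun a _ => norm_nonneg _) fun a _ => ?_)
      (Finset.prod_nonneg fun a _ => norm_nonneg _) (Real.Gamma_pos_of_pos hD).le
    rw [norm_mul]
    have e1 := hC a (-((ω a : ℂ) + y a * Complex.I)) (by simp)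
    have e2 := (hB a (-c a - ((ω a : ℂ) + y a * Complex.I)) ((h - c a - t a) / 2) (by simp)
      (by simp [ht a])).trans (le_abs_self _)
    have e3 : (-((ω a : ℂ) + y a * Complex.I)).im = -y a := by simp
    rw [e3, abs_neg] at e1
    calc _ ≤ (C a * (1 / (1 + |y a|) ^ 2)) * |B a| :=
          mul_le_mul e1 e2 (norm_nonneg _) (mul_nonneg (hC0 a) (by positivity))
      _ = _ := by ring

end Kernel

section Components

variable {Λ κ : Type} [DecidableEq Λ] [Fintype κ]

/-- The sum over the pairs of legs in different branches. -/
theorem sum_pairs_sub_eq {A : κ → Finset Λ} {B : Finset Λ}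
    (hA : Pairwise fun a b => Disjoint (A a) (A b)) (hAB : ∀ a, A a ⊆ B) (g : Sym2 Λ → ℂ) :
    ∑ q ∈ pairs B, g q - ∑ a, ∑ q ∈ pairs (A a), g q =
      ∑ q ∈ (pairs B).filter (fun q => ∀ a, q ∉ pairs (A a)), g q := by
  classical
  have h1 : ∑ a, ∑ q ∈ pairs (A a), g q =
      ∑ q ∈ (pairs B).filter (fun q => ¬ ∀ a, q ∉ pairs (A a)), g q := by
    rw [← Finset.sum_biUnion]
    · refine Finset.sum_congr ?_ fun _ _ => rfl
      ext q
      simp only [Finset.mem_biUnion, Finset.mem_univ, true_and, Finset.mem_filter, not_forall,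
        not_not]
      exact ⟨fun ⟨a, h⟩ => ⟨pairs_mono (hAB a) h, a, h⟩, fun h => h.2⟩
    · intro a _ b _ hab
      refine Finset.disjoint_left.mpr fun q h2 h3 => ?_
      induction q using Sym2.ind with
      | _ i j =>
        exact Finset.disjoint_left.mp (hA hab) (mk_mem_pairs.mp h2).1 (mk_mem_pairs.mp h3).1
  rw [h1, ← Finset.sum_filter_add_sum_filter_not (pairs B) (fun q => ∀ a, q ∉ pairs (A a)) g]
  ring

/-- Absolute convergence of the integral over the Mandelstam variables of the components. -/
theorem IsContour.integrable_componentIntegrand {Δ : Λ → ℂ} {A : κ → Finset Λ} {E₀ : Finset Λ}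
    {k₀ : Λ} {τ : Sym2 Λ → ℂ} {q₀ : Sym2 Λ}
    (hA : Pairwise fun a b => Disjoint (A a) (A b)) (hAE : ∀ a, Disjoint (A a) E₀)
    (hk₀ : k₀ ∉ Finset.univ.biUnion A ∪ E₀)
    (hne : ∀ a, (pairs (A a)).Nonempty) (hcard : 2 ≤ Fintype.card κ + E₀.card)
    (hτ : IsContour Δ 0 (Finset.univ.biUnion A ∪ insert k₀ E₀) ∅ k₀ τ q₀)
    {d : κ → ℂ} (hu : ∀ a, (∑ i ∈ A a, Δ i - d a).re / 2 < ∑ q ∈ pairs (A a), (τ q).re)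
    {K : (κ → ℂ) → ℂ} (hKm : Measurable K) {C : ℝ}
    (hK : ∀ t : κ → ℂ, (∀ a, (t a).re = (mandelstam (A a) τ).re) → ‖K t‖ ≤ C)
    {δ : Sym2 Λ → ℂ} (hdiag : ∀ i ∈ Finset.univ.biUnion A ∪ E₀, δ s(i, i) = -Δ i)
    (hδ : Below (pairs (Finset.univ.biUnion A ∪ E₀)) τ δ) :
    Integrable fun y : κ → ℝ => componentIntegrand K (Δ k₀) d (∑ i ∈ E₀, Δ i)
      (mandelstam (Finset.univ.biUnion A ∪ E₀) δ) (fun a => mandelstam (A a) δ)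
      fun a => (mandelstam (A a) τ).re + y a * Complex.I := by
  set B := Finset.univ.biUnion A ∪ E₀ with hB
  set L := Finset.univ.biUnion A ∪ insert k₀ E₀ with hL
  have hLB : L = insert k₀ B := by rw [hL, hB, Finset.union_insert]
  have hLe : L.erase k₀ = B := by rw [hLB, Finset.erase_insert hk₀]
  have hk₀L : k₀ ∈ L := hLB ▸ Finset.mem_insert_self _ _
  have hAB : ∀ a, A a ⊆ B := fun a i hi =>
    Finset.mem_union_left _ (Finset.mem_biUnion.mpr ⟨a, Finset.mem_univ a, hi⟩)
  have hBL : B ⊆ L := hLB ▸ Finset.subset_insert _ _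
  have hpos := hτ.pos
  rw [hLe] at hpos
  have hneA : ∀ a, (A a).Nonempty := fun a => by
    obtain ⟨q, hq⟩ := hne a
    induction q using Sym2.ind with
    | _ i j => exact ⟨i, (mk_mem_pairs.mp hq).1⟩
  have hτB := hτ.two_mul_sum_pairs hk₀L
  rw [hLe] at hτB
  have hτA : ∀ a, mandelstam (A a) τ = ∑ i ∈ A a, Δ i - 2 * ∑ q ∈ pairs (A a), τ q :=
    fun a => mandelstam_eq_sub fun i hi => hτ.mellin.diag i (hBL (hAB a hi)) (by simp)
  have hδA : ∀ a, mandelstam (A a) δ = ∑ i ∈ A a, Δ i - 2 * ∑ q ∈ pairs (A a), δ q :=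
    fun a => mandelstam_eq_sub fun i hi => hdiag i (hAB a hi)
  have hδB : mandelstam B δ = ∑ i ∈ B, Δ i - 2 * ∑ q ∈ pairs B, δ q := mandelstam_eq_sub hdiag
  have hsumB : ∑ i ∈ B, Δ i = ∑ a, ∑ i ∈ A a, Δ i + ∑ i ∈ E₀, Δ i := by
    rw [hB, Finset.sum_union, Finset.sum_biUnion]
    · exact fun a _ b _ hab => hA hab
    · rw [Finset.disjoint_biUnion_left]; exact fun a _ => hAE a
  obtain ⟨p, hp, hp'⟩ := exists_cross_pair hA hAE hneA hcard
  have hp'' : p ∈ (pairs B).filter (fun q => ∀ a, q ∉ pairs (A a)) := Finset.mem_filter.mpr ⟨hp, hp'⟩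
  have h0 : (∑ i ∈ E₀, Δ i - Δ k₀) / 2 + ∑ a, mandelstam (A a) τ / 2 =
      ∑ q ∈ (pairs B).filter (fun q => ∀ a, q ∉ pairs (A a)), τ q := by
    rw [← sum_pairs_sub_eq hA hAB, hτB, hsumB]
    simp_rw [hτA]
    rw [← Finset.sum_div, Finset.sum_sub_distrib, ← Finset.mul_sum]
    ring
  have h1 : (∑ i ∈ E₀, Δ i - mandelstam B δ + ∑ a, mandelstam (A a) δ) / 2 =
      ∑ q ∈ (pairs B).filter (fun q => ∀ a, q ∉ pairs (A a)), δ q := by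
    rw [← sum_pairs_sub_eq hA hAB, hδB, hsumB]
    simp_rw [hδA]
    rw [Finset.sum_sub_distrib, ← Finset.mul_sum]
    ring
  have h0' := congrArg Complex.re h0
  rw [Complex.add_re, Complex.re_sum, Complex.re_sum] at h0'
  have h0'' : ∑ a, (mandelstam (A a) τ / 2).re = ∑ a, (mandelstam (A a) τ).re / 2 :=
    Finset.sum_congr rfl fun a _ => by simp
  rw [h0''] at h0'
  refine Witten.integrable_componentIntegrand hKm hK ?_ ?_ (fun a => ?_) fun a => ?_
  · rw [h0']
    exact Finset.sum_pos (fun q hq => hpos q (Finset.mem_filter.mp hq).1) ⟨p, hp''⟩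
  · rw [h0', h1, Complex.re_sum]
    exact Finset.sum_lt_sum_of_nonempty ⟨p, hp''⟩ fun q hq => hδ q (Finset.mem_filter.mp hq).1
  · have h2 := hu a
    rw [hτA]
    simp only [Complex.sub_re, Complex.mul_re, Complex.re_ofNat, Complex.im_ofNat, zero_mul,
      sub_zero, Complex.re_sum] at h2 ⊢
    linarith
  · rw [hτA, hδA]
    have : ∑ q ∈ pairs (A a), (τ q).re < ∑ q ∈ pairs (A a), (δ q).re :=
      Finset.sum_lt_sum_of_nonempty (hne a) fun q hq => hδ q (pairs_mono (hAB a) hq)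
    simp only [Complex.sub_re, Complex.mul_re, Complex.re_ofNat, Complex.im_ofNat, zero_mul,
      sub_zero, Complex.re_sum]
    linarith

end Components

/-! ### Vertex insertion -/

section Insertion

variable {Λ : Type} [DecidableEq Λ]

theorem mandelstam_re_congr {A : Finset Λ} {δ δ' : Sym2 Λ → ℂ}
    (h : ∀ q ∈ A.sym2, (δ q).re = (δ' q).re) : (mandelstam A δ).re = (mandelstam A δ').re := by
  simp only [mandelstam_eq, Complex.neg_re, Complex.re_sum]
  congr 1
  exact Finset.sum_congr rfl fun i hi => Finset.sum_congr rfl fun j hj =>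
    h _ (Finset.mk_mem_sym2_iff.mpr ⟨hi, hj⟩)

theorem measurable_mandelstam (A : Finset Λ) : Measurable (mandelstam A) := by
  have : mandelstam A = fun δ => -∑ i ∈ A, ∑ j ∈ A, δ s(i, j) := funext fun δ => mandelstam_eq A δ
  rw [this]
  fun_prop

theorem measurable_kernelTwo (h c D : ℂ) : Measurable (kernelTwo h c D) := by
  have : kernelTwo h c D = fun s =>
      Complex.Gamma ((D - h + c) / 2) * bfn ((D - h - c) / 2) ((D - s) / 2) :=
    funext fun s => kernelTwo_eq h c D s
  rw [this]
  exact measurable_const.mul (Measurable.bfn measurable_const (by fun_prop))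

theorem bfn_ne_zero {x y : ℂ} (hx : 0 < x.re) (hxy : x.re < y.re) : bfn x y ≠ 0 :=
  div_ne_zero (mul_ne_zero (Complex.Gamma_ne_zero_of_re_pos hx)
    (Complex.Gamma_ne_zero_of_re_pos (by simpa using hxy)))
    (Complex.Gamma_ne_zero_of_re_pos (hx.trans hxy))

theorem forestLocalIntegrand_eq {κ : Type} [Fintype κ] (h c₀ : ℂ) (c : κ → ℂ) (D₀ D' s₀ : ℂ)
    (ω : κ → ℝ) (s t : κ → ℂ) :
    forestLocalIntegrand h c₀ c D₀ D' s₀ ω s t = kernelTwo h c₀ D' s₀ *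
      componentIntegrand (forestKernel h c (D₀ + (h - c₀)) ω) (h - c₀) (fun a => h - c a) D₀ s₀
        s t := by
  rw [forestLocalIntegrand, componentIntegrand, show D₀ - (h - c₀) = D₀ - h + c₀ by ring]
  ring

theorem localIntegrand_eq (h c₀ c₁ D₀ D' s₀ s₁ t : ℂ) :
    localIntegrand h c₀ c₁ D₀ D' s₀ s₁ t =
      kernelTwo h c₀ D' s₀ / kernelTwo h c₁ (D₀ + (h - c₀)) s₁ *
        componentIntegrand (κ := Unit) (fun t => kernelTwo h c₁ (D₀ + (h - c₀)) (t ())) (h - c₀)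
          (fun _ => h - c₁) D₀ s₀ (fun _ => s₁) fun _ => t := by
  simp only [localIntegrand, componentIntegrand, Finset.univ_unique, Finset.sum_singleton,
    Finset.prod_singleton]
  rw [show D₀ - (h - c₀) = D₀ - h + c₀ by ring]
  ring

variable [Fintype Λ]

/-- Insertion onto a vertex that glues several components: the kernel of the vertex depends on the
Mandelstam variables of the components only, so the integral over these is what remains. -/
theorem insertion_onto_components {κ : Type} [Fintype κ] {h c₀ : ℂ} {c : κ → ℂ} {Δ : Λ → ℂ}
    {A : κ → Finset Λ} {E₀ E₁ : Finset Λ} {k : κ → Λ} {k₀ l₀ : Λ}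
    (hA : Pairwise fun a b => Disjoint (A a) (A b))
    (hAE : ∀ a, Disjoint (A a) E₀) (hAE₁ : ∀ a, Disjoint (A a) E₁) (hE : Disjoint E₀ E₁)
    (hk : ∀ a, k a ∉ A a)
    (hk₀ : k₀ ∉ Finset.univ.biUnion A ∪ E₀ ∪ E₁) (hl₀ : l₀ ∉ Finset.univ.biUnion A ∪ E₀ ∪ E₁)
    (hcard : 2 ≤ Fintype.card κ + E₀.card)
    (hΔk : ∀ a, Δ (k a) = h - c a) (hΔk₀ : Δ k₀ = h - c₀) (hΔl₀ : Δ l₀ = h + c₀)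
    {M' : κ → (Sym2 Λ → ℂ) → ℂ} {σ : κ → Sym2 Λ → ℂ} {q : κ → Sym2 Λ}
    {τ ν' : Sym2 Λ → ℂ} {q₀ p₀ : Sym2 Λ} {ω : κ → ℝ}
    (hM' : ∀ a, IsMellinFunction (insert (k a) (A a)) (M' a))
    (hM'g : ∀ a, PolyGrowth (insert (k a) (A a)) Δ (M' a) (fun p => (σ a p).re))
    (hσ : ∀ a, IsContour Δ 0 (insert (k a) (A a)) ∅ (k a) (σ a) (q a))
    (hτ : IsContour Δ 0 (Finset.univ.biUnion A ∪ insert k₀ E₀) ∅ k₀ τ q₀)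
    (hν' : IsContour Δ 0 (insert l₀ E₁) ∅ l₀ ν' p₀)
    (hστ : ∀ a, Below (pairs (A a)) (σ a) τ)
    (hω : ∀ a, ω a < 0 ∧ ω a < (-c a).re ∧ 0 < ((h + c a - mandelstam (A a) τ) / 2).re + ω a)
    (hD : 0 < ((∑ i ∈ E₀, Δ i + (h - c₀) + ((Fintype.card κ : ℂ) - 2) * h + ∑ a, c a) / 2).re +
      ∑ a, ω a)
    {δ : Sym2 Λ → ℂ} (hδ : IsMellin (Finset.univ.biUnion A ∪ E₀ ∪ E₁) ∅ Δ δ)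
    (hτδ : Below (pairs (Finset.univ.biUnion A ∪ E₀)) τ δ) (hν'δ : Below (pairs E₁) ν' δ) :
    Integrable (glueIntegrand 0 (Finset.univ.biUnion A ∪ insert k₀ E₀) ∅ k₀ τ q₀
      (forestGlue h c (∑ i ∈ E₀, Δ i + (h - c₀)) ω A k σ q M') δ) ∧
    Integrable (fun y : κ → ℝ => forestLocalIntegrand h c₀ c (∑ i ∈ E₀, Δ i) (∑ i ∈ E₁, Δ i)
      (mandelstam (Finset.univ.biUnion A ∪ E₀) δ) ω (fun a => mandelstam (A a) δ)
      (fun a => (mandelstam (A a) τ).re + y a * Complex.I)) ∧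
    insertVertex h Δ (Finset.univ.biUnion A ∪ insert k₀ E₀) k₀ τ q₀
      (forestGlue h c (∑ i ∈ E₀, Δ i + (h - c₀)) ω A k σ q M') (insert l₀ E₁) l₀ ν' p₀ δ =
      (∏ a, glueIntegral 0 (insert (k a) (A a)) ∅ (k a) (σ a) (q a) (M' a) δ) *
        forestLocalFactor h c₀ c (∑ i ∈ E₀, Δ i) (∑ i ∈ E₁, Δ i)
          (mandelstam (Finset.univ.biUnion A ∪ E₀) δ) ω (fun a => mandelstam (A a) δ)
          (fun a => (mandelstam (A a) τ).re) := by
  set U := Finset.univ.biUnion A with hU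
  have hAU : ∀ a, A a ⊆ U := fun a i hi => Finset.mem_biUnion.mpr ⟨a, Finset.mem_univ a, hi⟩
  have hk₀' : k₀ ∉ U ∪ E₀ := fun h' => hk₀ (Finset.mem_union_left _ h')
  have hl₀' : l₀ ∉ E₁ := fun h' => hl₀ (Finset.mem_union_right _ h')
  have herase : ∀ a, (insert (k a) (A a)).erase (k a) = A a := fun a => Finset.erase_insert (hk a)
  have hLe : (U ∪ insert k₀ E₀).erase k₀ = U ∪ E₀ := by
    rw [Finset.union_insert, Finset.erase_insert hk₀']
  have hk₀L : k₀ ∈ U ∪ insert k₀ E₀ := by simp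
  have hne : ∀ a, (pairs (A a)).Nonempty := fun a => ⟨q a, by have := (hσ a).mem; rwa [herase] at this⟩
  have hdiag : ∀ i ∈ U ∪ E₀, δ s(i, i) = -Δ i := fun i hi =>
    hδ.diag i (Finset.mem_union_left _ hi) (by simp)
  have hUE₁ : Disjoint (U ∪ E₀) E₁ := by
    rw [Finset.disjoint_union_left, hU, Finset.disjoint_biUnion_left]
    exact ⟨fun a _ => hAE₁ a, hE⟩
  set D₀ := ∑ i ∈ E₀, Δ i with hD₀
  set M₀ := forestGlue h c (D₀ + (h - c₀)) ω A k σ q M' with hM₀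
  set N : κ → (Sym2 Λ → ℂ) → ℂ := fun a =>
    glueIntegral 0 (insert (k a) (A a)) ∅ (k a) (σ a) (q a) (M' a) with hN
  set K := forestKernel h c (D₀ + (h - c₀)) ω with hK
  have hKm : Measurable K := measurable_forestKernel h c _ ω
  have hNm : ∀ a, Measurable (N a) := fun a =>
    measurable_glueIntegral (by simp) (hσ a).mem_indexSet (hM' a).measurable
  have hM₀m : Measurable M₀ :=
    (hKm.comp (measurable_pi_lambda _ fun a => measurable_mandelstam (A a))).mul
      (Finset.measurable_prod _ fun a _ => hNm a)
  have hRep : ∀ a, Reproduces (pairs (A a)) (N a) (∑ p ∈ pairs (A a), σ a p) τ := fun a => by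
    have := reproduces_glueIntegral (hσ a) (Finset.mem_insert_self _ _) (hM' a).measurable
      (hM'g a) (z := τ) (by rw [herase]; exact hστ a)
    rwa [herase] at this
  have hu : ∀ a, ∑ p ∈ pairs (A a), σ a p = (∑ i ∈ A a, Δ i - (h - c a)) / 2 := fun a => by
    have := (hσ a).two_mul_sum_pairs (Finset.mem_insert_self _ _)
    rwa [herase, hΔk] at this
  obtain ⟨C, hC⟩ := exists_norm_forestKernel_le (θ := fun a => (mandelstam (A a) τ).re)
    (fun a => by simpa using hω a) hD
  have hM₀g : GrowsAlong (U ∪ insert k₀ E₀) ∅ Δ M₀ fun q => (τ q).re := by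
    refine GrowsAlong.mul (GrowsAlong.of_bounded (C := C) fun τ' _ hτ' => hC _ fun a => ?_)
      (GrowsAlong.prod _ fun a _ => ?_)
    · exact mandelstam_re_congr fun q hq =>
        hτ' q (Finset.sym2_mono ((hAU a).trans Finset.subset_union_left) hq)
    · refine GrowsAlong.glueIntegral (hσ a) (by simp) (Finset.mem_insert_self _ _) (by simp)
        (hM' a).measurable (hM'g a) ?_ ?_
      · rw [indexSet_empty, herase]; exact hστ a
      · rw [indexSet_empty, herase]
        exact pairs_subset_sym2 ((hAU a).trans Finset.subset_union_left)
  have hKc := hτ.integrable_componentIntegrand hA hAE hk₀' hne hcard (d := fun a => h - c a)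
    (fun a => by
      have h1 := congrArg Complex.re (hu a)
      rw [Complex.re_sum, Complex.div_ofNat_re] at h1
      rw [← h1]
      exact Finset.sum_lt_sum_of_nonempty (hne a) (hστ a)) hKm hC hdiag hτδ
  have hmain := glueIntegral_components hA hAE hk₀' hne hcard hτ hRep hu hKm hM₀m hM₀g
    (fun τ' _ _ => rfl) hdiag hτδ
  rw [hΔk₀] at hKc hmain
  refine ⟨integrable_glueIntegrand hτ (by simp) hk₀L (by simp) hM₀m hM₀g
    (by rwa [indexSet_empty, hLe]), ?_, ?_⟩
  · simp_rw [forestLocalIntegrand_eq]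
    exact hKc.const_mul _
  · have hcon := glueIntegral_contact (Δ' := 0) hν' (Finset.mem_insert_self _ _) hΔl₀ (δ := δ)
      (fun i hi => hδ.diag i (by
        rw [Finset.erase_insert hl₀'] at hi; exact Finset.mem_union_right _ hi) (by simp))
      (by rwa [Finset.erase_insert hl₀'])
    rw [Finset.erase_insert hl₀', ← hδ.mandelstam_compl hUE₁ rfl] at hcon
    rw [insertVertex, Witten.glue, hmain, hcon, forestLocalFactor]
    simp_rw [forestLocalIntegrand_eq]
    rw [integral_const_mul]
    ring

/-- Insertion onto an end vertex: the diagram has a single component, and the kernel of the vertex is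
`K₂`. -/
theorem insertion_onto_end_vertex {h c₀ c₁ : ℂ} {Δ : Λ → ℂ}
    {A₁ E₀ E₁ : Finset Λ} {k₁ l₁ k₀ l₀ : Λ}
    (hA₁E₀ : Disjoint A₁ E₀) (hA₁E₁ : Disjoint A₁ E₁) (hE : Disjoint E₀ E₁)
    (hnodup : [k₁, l₁, k₀, l₀].Nodup) (hnew : ∀ k ∈ [k₁, l₁, k₀, l₀], k ∉ A₁ ∪ E₀ ∪ E₁)
    (hΔk₁ : Δ k₁ = h - c₁) (hΔl₁ : Δ l₁ = h + c₁) (hΔk₀ : Δ k₀ = h - c₀) (hΔl₀ : Δ l₀ = h + c₀)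
    {M' : (Sym2 Λ → ℂ) → ℂ} {σ ν τ ν' : Sym2 Λ → ℂ} {q₁ p₁ q₀ p₀ : Sym2 Λ}
    (hM' : IsMellinFunction (insert k₁ A₁) M')
    (hM'g : PolyGrowth (insert k₁ A₁) Δ M' (fun q => (σ q).re))
    (hσ : IsContour Δ 0 (insert k₁ A₁) ∅ k₁ σ q₁)
    (hν : IsContour Δ 0 (insert l₁ (insert k₀ E₀)) ∅ l₁ ν p₁)
    (hτ : IsContour Δ 0 (A₁ ∪ insert k₀ E₀) ∅ k₀ τ q₀)
    (hν' : IsContour Δ 0 (insert l₀ E₁) ∅ l₀ ν' p₀)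
    (hστ : Below (pairs A₁) σ τ) (hντ : Below (pairs (insert k₀ E₀)) ν τ) :
    let M₀ := insertVertex h Δ (insert k₁ A₁) k₁ σ q₁ M' (insert l₁ (insert k₀ E₀)) l₁ ν p₁
    let M := insertVertex h Δ (A₁ ∪ insert k₀ E₀) k₀ τ q₀ M₀ (insert l₀ E₁) l₀ ν' p₀
    let D₀ := ∑ i ∈ E₀, Δ i
    let D₁ := ∑ i ∈ E₁, Δ i
    let M₀s : (Sym2 Λ → ℂ) → ℂ := fun δ =>
      kernelTwo h c₁ (D₀ + (h - c₀)) (mandelstam A₁ δ) *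
        glueIntegral 0 (insert k₁ A₁) ∅ k₁ σ q₁ M' δ
    (∀ δ, IsMellin (A₁ ∪ insert k₀ E₀) ∅ Δ δ →
      Below (pairs A₁) σ δ → Below (pairs (insert k₀ E₀)) ν δ →
      Integrable (glueIntegrand 0 (insert k₁ A₁) ∅ k₁ σ q₁ M' δ) ∧ M₀ δ = M₀s δ) ∧
    (∀ δ, IsMellin (A₁ ∪ E₀ ∪ E₁) ∅ Δ δ →
      Below (pairs (A₁ ∪ E₀)) τ δ → Below (pairs E₁) ν' δ →
      Integrable (glueIntegrand 0 (A₁ ∪ insert k₀ E₀) ∅ k₀ τ q₀ M₀ δ) ∧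
      Integrable (fun y : ℝ => localIntegrand h c₀ c₁ D₀ D₁ (mandelstam (A₁ ∪ E₀) δ)
        (mandelstam A₁ δ) ((mandelstam A₁ τ).re + y * Complex.I)) ∧
      M δ = M₀s δ * localFactor h c₀ c₁ D₀ D₁ (mandelstam (A₁ ∪ E₀) δ) (mandelstam A₁ δ)
        (mandelstam A₁ τ).re) := by
  intro M₀ M D₀ D₁ M₀s
  have hmem : ∀ k ∈ [k₁, l₁, k₀, l₀], k ∉ A₁ ∧ k ∉ E₀ ∧ k ∉ E₁ := fun k hk => by
    simpa [not_or, and_assoc] using hnew k hk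
  have hk₁ : k₁ ∉ A₁ := (hmem k₁ (by simp)).1
  have hl₁ : l₁ ∉ insert k₀ E₀ := by
    simp only [List.nodup_cons, List.mem_cons, List.not_mem_nil, not_or] at hnodup
    rw [Finset.mem_insert, not_or]
    exact ⟨hnodup.2.1.1, (hmem l₁ (by simp)).2.1⟩
  have hk₀E : k₀ ∉ E₀ := (hmem k₀ (by simp)).2.1
  have hk₀A : k₀ ∉ A₁ := (hmem k₀ (by simp)).1
  have hl₀ : l₀ ∉ E₁ := (hmem l₀ (by simp)).2.2
  have hk₀B : k₀ ∉ A₁ ∪ E₀ := by simp [hk₀A, hk₀E]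
  have e1 : (insert k₁ A₁).erase k₁ = A₁ := Finset.erase_insert hk₁
  have e2 : (insert l₁ (insert k₀ E₀)).erase l₁ = insert k₀ E₀ := Finset.erase_insert hl₁
  have e3 : (A₁ ∪ insert k₀ E₀).erase k₀ = A₁ ∪ E₀ := by
    rw [Finset.union_insert, Finset.erase_insert hk₀B]
  have hdisj : Disjoint A₁ (insert k₀ E₀) := by
    rw [Finset.disjoint_insert_right]; exact ⟨hk₀A, hA₁E₀⟩
  have hsum : ∑ i ∈ insert k₀ E₀, Δ i = D₀ + (h - c₀) := by
    rw [Finset.sum_insert hk₀E, hΔk₀, add_comm]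
  set N : (Sym2 Λ → ℂ) → ℂ := glueIntegral 0 (insert k₁ A₁) ∅ k₁ σ q₁ M' with hN
  have hfirst : ∀ δ, IsMellin (A₁ ∪ insert k₀ E₀) ∅ Δ δ →
      Below (pairs A₁) σ δ → Below (pairs (insert k₀ E₀)) ν δ → M₀ δ = M₀s δ := fun δ hδ h1 h2 => by
    have hcon := glueIntegral_contact (Δ' := 0) hν (Finset.mem_insert_self _ _) hΔl₁ (δ := δ)
      (fun i hi => hδ.diag i (by
        rw [e2] at hi; exact Finset.mem_union_right _ hi) (by simp)) (by rwa [e2])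
    rw [e2, ← hδ.mandelstam_compl hdisj rfl, hsum] at hcon
    show Witten.glue _ _ _ _ _ _ _ _ _ _ δ = _
    rw [Witten.glue, hcon, mul_comm]
  have hNm : Measurable N := measurable_glueIntegral (by simp) hσ.mem_indexSet hM'.measurable
  have hM₀m : Measurable M₀ :=
    hNm.mul (measurable_glueIntegral (by simp) hν.mem_indexSet measurable_const)
  have hM₀g : GrowsAlong (A₁ ∪ insert k₀ E₀) ∅ Δ M₀ fun q => (τ q).re := by
    refine GrowsAlong.mul ?_ ?_
    · refine GrowsAlong.glueIntegral hσ (by simp) (Finset.mem_insert_self _ _) (by simp)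
        hM'.measurable hM'g ?_ ?_
      · rw [indexSet_empty, e1]; exact hστ
      · rw [indexSet_empty, e1]; exact pairs_subset_sym2 Finset.subset_union_left
    · refine GrowsAlong.glueIntegral hν (by simp) (Finset.mem_insert_self _ _) (by simp)
        measurable_const (growsAlong_contact _ _ _ _ _ _ _) ?_ ?_
      · rw [indexSet_empty, e2]; exact hντ
      · rw [indexSet_empty, e2]; exact pairs_subset_sym2 Finset.subset_union_right
  refine ⟨fun δ hδ h1 h2 => ⟨integrable_glueIntegrand hσ (by simp) (Finset.mem_insert_self _ _)
    (by simp) hM'.measurable hM'g (by rwa [indexSet_empty, e1]), hfirst δ hδ h1 h2⟩,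
    fun δ hδ hτδ hν'δ => ⟨integrable_glueIntegrand hτ (by simp) (by simp) (by simp) hM₀m hM₀g
      (by rwa [indexSet_empty, e3]), ?_⟩⟩
  have hdiag : ∀ i ∈ A₁ ∪ E₀, δ s(i, i) = -Δ i := fun i hi =>
    hδ.diag i (Finset.mem_union_left _ hi) (by simp)
  have hq₁ := hσ.mem
  rw [e1] at hq₁
  have hp₁ := hν.mem
  rw [e2] at hp₁
  -- the left argument of the Beta function in the kernel, and its second argument at `τ`
  have hx := hν.two_mul_sum_pairs (Finset.mem_insert_self _ _)
  rw [e2, hsum, hΔl₁] at hx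
  have hy : (D₀ + (h - c₀) - mandelstam A₁ τ) / 2 = ∑ q ∈ pairs (insert k₀ E₀), τ q := by
    rw [hτ.mellin.mandelstam_compl hdisj rfl, mandelstam_eq_sub (Δ := Δ) fun i hi =>
      hτ.mellin.diag i (Finset.mem_union_right _ hi) (by simp), hsum]
    ring
  have hx' : (D₀ + (h - c₀) - h - c₁) / 2 = ∑ q ∈ pairs (insert k₀ E₀), ν q := by rw [hx]; ring
  have hxpos : 0 < ((D₀ + (h - c₀) - h - c₁) / 2).re := by
    rw [hx', Complex.re_sum]
    exact Finset.sum_pos (fun q hq => hν.pos q (by rwa [e2])) ⟨p₁, hp₁⟩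
  have hxy : ((D₀ + (h - c₀) - h - c₁) / 2).re < ((D₀ + (h - c₀) - mandelstam A₁ τ) / 2).re := by
    rw [hx', hy, Complex.re_sum, Complex.re_sum]
    exact Finset.sum_lt_sum_of_nonempty ⟨p₁, hp₁⟩ hντ
  have hst : (mandelstam A₁ δ).re < (mandelstam A₁ τ).re := by
    rw [mandelstam_eq_sub (Δ := Δ) fun i hi => hdiag i (Finset.mem_union_left _ hi),
      mandelstam_eq_sub (Δ := Δ) fun i hi =>
        hτ.mellin.diag i (Finset.mem_union_left _ hi) (by simp)]
    have : ∑ q ∈ pairs A₁, (τ q).re < ∑ q ∈ pairs A₁, (δ q).re :=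
      Finset.sum_lt_sum_of_nonempty ⟨q₁, hq₁⟩ fun q hq =>
        hτδ q (pairs_mono Finset.subset_union_left hq)
    simp only [Complex.sub_re, Complex.mul_re, Complex.re_ofNat, Complex.im_ofNat, zero_mul,
      sub_zero, Complex.re_sum]
    linarith
  set s₀ := mandelstam (A₁ ∪ E₀) δ
  set s₁ := mandelstam A₁ δ with hs₁
  set θ := (mandelstam A₁ τ).re with hθ
  set K : (Unit → ℂ) → ℂ := fun t => kernelTwo h c₁ (D₀ + (h - c₀)) (t ()) with hK
  have hKm : Measurable K := (measurable_kernelTwo h c₁ _).comp (measurable_pi_apply ())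
  obtain ⟨C, hC⟩ := exists_norm_bfn_le hxpos hxy
  have hKb : ∀ t : Unit → ℂ, (∀ a, (t a).re = (mandelstam A₁ τ).re) →
      ‖K t‖ ≤ ‖Complex.Gamma ((D₀ + (h - c₀) - h + c₁) / 2)‖ * C := fun t ht => by
    rw [hK]
    simp only
    rw [kernelTwo_eq, norm_mul]
    exact mul_le_mul_of_nonneg_left (hC _ _ rfl (by simp [ht ()])) (norm_nonneg _)
  have hbi : (Finset.univ : Finset Unit).biUnion (fun _ => A₁) = A₁ := by simp
  have hA : Pairwise fun a b : Unit => Disjoint A₁ A₁ := fun a b hab => absurd rfl hab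
  have hcard : 2 ≤ Fintype.card Unit + E₀.card := by
    have : E₀.Nonempty := by
      by_contra hE₀
      rw [Finset.not_nonempty_iff_eq_empty] at hE₀
      rw [hE₀] at hp₁
      simp [pairs] at hp₁
      exact hp₁.2 (by rw [hp₁.1]; simp)
    have := this.card_pos
    rw [Fintype.card_unit]
    omega
  have hRep : Reproduces (pairs A₁) N (∑ p ∈ pairs A₁, σ p) τ := by
    have := reproduces_glueIntegral (Δ' := 0) hσ (Finset.mem_insert_self _ _) hM'.measurable
      hM'g (z := τ) (by rwa [e1])
    rwa [e1] at this
  have hu : ∑ p ∈ pairs A₁, σ p = (∑ i ∈ A₁, Δ i - (h - c₁)) / 2 := by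
    have := hσ.two_mul_sum_pairs (Finset.mem_insert_self _ _)
    rwa [e1, hΔk₁] at this
  have hKc := IsContour.integrable_componentIntegrand (A := fun _ : Unit => A₁) (E₀ := E₀)
    (Δ := Δ) (k₀ := k₀) (τ := τ) (q₀ := q₀) (δ := δ) hA (fun _ => hA₁E₀) (by rwa [hbi])
    (fun _ => ⟨q₁, hq₁⟩) hcard (by rwa [hbi]) (d := fun _ => h - c₁)
    (fun _ => by
      have h1 := congrArg Complex.re hu
      rw [Complex.re_sum, Complex.div_ofNat_re] at h1
      rw [← h1]
      exact Finset.sum_lt_sum_of_nonempty ⟨q₁, hq₁⟩ hστ) hKm hKb (by rwa [hbi]) (by rwa [hbi])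
  have hmain := glueIntegral_components (A := fun _ : Unit => A₁) (E₀ := E₀)
    (Δ := Δ) (k₀ := k₀) (τ := τ) (q₀ := q₀) (δ := δ) (N := fun _ => N) (M₀ := M₀) hA
    (fun _ => hA₁E₀) (by rwa [hbi]) (fun _ => ⟨q₁, hq₁⟩) hcard (by rwa [hbi]) (fun _ => hRep)
    (d := fun _ => h - c₁) (fun _ => hu) hKm hM₀m (by rwa [hbi])
    (fun τ' hτ' hre => by
      rw [hbi] at hτ'
      rw [hfirst τ' hτ' (fun q hq => by rw [hre]; exact hστ q hq)
        (fun q hq => by rw [hre]; exact hντ q hq)]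
      simp [M₀s, hK, hN])
    (by rwa [hbi]) (by rwa [hbi])
  rw [hbi, hΔk₀] at hKc hmain
  simp only [Finset.univ_unique, Finset.prod_singleton, Fintype.card_unit, pow_one] at hmain
  set F : ℂ → ℂ := fun t => componentIntegrand (κ := Unit) K (h - c₀) (fun _ => h - c₁) D₀ s₀
    (fun _ => s₁) fun _ => t with hF
  have hmp := volume_preserving_funUnique Unit ℝ
  have hKc' : Integrable fun y : ℝ => F (θ + y * Complex.I) :=
    (hmp.integrable_comp_emb (MeasurableEquiv.funUnique Unit ℝ).measurableEmbedding).mp hKc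
  have hint : ∫ y : Unit → ℝ, componentIntegrand K (h - c₀) (fun _ => h - c₁) D₀ s₀
      (fun _ => s₁) (fun a => (θ : ℂ) + y a * Complex.I) = ∫ y : ℝ, F (θ + y * Complex.I) :=
    hmp.integral_comp (MeasurableEquiv.funUnique Unit ℝ).measurableEmbedding
      fun y : ℝ => F (θ + y * Complex.I)
  refine ⟨?_, ?_⟩
  · simp_rw [localIntegrand_eq]
    exact hKc'.const_mul _
  have hcon := glueIntegral_contact (Δ' := 0) hν' (Finset.mem_insert_self _ _) hΔl₀ (δ := δ)
    (fun i hi => hδ.diag i (by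
      rw [Finset.erase_insert hl₀] at hi; exact Finset.mem_union_right _ hi) (by simp))
    (by rwa [Finset.erase_insert hl₀])
  rw [Finset.erase_insert hl₀, ← hδ.mandelstam_compl
    (by rw [Finset.disjoint_union_left]; exact ⟨hA₁E₁, hE⟩) rfl] at hcon
  have hM : M δ = N δ * (1 / 2 * ((∫ y : ℝ, F (θ + y * Complex.I)) / (2 * (Real.pi : ℂ)))) *
      kernelTwo h c₀ D₁ s₀ := by
    show Witten.glue _ _ _ _ _ _ _ _ _ _ δ = _
    rw [Witten.glue, hcon, hmain, hint]
  have hloc : ∫ y : ℝ, localIntegrand h c₀ c₁ D₀ D₁ s₀ s₁ (θ + y * Complex.I) =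
      kernelTwo h c₀ D₁ s₀ / kernelTwo h c₁ (D₀ + (h - c₀)) s₁ *
        ∫ y : ℝ, F (θ + y * Complex.I) := by
    rw [← integral_const_mul]
    exact integral_congr_ae (Filter.Eventually.of_forall fun y => localIntegrand_eq _ _ _ _ _ _ _ _)
  rw [hM, localFactor, hloc]
  show _ = kernelTwo h c₁ (D₀ + (h - c₀)) s₁ * N δ * _
  by_cases h0 : kernelTwo h c₁ (D₀ + (h - c₀)) s₁ = 0
  · -- the kernel vanishes at `s₁` only if `Γ` takes its conventional value at a pole
    have hΓ : Complex.Gamma ((D₀ + (h - c₀) - h + c₁) / 2) = 0 := by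
      rw [kernelTwo_eq, mul_eq_zero] at h0
      refine h0.resolve_right (bfn_ne_zero hxpos (hxy.trans ?_))
      simp only [Complex.div_ofNat_re, Complex.sub_re]
      linarith
    have hF0 : ∀ t, F t = 0 := fun t => by
      simp [hF, componentIntegrand, hK, kernelTwo_eq, hΓ]
    simp [hF0, h0]
  · generalize (∫ y : ℝ, F (θ + y * Complex.I)) = J
    field_simp

end Insertion

/-! ### Collapsing blocks of legs -/

section Blocks

variable {Λ : Type}

/-- The Mellin variables between blocks of legs: the entry at `(l, l')` is the sum of the variables
between the legs in the block `A l` and those in the block `A l'`. -/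
def blockVars (A : Λ → Finset Λ) (δ : Sym2 Λ → ℂ) : Sym2 Λ → ℂ :=
  Sym2.lift ⟨fun l l' => ∑ i ∈ A l, ∑ j ∈ A l', δ s(i, j), by
    intro l l'
    show ∑ i ∈ A l, ∑ j ∈ A l', δ s(i, j) = ∑ i ∈ A l', ∑ j ∈ A l, δ s(i, j)
    rw [Finset.sum_comm]
    exact Finset.sum_congr rfl fun i _ => Finset.sum_congr rfl fun j _ => by rw [Sym2.eq_swap]⟩

theorem blockVars_mk (A : Λ → Finset Λ) (δ : Sym2 Λ → ℂ) (l l' : Λ) :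
    blockVars A δ s(l, l') = ∑ i ∈ A l, ∑ j ∈ A l', δ s(i, j) := rfl

theorem blockVars_congr {A A' : Λ → Finset Λ} {L : Finset Λ} (h : ∀ l ∈ L, A l = A' l)
    (δ : Sym2 Λ → ℂ) : ∀ q ∈ L.sym2, blockVars A δ q = blockVars A' δ q := fun q hq => by
  induction q using Sym2.ind with
  | _ l l' =>
    obtain ⟨h1, h2⟩ := Finset.mk_mem_sym2_iff.mp hq
    rw [blockVars_mk, blockVars_mk, h l h1, h l' h2]

variable [DecidableEq Λ]

theorem blockVars_diag (A : Λ → Finset Λ) (δ : Sym2 Λ → ℂ) (l : Λ) :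
    blockVars A δ s(l, l) = -mandelstam (A l) δ := by
  rw [mandelstam_eq, neg_neg, blockVars_mk]

/-- The legs `L` of a composite diagram are partitioned into blocks, labelled by the legs `L₀` of one
part of it; blocks with labels outside `X` consist of the leg itself. -/
structure Blocks (L₀ X L : Finset Λ) (A : Λ → Finset Λ) : Prop where
  disj : ∀ l ∈ L₀, ∀ l' ∈ L₀, l ≠ l' → Disjoint (A l) (A l')
  union : L = L₀.biUnion A
  single : ∀ l ∈ L₀, l ∉ X → A l = {l}
  sub : X ⊆ L₀

variable {L₀ X L : Finset Λ} {A : Λ → Finset Λ}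

theorem Blocks.subset (h : Blocks L₀ X L A) {l : Λ} (hl : l ∈ L₀) : A l ⊆ L := fun i hi => by
  rw [h.union]; exact Finset.mem_biUnion.mpr ⟨l, hl, hi⟩

theorem Blocks.mem (h : Blocks L₀ X L A) {l : Λ} (hl : l ∈ L₀) (hlX : l ∉ X) : l ∈ L :=
  h.subset hl (by rw [h.single l hl hlX]; exact Finset.mem_singleton_self l)

theorem Blocks.subset_erase (h : Blocks L₀ X L A) {a l : Λ} (ha : a ∈ L₀) (haX : a ∉ X)
    (hl : l ∈ L₀) (hla : l ≠ a) : A l ⊆ L.erase a := fun i hi => by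
  refine Finset.mem_erase.mpr ⟨?_, h.subset hl hi⟩
  rintro rfl
  exact Finset.disjoint_left.mp (h.disj l hl i ha hla) hi
    (by rw [h.single i ha haX]; exact Finset.mem_singleton_self i)

/-- Sums over the blocks obey the constraints of the part, in which the legs with proper blocks are off
shell. -/
theorem Blocks.isMellin (h : Blocks L₀ X L A) {Δ : Λ → ℂ} {δ : Sym2 Λ → ℂ}
    (hδ : IsMellin L ∅ Δ δ) : IsMellin L₀ X Δ (blockVars A δ) where
  row l hl := by
    simp_rw [blockVars_mk]
    rw [Finset.sum_comm]
    refine Finset.sum_eq_zero fun i hi => ?_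
    rw [← Finset.sum_biUnion fun l hl l' hl' hne => h.disj l hl l' hl' hne, ← h.union]
    exact hδ.row i (h.subset hl hi)
  diag l hl hlX := by
    rw [blockVars_mk, h.single l hl hlX, Finset.sum_singleton, Finset.sum_singleton]
    exact hδ.diag l (h.mem hl hlX) (by simp)

/-- The rows determine the entries at one leg. -/
theorem IsMellin.eq_of_eq_erase {Δ : Λ → ℂ} {x x' : Sym2 Λ → ℂ} (h : IsMellin L X Δ x)
    (h' : IsMellin L X Δ x') {a : Λ} (ha : a ∈ L) (he : ∀ q ∈ (L.erase a).sym2, x q = x' q) :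
    ∀ q ∈ L.sym2, x q = x' q := by
  have hrow : ∀ y, IsMellin L X Δ y → ∀ l ∈ L, y s(l, a) = -∑ j ∈ L.erase a, y s(l, j) :=
    fun y hy l hl => by
      have := hy.row l hl
      rw [← Finset.sum_erase_add L _ ha] at this
      linear_combination this
  have h1 : ∀ l ∈ L.erase a, x s(l, a) = x' s(l, a) := fun l hl => by
    have hlL := Finset.mem_of_mem_erase hl
    rw [hrow x h l hlL, hrow x' h' l hlL]
    congr 1
    exact Finset.sum_congr rfl fun j hj => he _ (Finset.mk_mem_sym2_iff.mpr ⟨hl, hj⟩)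
  have h2 : x s(a, a) = x' s(a, a) := by
    rw [hrow x h a ha, hrow x' h' a ha]
    congr 1
    exact Finset.sum_congr rfl fun j hj => by rw [Sym2.eq_swap]; exact h1 j hj
  intro q hq
  induction q using Sym2.ind with
  | _ l l' =>
    obtain ⟨hl, hl'⟩ := Finset.mk_mem_sym2_iff.mp hq
    by_cases e : l = a
    · by_cases e' : l' = a
      · rw [e, e', h2]
      · rw [e, Sym2.eq_swap]; exact h1 l' (Finset.mem_erase.mpr ⟨e', hl'⟩)
    · by_cases e' : l' = a
      · rw [e']; exact h1 l (Finset.mem_erase.mpr ⟨e, hl⟩)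
      · exact he _ (Finset.mk_mem_sym2_iff.mpr
          ⟨Finset.mem_erase.mpr ⟨e, hl⟩, Finset.mem_erase.mpr ⟨e', hl'⟩⟩)

open Classical in
/-- The label of the block that contains `i`. -/
noncomputable def blockOf (L₀ : Finset Λ) (A : Λ → Finset Λ) (i : Λ) : Λ :=
  if h : ∃ l ∈ L₀, i ∈ A l then h.choose else i

theorem Blocks.blockOf_eq (h : Blocks L₀ X L A) {i l : Λ} (hl : l ∈ L₀) (hi : i ∈ A l) :
    blockOf L₀ A i = l := by
  have hex : ∃ l ∈ L₀, i ∈ A l := ⟨l, hl, hi⟩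
  rw [blockOf, dif_pos hex]
  by_contra hne
  exact Finset.disjoint_left.mp (h.disj _ hex.choose_spec.1 l hl hne) hex.choose_spec.2 hi

theorem Blocks.blockOf_mem (h : Blocks L₀ X L A) {i : Λ} (hi : i ∈ L) :
    blockOf L₀ A i ∈ L₀ ∧ i ∈ A (blockOf L₀ A i) := by
  rw [h.union] at hi
  obtain ⟨l, hl, hil⟩ := Finset.mem_biUnion.mp hi
  rw [h.blockOf_eq hl hil]
  exact ⟨hl, hil⟩

theorem Blocks.blockOf_mem_erase (h : Blocks L₀ X L A) {a i : Λ} (ha : a ∈ L₀) (haX : a ∉ X)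
    (hi : i ∈ L.erase a) : blockOf L₀ A i ∈ L₀.erase a := by
  obtain ⟨hne, hiL⟩ := Finset.mem_erase.mp hi
  obtain ⟨h1, h2⟩ := h.blockOf_mem hiL
  refine Finset.mem_erase.mpr ⟨fun e => hne ?_, h1⟩
  rw [e, h.single a ha haX] at h2
  exact Finset.mem_singleton.mp h2

variable {a : Λ}

theorem Blocks.map_mem_indexSet (h : Blocks L₀ X L A) (ha : a ∈ L₀) (haX : a ∉ X) {q : Sym2 Λ}
    (hq : q ∈ pairs (L.erase a)) : Sym2.map (blockOf L₀ A) q ∈ indexSet L₀ X a := by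
  induction q using Sym2.ind with
  | _ i j =>
    obtain ⟨hi, hj, hij⟩ := mk_mem_pairs.mp hq
    have h1 := h.blockOf_mem_erase ha haX hi
    have h2 := h.blockOf_mem_erase ha haX hj
    rw [Sym2.map_mk]
    by_cases e : blockOf L₀ A i = blockOf L₀ A j
    · rw [← e, diag_mem_indexSet]
      by_contra hX
      have h3 := (h.blockOf_mem (Finset.mem_of_mem_erase hi)).2
      have h4 := (h.blockOf_mem (Finset.mem_of_mem_erase hj)).2
      rw [← e] at h4
      rw [h.single _ (Finset.mem_of_mem_erase h1) hX, Finset.mem_singleton] at h3 h4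
      exact hij (h3.trans h4.symm)
    · exact Finset.mem_union_left _ (mk_mem_pairs.mpr ⟨h1, h2, e⟩)

theorem Blocks.fiber_diag (h : Blocks L₀ X L A) (ha : a ∈ L₀) (haX : a ∉ X) {b : Λ}
    (hb : b ∈ L₀) (hba : b ≠ a) :
    (pairs (L.erase a)).filter (fun q => Sym2.map (blockOf L₀ A) q = s(b, b)) = pairs (A b) := by
  ext q
  induction q using Sym2.ind with
  | _ i j =>
    rw [Finset.mem_filter, mk_mem_pairs, mk_mem_pairs, Sym2.map_mk, Sym2.eq_iff, or_self]
    constructor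
    · rintro ⟨⟨hi, hj, hij⟩, e1, e2⟩
      exact ⟨e1 ▸ (h.blockOf_mem (Finset.mem_of_mem_erase hi)).2,
        e2 ▸ (h.blockOf_mem (Finset.mem_of_mem_erase hj)).2, hij⟩
    · rintro ⟨hi, hj, hij⟩
      have hs := h.subset_erase ha haX hb hba
      exact ⟨⟨hs hi, hs hj, hij⟩, h.blockOf_eq hb hi, h.blockOf_eq hb hj⟩

theorem Blocks.fiber_cross (h : Blocks L₀ X L A) (ha : a ∈ L₀) (haX : a ∉ X) {l l' : Λ}
    (hq : s(l, l') ∈ pairs (L₀.erase a)) :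
    (pairs (L.erase a)).filter (fun q => Sym2.map (blockOf L₀ A) q = s(l, l')) =
      (A l ×ˢ A l').image fun p => s(p.1, p.2) := by
  obtain ⟨hl, hl', hne⟩ := mk_mem_pairs.mp hq
  obtain ⟨hla, hl⟩ := Finset.mem_erase.mp hl
  obtain ⟨hla', hl'⟩ := Finset.mem_erase.mp hl'
  ext q
  induction q using Sym2.ind with
  | _ i j =>
    rw [Finset.mem_filter, mk_mem_pairs, Sym2.map_mk, Sym2.eq_iff, Finset.mem_image]
    constructor
    · rintro ⟨⟨hi, hj, hij⟩, e⟩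
      have hi' := (h.blockOf_mem (Finset.mem_of_mem_erase hi)).2
      have hj' := (h.blockOf_mem (Finset.mem_of_mem_erase hj)).2
      rcases e with ⟨e1, e2⟩ | ⟨e1, e2⟩
      · exact ⟨(i, j), Finset.mem_product.mpr ⟨e1 ▸ hi', e2 ▸ hj'⟩, rfl⟩
      · exact ⟨(j, i), Finset.mem_product.mpr ⟨e2 ▸ hj', e1 ▸ hi'⟩, Sym2.eq_swap⟩
    · rintro ⟨⟨i', j'⟩, hp, e⟩
      obtain ⟨hi, hj⟩ := Finset.mem_product.mp hp
      have h1 := h.blockOf_eq hl hi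
      have h2 := h.blockOf_eq hl' hj
      have hij : i' ≠ j' := fun e => hne (by rw [← h1, ← h2]; simp only at e ⊢; rw [e])
      have hi' := h.subset_erase ha haX hl hla hi
      have hj' := h.subset_erase ha haX hl' hla' hj
      rcases Sym2.eq_iff.mp e with ⟨rfl, rfl⟩ | ⟨rfl, rfl⟩
      · exact ⟨⟨hi', hj', hij⟩, Or.inl ⟨h1, h2⟩⟩
      · exact ⟨⟨hj', hi', hij.symm⟩, Or.inr ⟨h2, h1⟩⟩

theorem Blocks.sum_fiber_cross (h : Blocks L₀ X L A) (ha : a ∈ L₀) (haX : a ∉ X) {l l' : Λ}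
    (hq : s(l, l') ∈ pairs (L₀.erase a)) {M : Type} [AddCommMonoid M] (g : Sym2 Λ → M) :
    ∑ q ∈ (pairs (L.erase a)).filter (fun q => Sym2.map (blockOf L₀ A) q = s(l, l')), g q =
      ∑ i ∈ A l, ∑ j ∈ A l', g s(i, j) := by
  rw [h.fiber_cross ha haX hq, Finset.sum_image, Finset.sum_product]
  obtain ⟨hl, hl', hne⟩ := mk_mem_pairs.mp hq
  have hd := h.disj l (Finset.mem_of_mem_erase hl) l' (Finset.mem_of_mem_erase hl') hne
  rintro ⟨i, j⟩ hp ⟨i', j'⟩ hp' e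
  obtain ⟨hi, hj⟩ := Finset.mem_product.mp hp
  obtain ⟨hi', hj'⟩ := Finset.mem_product.mp hp'
  rcases Sym2.eq_iff.mp e with ⟨e1, e2⟩ | ⟨e1, e2⟩
  · exact Prod.ext e1 e2
  · simp only at e1 e2 hi hj'
    exact absurd hj' (Finset.disjoint_left.mp hd (e1 ▸ hi))

/-- Entries of the Mellin variables between blocks along a vertical contour: the displacements are
the sums of the displacements over the pairs of legs in the two blocks. -/
theorem Blocks.blockVars_contourAt (h : Blocks L₀ X L A) (ha : a ∈ L₀) (haX : a ∉ X) {Δ : Λ → ℂ}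
    {τ : Sym2 Λ → ℂ} (hτ : IsMellin L ∅ Δ τ) {w : Sym2 Λ → ℝ}
    (hw : ∀ q ∉ pairs (L.erase a), w q = 0) (hw0 : ∑ q ∈ pairs (L.erase a), w q = 0) :
    ∀ q ∈ L₀.sym2, blockVars A (contourAt L a τ w) q = contourAt L₀ a (blockVars A τ)
      (fiberSum (pairs (L.erase a)) (Sym2.map (blockOf L₀ A)) w) q := by
  set U := fiberSum (pairs (L.erase a)) (Sym2.map (blockOf L₀ A)) w with hU
  have hLa : a ∈ L := h.mem ha haX
  have hm1 := h.isMellin (hτ.contourAt (w := w) (by simp) hLa (by simp)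
    (by rwa [indexSet_empty]) (by rwa [indexSet_empty]))
  have hm2 : IsMellin L₀ X Δ (contourAt L₀ a (blockVars A τ) U) := by
    refine (h.isMellin hτ).contourAt haX ha h.sub (fun q hq => ?_) ?_
    · rw [hU, fiberSum, Finset.filter_eq_empty_iff.mpr, Finset.sum_empty]
      exact fun p hp e => hq (e ▸ h.map_mem_indexSet ha haX hp)
    · rw [← hw0, ← Finset.sum_fiberwise_of_maps_to (s := pairs (L.erase a))
        (fun q hq => h.map_mem_indexSet ha haX hq)]
      rfl
  have hc : ∀ q, a ∉ q → ∀ (L : Finset Λ) τ w, contourAt L a τ w q = τ q + Complex.I * spread w q :=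
    fun q hq L τ w => by rw [contourAt, if_neg hq]
  have hA : ∀ l ∈ L₀.erase a, a ∉ A l := fun l hl hal => by
    obtain ⟨hne, hl⟩ := Finset.mem_erase.mp hl
    exact absurd rfl (Finset.mem_erase.mp (h.subset_erase ha haX hl hne hal)).1
  refine hm1.eq_of_eq_erase hm2 ha fun q hq => ?_
  induction q using Sym2.ind with
  | _ l l' =>
    obtain ⟨hl, hl'⟩ := Finset.mk_mem_sym2_iff.mp hq
    have hla := (Finset.mem_erase.mp hl).1
    have hla' := (Finset.mem_erase.mp hl').1
    have e1 : blockVars A (contourAt L a τ w) s(l, l') = blockVars A τ s(l, l') +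
        Complex.I * ((∑ i ∈ A l, ∑ j ∈ A l', spread w s(i, j) : ℝ) : ℂ) := by
      rw [blockVars_mk, blockVars_mk]
      push_cast
      rw [Finset.mul_sum, ← Finset.sum_add_distrib]
      refine Finset.sum_congr rfl fun i hi => ?_
      rw [Finset.mul_sum, ← Finset.sum_add_distrib]
      refine Finset.sum_congr rfl fun j hj => hc _ ?_ _ _ _
      rw [Sym2.mem_iff, not_or]
      exact ⟨fun e => hA l hl (e ▸ hi), fun e => hA l' hl' (e ▸ hj)⟩
    rw [e1, hc _ (by rw [Sym2.mem_iff, not_or]; exact ⟨hla.symm, hla'.symm⟩)]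
    congr 3
    by_cases hne : l = l'
    · subst hne
      rw [sum_sum_eq_pairs, Finset.sum_eq_zero, zero_add, spread, if_pos (by simp), hU, fiberSum,
        h.fiber_diag ha haX (Finset.mem_of_mem_erase hl) hla]
      · congr 1
        exact Finset.sum_congr rfl fun q hq => by rw [spread, if_neg (Finset.mem_filter.mp hq).2]
      · exact fun i _ => by rw [spread, if_pos (by simp), hw _ diag_notMem_pairs, mul_zero]
    · have hp : s(l, l') ∈ pairs (L₀.erase a) := mk_mem_pairs.mpr ⟨hl, hl', hne⟩
      rw [spread, if_neg (by simpa using hne), hU, fiberSum, h.sum_fiber_cross ha haX hp]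
      refine Finset.sum_congr rfl fun i hi => Finset.sum_congr rfl fun j hj => ?_
      rw [spread, if_neg]
      rw [Sym2.mk_isDiag_iff]
      rintro rfl
      exact Finset.disjoint_left.mp (h.disj l (Finset.mem_of_mem_erase hl) l'
        (Finset.mem_of_mem_erase hl') hne) hi hj

end Blocks

section Blocks

variable {Λ : Type} [DecidableEq Λ] {L₀ X L : Finset Λ} {A : Λ → Finset Λ} {a : Λ}
  {Δ Δ' Δ'' : Λ → ℂ} {τ δ : Sym2 Λ → ℂ} {q₀ q₁ : Sym2 Λ}

/-- The variable of an off-shell leg is, up to a constant, the sum over the pairs inside its block. -/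
theorem betaArg_blockVars {b : Λ} (hdiag : ∀ i ∈ A b, δ s(i, i) = -Δ i) :
    betaArg Δ' (blockVars A δ) s(b, b) =
      ∑ q ∈ pairs (A b), δ q - (∑ i ∈ A b, Δ i - Δ' b) / 2 := by
  rw [betaArg_diag, blockVars_diag, mandelstam_eq_sub hdiag]
  ring

theorem Blocks.nonempty (h : Blocks L₀ X L A) (hX : ∀ b ∈ X, (pairs (A b)).Nonempty) {l : Λ}
    (hl : l ∈ L₀) : (A l).Nonempty := by
  by_cases hlX : l ∈ X
  · obtain ⟨q, hq⟩ := hX l hlX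
    induction q using Sym2.ind with
    | _ i j => exact ⟨i, (mk_mem_pairs.mp hq).1⟩
  · rw [h.single l hl hlX]; exact Finset.singleton_nonempty l

theorem Blocks.cross_mem (h : Blocks L₀ X L A) (ha : a ∈ L₀) (haX : a ∉ X) {l l' i j : Λ}
    (hq : s(l, l') ∈ pairs (L₀.erase a)) (hi : i ∈ A l) (hj : j ∈ A l') :
    s(i, j) ∈ pairs (L.erase a) := by
  have : s(i, j) ∈ (pairs (L.erase a)).filter
      fun q => Sym2.map (blockOf L₀ A) q = s(l, l') := by
    rw [h.fiber_cross ha haX hq]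
    exact Finset.mem_image.mpr ⟨(i, j), Finset.mem_product.mpr ⟨hi, hj⟩, rfl⟩
  exact (Finset.mem_filter.mp this).1

/-- A contour of the composite diagram induces one for its part. -/
theorem Blocks.isContour (h : Blocks L₀ X L A) (ha : a ∈ L₀) (haX : a ∉ X)
    (hX : ∀ b ∈ X, (pairs (A b)).Nonempty) (hτ : IsContour Δ Δ'' L ∅ a τ q₀)
    (hu : ∀ b ∈ X, ((∑ i ∈ A b, Δ i - Δ' b) / 2).re < (∑ q ∈ pairs (A b), τ q).re)
    (hq₁ : q₁ ∈ pairs (L₀.erase a)) : IsContour Δ Δ' L₀ X a (blockVars A τ) q₁ where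
  mellin := h.isMellin hτ.mellin
  pos q hq := by
    induction q using Sym2.ind with
    | _ l l' =>
      obtain ⟨hl, hl', -⟩ := mk_mem_pairs.mp hq
      rw [blockVars_mk, Complex.re_sum]
      refine Finset.sum_pos (fun i hi => ?_) (h.nonempty hX (Finset.mem_of_mem_erase hl))
      rw [Complex.re_sum]
      exact Finset.sum_pos (fun j hj => hτ.pos _ (h.cross_mem ha haX hq hi hj))
        (h.nonempty hX (Finset.mem_of_mem_erase hl'))
  pos_off b hb := by
    have h1 := betaArg_blockVars (A := A) (Δ := Δ) (Δ' := Δ') (δ := τ) (b := b) fun i hi =>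
      hτ.mellin.diag i (h.subset (h.sub hb) hi) (by simp)
    rw [betaArg_diag] at h1
    have h2 := congrArg Complex.re h1
    rw [Complex.sub_re, Complex.div_ofNat_re] at h2
    linarith [hu b hb]
  mem := hq₁

/-- The local variables are ordered on the contour as those of the composite diagram are. -/
theorem Blocks.below (h : Blocks L₀ X L A) (ha : a ∈ L₀) (haX : a ∉ X)
    (hX : ∀ b ∈ X, (pairs (A b)).Nonempty) (hτ : ∀ i ∈ L.erase a, τ s(i, i) = -Δ i)
    (hδ : ∀ i ∈ L.erase a, δ s(i, i) = -Δ i) (hτδ : Below (pairs (L.erase a)) τ δ) :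
    Below (indexSet L₀ X a) (blockVars A τ) (blockVars A δ) := by
  intro q hq
  rw [indexSet, Finset.mem_union] at hq
  rcases hq with hq | hq
  · induction q using Sym2.ind with
    | _ l l' =>
      obtain ⟨hl, hl', -⟩ := mk_mem_pairs.mp hq
      rw [blockVars_mk, blockVars_mk, Complex.re_sum, Complex.re_sum]
      refine Finset.sum_lt_sum_of_nonempty (h.nonempty hX (Finset.mem_of_mem_erase hl)) fun i hi => ?_
      rw [Complex.re_sum, Complex.re_sum]
      exact Finset.sum_lt_sum_of_nonempty (h.nonempty hX (Finset.mem_of_mem_erase hl'))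
        fun j hj => hτδ _ (h.cross_mem ha haX hq hi hj)
  · obtain ⟨b, hb, rfl⟩ := Finset.mem_image.mp hq
    have hs := h.subset_erase ha haX (h.sub hb) fun e => haX (e ▸ hb)
    rw [blockVars_diag, blockVars_diag, mandelstam_eq_sub fun i hi => hτ i (hs hi),
      mandelstam_eq_sub fun i hi => hδ i (hs hi)]
    have h1 : ∑ q ∈ pairs (A b), (τ q).re < ∑ q ∈ pairs (A b), (δ q).re :=
      Finset.sum_lt_sum_of_nonempty (hX b hb) fun q hq => hτδ q (pairs_mono hs hq)
    simp only [Complex.neg_re, Complex.sub_re, Complex.mul_re, Complex.re_ofNat, Complex.im_ofNat,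
      zero_mul, sub_zero, Complex.re_sum]
    linarith

variable [Fintype Λ]

/-- Gluing leg `a` of a composite diagram, one part of which carries `a`: the integrals inside the
blocks reproduce the factors `N b`, and the remaining integral over the variables between blocks is
the gluing integral of that part alone, with the legs in `X` off shell. -/
theorem Blocks.glueIntegral_eq (h : Blocks L₀ X L A) (ha : a ∈ L₀) (haX : a ∉ X)
    (hX : ∀ b ∈ X, (pairs (A b)).Nonempty) (hτ : IsContour Δ Δ'' L ∅ a τ q₀)
    (hq₁ : q₁ ∈ pairs (L₀.erase a)) {H : (Sym2 Λ → ℂ) → ℂ} (hH : IsMellinFunction L₀ H)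
    {N : Λ → (Sym2 Λ → ℂ) → ℂ}
    (hN : ∀ b ∈ X, Reproduces (pairs (A b)) (N b) ((∑ i ∈ A b, Δ i - Δ' b) / 2) τ)
    {M : (Sym2 Λ → ℂ) → ℂ} (hMm : Measurable M) (hMg : GrowsAlong L ∅ Δ M fun q => (τ q).re)
    (hM : ∀ τ', IsMellin L ∅ Δ τ' → (∀ q, (τ' q).re = (τ q).re) →
      M τ' = H (blockVars A τ') * ∏ b ∈ X, N b τ')
    (hdiag : ∀ i ∈ L.erase a, δ s(i, i) = -Δ i) (hδ : Below (pairs (L.erase a)) τ δ) :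
    glueIntegral Δ'' L ∅ a τ q₀ M δ =
      glueIntegral Δ' L₀ X a (blockVars A τ) q₁ H (blockVars A δ) * ∏ b ∈ X, N b δ := by
  have hLa : a ∈ L := h.mem ha haX
  have hint := integrable_lineIntegrand hτ (by simp) hLa (by simp) hMm hMg (δ := δ)
    (by rwa [indexSet_empty])
  have hq₀ := hτ.mem
  have hq₁' : q₁ ∈ indexSet L₀ X a := Finset.mem_union_left _ hq₁
  rw [Witten.glueIntegral_eq (by simp) hτ.mem_indexSet hMm,
    Witten.glueIntegral_eq haX hq₁' hH.measurable]
  rw [indexSet_empty] at hint ⊢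
  set Q := pairs (L.erase a) with hQ
  set J := indexSet L₀ X a with hJ
  set π := Sym2.map (blockOf L₀ A) with hπ
  have hXa : ∀ b ∈ X, b ≠ a := fun b hb e => haX (e ▸ hb)
  have hout : ∀ b : Λ, (s(b, b) : Sym2 Λ).out.1 = b := fun b => by
    have := Sym2.out_fst_mem (s(b, b) : Sym2 Λ)
    simpa using this
  -- the block of pairs inside `A b` is labelled by `s(b, b)` and carries `N b`; the block of pairs
  -- between `A l` and `A l'` is labelled by `s(l, l')` and carries the constant `1`
  set N' : Sym2 Λ → (Sym2 Λ → ℂ) → ℂ := fun q => if q.IsDiag then N q.out.1 else fun _ => 1 with hN'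
  set u' : Sym2 Λ → ℂ := fun q => if q.IsDiag then
    (∑ i ∈ A q.out.1, Δ i - Δ' q.out.1) / 2 else 0 with hu'
  have hN'd : ∀ b, N' s(b, b) = N b := fun b => by
    simp only [hN', Sym2.mk_isDiag_iff, if_true, hout]
  have hu'd : ∀ b, u' s(b, b) = (∑ i ∈ A b, Δ i - Δ' b) / 2 := fun b => by
    simp only [hu', Sym2.mk_isDiag_iff, if_true, hout]
  have hN'p : ∀ q ∈ pairs (L₀.erase a), N' q = fun _ => 1 := fun q hq => by
    simp only [hN', if_neg (Finset.mem_filter.mp hq).2]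
  have hu'p : ∀ q ∈ pairs (L₀.erase a), u' q = 0 := fun q hq => by
    simp only [hu', if_neg (Finset.mem_filter.mp hq).2]
  have hprodN : ∀ z, ∏ j ∈ J, N' j z = ∏ b ∈ X, N b z := fun z => by
    rw [hJ, prod_indexSet, Finset.prod_eq_one fun q hq => by rw [hN'p q hq], one_mul]
    exact Finset.prod_congr rfl fun b _ => by rw [hN'd]
  set H' : (Sym2 Λ → ℝ) → ℂ := fun U => H (contourAt L₀ a (blockVars A τ) U) with hH'
  have hH'm : Measurable H' := hH.measurable.comp (measurable_contourAt _ _ _)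
  have hRep : ∀ j ∈ J, Reproduces (Q.filter fun q => π q = j) (N' j) (u' j) τ := fun j hj => by
    rw [hJ, indexSet, Finset.mem_union] at hj
    rcases hj with hj | hj
    · rw [hN'p j hj, hu'p j hj]
      exact reproduces_one fun q hq => hτ.pos q (Finset.mem_filter.mp hq).1
    · obtain ⟨b, hb, rfl⟩ := Finset.mem_image.mp hj
      rw [hN'd, hu'd, hQ, hπ, h.fiber_diag ha haX (h.sub hb) (hXa b hb)]
      exact hN b hb
  have hline : ∀ᵐ w ∂hyperVolume Q q₀, lineIntegrand Δ'' L ∅ a τ M δ w =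
      (H' (fiberSum Q π w) * ∏ j ∈ J, N' j (shift τ w)) * ∏ q ∈ Q, bfn (shift τ w q) (δ q) := by
    filter_upwards [hyperVolume_ae hq₀] with w hw
    have hmel := hτ.mellin.contourAt (w := w) (by simp) hLa (by simp)
      (by rw [indexSet_empty]; exact hw.1) (by rw [indexSet_empty]; exact hw.2)
    rw [lineIntegrand_empty, hM _ hmel fun q => contourAt_re L a τ w q, hprodN]
    congr 2
    · exact hH.depends _ _ (h.blockVars_contourAt ha haX hτ.mellin hw.1 hw.2)
    · refine Finset.prod_congr rfl fun b hb => (hN b hb).depends _ _ fun q hq => ?_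
      rw [contourAt_of_mem_pairs _ _
        (pairs_mono (h.subset_erase ha haX (h.sub hb) (hXa b hb)) hq), shift]
  rw [integral_congr_ae hline, integral_of_reproduces (π := π) (J := J) (j₀ := q₁)
    (fun q hq => h.map_mem_indexSet ha haX hq) ?_ hq₀ hq₁' hδ hH'm hRep (hint.congr hline), hprodN,
    mul_comm]
  · congr 3
    funext U
    rw [lineIntegrand]
    congr 1
    refine Finset.prod_congr rfl fun j hj => ?_
    rw [indexSet, Finset.mem_union] at hj
    rcases hj with hj | hj
    · rw [hu'p j hj, betaArg_of_mem_pairs _ _ hj, betaArg_of_mem_pairs _ _ hj]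
      induction j using Sym2.ind with
      | _ l l' =>
        rw [h.sum_fiber_cross ha haX hj, h.sum_fiber_cross ha haX hj, sub_zero, sub_zero]
        rfl
    · obtain ⟨b, hb, rfl⟩ := Finset.mem_image.mp hj
      have hs := h.subset_erase ha haX (h.sub hb) (hXa b hb)
      rw [hu'd, hπ, h.fiber_diag ha haX (h.sub hb) (hXa b hb),
        betaArg_blockVars (Δ := Δ) fun i hi =>
          hτ.mellin.diag i (Finset.mem_of_mem_erase (hs hi)) (by simp),
        betaArg_blockVars (Δ := Δ) fun i hi => hdiag i (hs hi)]
  · intro j hj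
    rw [hJ, indexSet, Finset.mem_union] at hj
    rcases hj with hj | hj
    · induction j using Sym2.ind with
      | _ l l' =>
        obtain ⟨hl, hl', -⟩ := mk_mem_pairs.mp hj
        obtain ⟨i, hi⟩ := h.nonempty hX (Finset.mem_of_mem_erase hl)
        obtain ⟨i', hi'⟩ := h.nonempty hX (Finset.mem_of_mem_erase hl')
        refine ⟨s(i, i'), h.cross_mem ha haX hj hi hi', ?_⟩
        rw [hπ, Sym2.map_mk, h.blockOf_eq (Finset.mem_of_mem_erase hl) hi,
          h.blockOf_eq (Finset.mem_of_mem_erase hl') hi']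
    · obtain ⟨b, hb, rfl⟩ := Finset.mem_image.mp hj
      obtain ⟨q, hq⟩ := hX b hb
      have : q ∈ Q.filter fun q => π q = s(b, b) := by
        rw [hQ, hπ, h.fiber_diag ha haX (h.sub hb) (hXa b hb)]; exact hq
      exact ⟨q, Finset.mem_filter.mp this⟩

end Blocks

/-! ### Cutting tree propagators -/

namespace ScalarDiagram

variable {V E ι : Type} {G : ScalarDiagram V E ι}

/-- A property of vertices that is preserved along the propagators of a path is preserved along the
path. -/
theorem Joined.iff {P : E → Prop} {Q : V → Prop} (hQ : ∀ e, P e → (Q (G.src e) ↔ Q (G.tgt e)))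
    {v w : V} (h : G.Joined P v w) : Q v ↔ Q w := by
  induction h with
  | rel v w h =>
    obtain ⟨e, he, rfl, rfl⟩ := h
    exact hQ e he
  | refl v => rfl
  | symm v w _ ih => exact ih.symm
  | trans u v w _ _ ih1 ih2 => exact ih1.trans ih2

theorem Joined.symm {P : E → Prop} {v w : V} (h : G.Joined P v w) : G.Joined P w v :=
  Relation.EqvGen.symm _ _ h

theorem Joined.trans {P : E → Prop} {u v w : V} (h : G.Joined P u v) (h' : G.Joined P v w) :
    G.Joined P u w :=
  Relation.EqvGen.trans _ _ _ h h'

theorem joined_refl (P : E → Prop) (v : V) : G.Joined P v v := Relation.EqvGen.refl v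

theorem Joined.mono {P Q : E → Prop} (hPQ : ∀ e, P e → Q e) {v w : V} (h : G.Joined P v w) :
    G.Joined Q v w :=
  Relation.EqvGen.mono (fun _ _ ⟨e, he, h⟩ => ⟨e, hPQ e he, h⟩) v w h

theorem partOf_eq_iff {v w : V} :
    G.partOf v = G.partOf w ↔ G.Joined (fun e => ¬ G.IsTree e) v w :=
  Quotient.eq (r := G.partSetoid)

/-- After cutting a propagator of a connected diagram, every vertex is joined to one of its ends. -/
theorem Connected.joined_or (hG : G.Connected) (e : E) (b : Bool) (v : V) :
    G.Joined (fun e' => e' ≠ e) (G.base (.inr (e, b))) v ∨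
      G.Joined (fun e' => e' ≠ e) (G.base (.inr (e, !b))) v := by
  have key : G.Joined (fun e' => e' ≠ e) (G.src e) v ∨ G.Joined (fun e' => e' ≠ e) (G.tgt e) v := by
    refine (Joined.iff (Q := fun v => G.Joined (fun e' => e' ≠ e) (G.src e) v ∨
      G.Joined (fun e' => e' ≠ e) (G.tgt e) v) (fun e' _ => ?_) (hG.2 (G.src e) v)).mp
      (Or.inl (joined_refl _ _))
    by_cases h : e' = e
    · subst h
      exact ⟨fun _ => Or.inr (joined_refl _ _), fun _ => Or.inl (joined_refl _ _)⟩
    · have hj : G.Joined (fun e' => e' ≠ e) (G.src e') (G.tgt e') :=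
        Relation.EqvGen.rel _ _ ⟨e', h, rfl, rfl⟩
      exact or_congr ⟨fun h => h.trans hj, fun h => h.trans hj.symm⟩
        ⟨fun h => h.trans hj, fun h => h.trans hj.symm⟩
  cases b
  · exact key
  · exact key.symm

theorem IsTree.not_joined {e : E} (he : G.IsTree e) (b : Bool) :
    ¬ G.Joined (fun e' => e' ≠ e) (G.base (.inr (e, b))) (G.base (.inr (e, !b))) := by
  cases b
  · exact he
  · exact fun h => he h.symm

theorem IsTree.partOf_ne {e : E} (he : G.IsTree e) (b : Bool) :
    G.partOf (G.base (.inr (e, b))) ≠ G.partOf (G.base (.inr (e, !b))) := fun h =>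
  he.not_joined b ((partOf_eq_iff.mp h).mono fun e' he' h' => he' (by rw [h']; exact he))

/-- Propagators between different parts are tree propagators. -/
theorem isTree_of_partOf_ne {e : E} {b : Bool}
    (h : G.partOf (G.base (.inr (e, b))) ≠ G.partOf (G.base (.inr (e, !b)))) : G.IsTree e := by
  by_contra he
  refine h (partOf_eq_iff.mpr ?_)
  have : G.Joined (fun e => ¬ G.IsTree e) (G.src e) (G.tgt e) :=
    Relation.EqvGen.rel _ _ ⟨e, he, rfl, rfl⟩
  cases b
  · exact this
  · exact this.symm

variable [Fintype E] [Fintype ι]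

theorem mem_boundary {l : G.Label} : l ∈ G.boundary ↔ l.isLeft := by
  classical
  simp [boundary]

theorem branch_inl (i : ι) : G.branch (.inl i) = {.inl i} := rfl

theorem mem_branch_inr {e : E} {b : Bool} {k : G.Label} : k ∈ G.branch (.inr (e, b)) ↔
    k.isLeft ∧ ¬ G.Joined (fun e' => e' ≠ e) (G.base (.inr (e, b))) (G.base k) := by
  classical
  rw [branch, Finset.mem_filter, mem_boundary]

theorem branch_subset_boundary (l : G.Label) : G.branch l ⊆ G.boundary := by
  intro k hk
  rw [mem_boundary]
  rcases l with i | ⟨e, b⟩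
  · rw [branch_inl, Finset.mem_singleton] at hk
    rw [hk]; rfl
  · exact (mem_branch_inr.mp hk).1

/-- The two ends of a propagator see disjoint sets of boundary points. -/
theorem Connected.disjoint_branch (hG : G.Connected) (e : E) (b : Bool) :
    Disjoint (G.branch (.inr (e, b))) (G.branch (.inr (e, !b))) := by
  rw [Finset.disjoint_left]
  intro k hk hk'
  rcases hG.joined_or e b (G.base k) with h | h
  · exact (mem_branch_inr.mp hk).2 h
  · exact (mem_branch_inr.mp hk').2 h

/-- Every boundary point is seen from one end of a tree propagator. -/
theorem IsTree.branch_union [DecidableEq ι] [DecidableEq E] {e : E} (he : G.IsTree e) (b : Bool) :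
    G.branch (.inr (e, b)) ∪ G.branch (.inr (e, !b)) = G.boundary := by
  ext k
  rw [Finset.mem_union, mem_branch_inr, mem_branch_inr, mem_boundary, ← and_or_left]
  refine ⟨fun h => h.1, fun h => ⟨h, ?_⟩⟩
  by_contra hn
  push Not at hn
  exact he.not_joined b (hn.1.trans hn.2.symm)

variable [Fintype V]

theorem mem_legs_inl {S : Finset G.Part} {i : ι} :
    (.inl i : G.Label) ∈ G.legs S ↔ G.partOf (G.base (.inl i)) ∈ S := by
  classical
  simp [legs]

theorem mem_legs_inr {S : Finset G.Part} {e : E} {b : Bool} :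
    (.inr (e, b) : G.Label) ∈ G.legs S ↔ G.partOf (G.base (.inr (e, b))) ∈ S ∧
      G.IsTree e ∧ G.partOf (G.base (.inr (e, !b))) ∉ S := by
  classical
  rw [legs, Finset.mem_filter]
  simp

theorem partOf_of_mem_legs {S : Finset G.Part} {l : G.Label} (h : l ∈ G.legs S) :
    G.partOf (G.base l) ∈ S := by
  rcases l with i | ⟨e, b⟩
  · exact mem_legs_inl.mp h
  · exact (mem_legs_inr.mp h).1

theorem mem_treeLegs {B : G.Part} {l : G.Label} :
    l ∈ G.treeLegs B ↔ l ∈ G.legs {B} ∧ l.isRight := by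
  classical
  rw [treeLegs, Finset.mem_filter]

theorem mem_treeLegs_inr {B : G.Part} {e : E} {b : Bool} :
    (.inr (e, b) : G.Label) ∈ G.treeLegs B ↔ G.partOf (G.base (.inr (e, b))) = B ∧ G.IsTree e := by
  rw [mem_treeLegs, mem_legs_inr, Finset.mem_singleton, Finset.mem_singleton]
  constructor
  · rintro ⟨⟨h1, h2, -⟩, -⟩
    exact ⟨h1, h2⟩
  · rintro ⟨h1, h2⟩
    exact ⟨⟨h1, h2, fun h => h2.partOf_ne b (h1.trans h.symm)⟩, rfl⟩

theorem treeLegs_subset (B : G.Part) : G.treeLegs B ⊆ G.legs {B} := fun _ h => (mem_treeLegs.mp h).1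

theorem disjoint_legs {S S' : Finset G.Part} (h : Disjoint S S') :
    Disjoint (G.legs S) (G.legs S') :=
  Finset.disjoint_left.mpr fun _ hl hl' =>
    Finset.disjoint_left.mp h (partOf_of_mem_legs hl) (partOf_of_mem_legs hl')

variable {S S' : Finset G.Part} {e : E} {b : Bool}

/-- The legs of a glued diagram, when the second diagram has no further open tree propagator. -/
theorem legs_union [DecidableEq ι] [DecidableEq E] (hSS' : Disjoint S S') (he : G.IsTree e)
    (hS : G.partOf (G.base (.inr (e, b))) ∈ S) (hS' : G.partOf (G.base (.inr (e, !b))) ∈ S')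
    (hcomp : ∀ l ∈ G.legs S', l.isRight → l = .inr (e, !b)) :
    G.legs (S ∪ S') = (G.legs S).erase (.inr (e, b)) ∪ (G.legs S').erase (.inr (e, !b)) := by
  have hd : ∀ P ∈ S, P ∉ S' := fun P hP => Finset.disjoint_left.mp hSS' hP
  ext l
  rcases l with i | ⟨e₂, b₂⟩
  · simp [mem_legs_inl]
  · simp only [mem_legs_inr, Finset.mem_union, Finset.mem_erase, not_or]
    constructor
    · rintro ⟨h1, h2, h3, h4⟩
      rcases h1 with h1 | h1
      · refine Or.inl ⟨fun h => ?_, h1, h2, h3⟩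
        obtain ⟨rfl, rfl⟩ := Prod.mk.inj (Sum.inr.inj h)
        exact h4 hS'
      · refine Or.inr ⟨fun h => ?_, h1, h2, h4⟩
        obtain ⟨rfl, rfl⟩ := Prod.mk.inj (Sum.inr.inj h)
        rw [Bool.not_not] at h3
        exact h3 hS
    · rintro (⟨h1, h2, h3, h4⟩ | ⟨h1, h2, h3, h4⟩)
      · refine ⟨Or.inl h2, h3, h4, fun h5 => h1 ?_⟩
        have h6 := hcomp (.inr (e₂, !b₂)) (mem_legs_inr.mpr
          ⟨h5, h3, by rw [Bool.not_not]; exact hd _ h2⟩) rfl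
        obtain ⟨rfl, h7⟩ := Prod.mk.inj (Sum.inr.inj h6)
        rw [Bool.not_inj h7]
      · exact absurd (hcomp _ (mem_legs_inr.mpr ⟨h2, h3, h4⟩) rfl) h1

/-- The boundary points of a complete subdiagram are those seen through the propagator that connects
it to the rest. -/
theorem branch_eq_erase [DecidableEq ι] [DecidableEq E] (hG : G.Connected)
    (hS : G.partOf (G.base (.inr (e, b))) ∉ S') (hS' : G.partOf (G.base (.inr (e, !b))) ∈ S')
    (hcomp : ∀ l ∈ G.legs S', l.isRight → l = .inr (e, !b)) :
    G.branch (.inr (e, b)) = (G.legs S').erase (.inr (e, !b)) := by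
  -- a path that avoids `e` does not leave `S'`
  have hclosed : ∀ {v w : V}, G.Joined (fun e' => e' ≠ e) v w →
      (G.partOf v ∈ S' ↔ G.partOf w ∈ S') := by
    intro v w h
    refine h.iff (Q := fun v => G.partOf v ∈ S') fun e' he' => ?_
    by_contra hne
    have hcase : ∀ c : Bool, G.partOf (G.base (.inr (e', c))) ∈ S' →
        G.partOf (G.base (.inr (e', !c))) ∉ S' → False := fun c h1 h2 => by
      have h3 : G.IsTree e' := isTree_of_partOf_ne (b := c) fun h => h2 (h ▸ h1)
      have h4 := hcomp _ (mem_legs_inr.mpr ⟨h1, h3, h2⟩) rfl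
      exact he' (Prod.mk.inj (Sum.inr.inj h4)).1
    by_cases h1 : G.partOf (G.src e') ∈ S'
    · by_cases h2 : G.partOf (G.tgt e') ∈ S'
      · exact hne (by simp [h1, h2])
      · exact hcase false h1 h2
    · by_cases h2 : G.partOf (G.tgt e') ∈ S'
      · exact hcase true h2 h1
      · exact hne (by simp [h1, h2])
  have hmem : ∀ v, G.partOf v ∈ S' ↔
      ¬ G.Joined (fun e' => e' ≠ e) (G.base (.inr (e, b))) v := fun v => by
    constructor
    · exact fun h h' => hS ((hclosed h').mpr h)
    · intro h
      exact (hclosed ((hG.joined_or e b v).resolve_left h)).mp hS'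
  ext l
  rw [mem_branch_inr, Finset.mem_erase]
  rcases l with i | ⟨e₂, b₂⟩
  · simp [mem_legs_inl, hmem]
  · simp only [Sum.isLeft_inr, Bool.false_eq_true, false_and, false_iff]
    exact fun h => h.1 (hcomp _ h.2 rfl)

end ScalarDiagram

/-! ### Dressed parts -/

theorem indexSet_subset_sym2 {Λ : Type} [DecidableEq Λ] {L X : Finset Λ} (hX : X ⊆ L) (a : Λ) :
    indexSet L X a ⊆ L.sym2 := by
  refine Finset.union_subset (pairs_subset_sym2 (Finset.erase_subset _ _)) fun q hq => ?_
  obtain ⟨b, hb, rfl⟩ := Finset.mem_image.mp hq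
  exact Finset.mk_mem_sym2_iff.mpr ⟨hX hb, hX hb⟩

theorem IsContour.of_empty {Λ : Type} [DecidableEq Λ] {Δ Δ' : Λ → ℂ} {L : Finset Λ} {a : Λ}
    {τ : Sym2 Λ → ℂ} {q₀ : Sym2 Λ} (h : IsContour Δ Δ' L ∅ a τ q₀) (Δ'' : Λ → ℂ) :
    IsContour Δ Δ'' L ∅ a τ q₀ :=
  ⟨h.mellin, h.pos, by simp, h.mem⟩

namespace ScalarDiagram

variable {V E ι : Type} [Fintype V] [Fintype E] [Fintype ι] {G : ScalarDiagram V E ι}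
  {loop : G.Part → (Sym2 G.Label → ℂ) → ℂ} {B : G.Part}

theorem isMellinFunction_partAmp (hloop : IsMellinFunction (G.legs {B}) (loop B)) :
    IsMellinFunction (G.legs {B}) (G.partAmp loop B) := by
  unfold partAmp
  split_ifs
  · exact hloop
  · exact ⟨measurable_const, fun _ _ _ => rfl⟩

variable [DecidableEq E] [DecidableEq ι] {X : Finset G.Label} {R : Set (Sym2 G.Label → ℝ)}
  {H : (Sym2 G.Label → ℂ) → ℂ}

theorem Dressed.subset (h : G.Dressed loop B X R H) : X ⊆ G.treeLegs B := by
  induction h with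
  | bare => simp
  | dress a τ q _ ha _ _ _ _ ih => exact Finset.insert_subset ha ih

theorem Dressed.subset_legs (h : G.Dressed loop B X R H) : X ⊆ G.legs {B} :=
  h.subset.trans (treeLegs_subset B)

theorem Dressed.isMellinFunction (h : G.Dressed loop B X R H)
    (hloop : IsMellinFunction (G.legs {B}) (loop B)) : IsMellinFunction (G.legs {B}) H := by
  induction h with
  | bare => exact isMellinFunction_partAmp hloop
  | dress a τ q hH ha haX hτ hR _ ih =>
    exact ⟨measurable_glueIntegral haX hτ.mem_indexSet ih.measurable, fun x x' hx =>
      glueIntegral_congr haX τ q _ fun p hp => hx p (indexSet_subset_sym2 hH.subset_legs a hp)⟩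

theorem Dressed.growsAlong (h : G.Dressed loop B X R H)
    (hloop : IsMellinFunction (G.legs {B}) (loop B)) {ρ : Sym2 G.Label → ℝ} (hρ : ρ ∈ R) :
    GrowsAlong (G.legs {B}) X G.labelDim H ρ := by
  induction h generalizing ρ with
  | bare => exact hρ
  | dress a τ q hH ha haX hτ hR _ ih =>
    exact GrowsAlong.glueIntegral hτ haX (treeLegs_subset B ha) hH.subset_legs
      (hH.isMellinFunction hloop).measurable (ih hR) hρ (indexSet_subset_sym2 hH.subset_legs a)

/-- The domain of a dressed part depends on the local variables only. -/
theorem Dressed.mem_of_eq (h : G.Dressed loop B X R H) {ρ ρ' : Sym2 G.Label → ℝ}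
    (he : ∀ q ∈ (G.legs {B}).sym2, ρ q = ρ' q) (hρ : ρ ∈ R) : ρ' ∈ R := by
  cases h with
  | bare =>
    obtain ⟨C, N, hC⟩ := hρ
    exact ⟨C, N, fun τ hτ hτρ => hC τ hτ fun q hq => (hτρ q hq).trans (he q hq).symm⟩
  | dress a τ q hH ha haX hτ hR _ =>
    exact fun p hp => (hρ p hp).trans_eq (he p (indexSet_subset_sym2 hH.subset_legs a hp))

/-- A leg can be dressed only if two further legs are present. -/
theorem Dressed.exists_pair (h : G.Dressed loop B X R H) (hX : X.Nonempty) (a : G.Label) :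
    (pairs ((G.legs {B}).erase a)).Nonempty := by
  cases h with
  | bare => simp at hX
  | dress b τ q hH hb hbX hτ hR _ =>
    have hq := hτ.mem
    have hbL := treeLegs_subset B hb
    induction q using Sym2.ind with
    | _ i j =>
      obtain ⟨hi, hj, hij⟩ := mk_mem_pairs.mp hq
      obtain ⟨hib, hi⟩ := Finset.mem_erase.mp hi
      obtain ⟨hjb, hj⟩ := Finset.mem_erase.mp hj
      by_cases hia : i = a
      · subst hia
        exact ⟨s(b, j), mk_mem_pairs.mpr ⟨Finset.mem_erase.mpr ⟨hib.symm, hbL⟩,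
          Finset.mem_erase.mpr ⟨hij.symm, hj⟩, hjb.symm⟩⟩
      · by_cases hja : j = a
        · subst hja
          exact ⟨s(i, b), mk_mem_pairs.mpr ⟨Finset.mem_erase.mpr ⟨hij, hi⟩,
            Finset.mem_erase.mpr ⟨hjb.symm, hbL⟩, hib⟩⟩
        · exact ⟨s(i, j), mk_mem_pairs.mpr ⟨Finset.mem_erase.mpr ⟨hia, hi⟩,
            Finset.mem_erase.mpr ⟨hja, hj⟩, hij⟩⟩

/-- On the domain of a dressed part the arguments of the Gamma functions of its dressed legs have
positive real part: a leg of dimension `Δ` has `x_aa = -Δ` before it is dressed, and dressing moves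
all other variables to the right, hence `x_aa` as well. -/
theorem Dressed.re_pos (h : G.Dressed loop B X R H) {x : Sym2 G.Label → ℂ}
    (hx : IsMellin (G.legs {B}) X G.labelDim x) (hxR : (fun q => (x q).re) ∈ R) :
    ∀ b ∈ X, 0 < (G.labelDim b + x s(b, b)).re := by
  induction h generalizing x with
  | bare => simp
  | @dress X R H a τ q hH ha haX hτ hR _ ih =>
    have haL := treeLegs_subset B ha
    have hXa : ∀ b ∈ X, b ≠ a := fun b hb e => haX (e ▸ hb)
    intro b hb
    rcases Finset.mem_insert.mp hb with rfl | hb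
    · have h1 := hx.mandelstam_erase haL
      have h2 := hτ.mellin.mandelstam_erase haL
      rw [mandelstam_eq, neg_inj, sum_sum_eq_pairs] at h1 h2
      have h3 : ∑ i ∈ (G.legs {B}).erase b, (τ s(i, i)).re ≤
          ∑ i ∈ (G.legs {B}).erase b, (x s(i, i)).re := by
        refine Finset.sum_le_sum fun i hi => ?_
        obtain ⟨hib, hiL⟩ := Finset.mem_erase.mp hi
        by_cases hiX : i ∈ X
        · exact (hxR _ (diag_mem_indexSet.mpr hiX)).le
        · rw [hτ.mellin.diag i hiL hiX, hx.diag i hiL (by simp [hib, hiX])]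
      have h4 : ∑ p ∈ pairs ((G.legs {B}).erase b), (τ p).re <
          ∑ p ∈ pairs ((G.legs {B}).erase b), (x p).re :=
        Finset.sum_lt_sum_of_nonempty ⟨q, hτ.mem⟩ fun p hp =>
          hxR p (Finset.mem_union_left _ hp)
      have h5 := hτ.mellin.diag b haL haX
      rw [← h1]
      rw [h5] at h2
      have h6 := congrArg Complex.re h2
      simp only [Complex.add_re, Complex.mul_re, Complex.re_ofNat, Complex.im_ofNat, zero_mul,
        sub_zero, Complex.re_sum, Complex.neg_re] at h6 ⊢
      linarith
    · have h1 := ih hτ.mellin hR b hb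
      have h2 := hxR _ (diag_mem_indexSet.mpr hb)
      simp only [Complex.add_re] at h1 h2 ⊢
      linarith

end ScalarDiagram

/-! ### Expanding a pre-amplitude around its root part -/

/-- Merging new legs `C` into the block of the leg `a`, which is thereby replaced. -/
theorem Blocks.insert {Λ : Type} [DecidableEq Λ] {L₀ X L C : Finset Λ} {A A' : Λ → Finset Λ}
    (h : Blocks L₀ X L A) {a : Λ} (ha : a ∈ L₀) (haX : a ∉ X)
    (hA' : ∀ l ∈ L₀, l ≠ a → A' l = A l) (haC : A' a = C) (hC : Disjoint (L.erase a) C) :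
    Blocks L₀ (insert a X) (L.erase a ∪ C) A' where
  disj l hl l' hl' hne := by
    have hs : ∀ l ∈ L₀, l ≠ a → A' l ⊆ L.erase a := fun l hl hla => by
      rw [hA' l hl hla]; exact h.subset_erase ha haX hl hla
    by_cases e : l = a
    · subst e
      rw [haC]
      exact (Finset.disjoint_of_subset_left (hs l' hl' hne.symm) hC).symm
    · by_cases e' : l' = a
      · subst e'
        rw [haC]
        exact Finset.disjoint_of_subset_left (hs l hl e) hC
      · rw [hA' l hl e, hA' l' hl' e']
        exact h.disj l hl l' hl' hne
  union := by
    ext i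
    rw [Finset.mem_union, Finset.mem_biUnion]
    constructor
    · rintro (hi | hi)
      · have h1 := h.blockOf_mem (Finset.mem_of_mem_erase hi)
        have h2 := (Finset.mem_erase.mp (h.blockOf_mem_erase ha haX hi)).1
        exact ⟨_, h1.1, by rw [hA' _ h1.1 h2]; exact h1.2⟩
      · exact ⟨a, ha, haC ▸ hi⟩
    · rintro ⟨l, hl, hi⟩
      by_cases e : l = a
      · subst e
        exact Or.inr (haC ▸ hi)
      · rw [hA' l hl e] at hi
        exact Or.inl (h.subset_erase ha haX hl e hi)
  single l hl hlX := by
    rw [Finset.mem_insert, not_or] at hlX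
    rw [hA' l hl hlX.1, h.single l hl hlX.2]
  sub := Finset.insert_subset ha h.sub

namespace ScalarDiagram

variable {V E ι : Type} {G : ScalarDiagram V E ι}

theorem farDim_inr (e : E) (b : Bool) : G.labelDim (.inr (e, !b)) = G.farDim (.inr (e, b)) := by
  cases b <;> simp only [labelDim, farDim, Bool.not_false, Bool.not_true] <;> ring

variable [Fintype E] [Fintype ι]

theorem localVars_eq (δ : Sym2 G.Label → ℂ) : G.localVars δ = blockVars G.branch δ := rfl

variable [Fintype V] [DecidableEq E] [DecidableEq ι]

/-- The legs of a subdiagram seen through a leg `l` of its root part `B`, when the tree propagators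
attached to the legs `X` of `B` have been glued. -/
noncomputable def block (G : ScalarDiagram V E ι) (B : G.Part) (X : Finset G.Label) (l : G.Label) :
    Finset G.Label :=
  if l ∈ G.treeLegs B \ X then {l} else G.branch l

theorem block_of_mem {B : G.Part} {X : Finset G.Label} {l : G.Label} (hl : l ∈ X) :
    G.block B X l = G.branch l := by
  rw [block, if_neg]
  simp [hl]

theorem block_of_notMem {B : G.Part} {X : Finset G.Label} {l : G.Label} (hl : l ∈ G.legs {B})
    (hlX : l ∉ X) : G.block B X l = {l} := by
  rw [block]
  split_ifs with h
  · rfl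
  · rcases l with i | p
    · rfl
    · exact absurd (Finset.mem_sdiff.mpr ⟨mem_treeLegs.mpr ⟨hl, rfl⟩, hlX⟩) h

theorem block_insert {B : G.Part} {X : Finset G.Label} {a l : G.Label} (hla : l ≠ a) :
    G.block B (insert a X) l = G.block B X l := by
  simp [block, hla]

theorem block_treeLegs (B : G.Part) : G.block B (G.treeLegs B) = G.branch := by
  funext l
  simp [block]

/-- The pre-amplitude `M` of the subdiagram `S` with root part `B` is the product of the dressed root
part `H`, a function of the variables between the blocks of legs seen through the legs of `B`, and
of one factor `N b` for every tree leg `b ∈ X` of `B` that has been glued: the gluing integral, over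
the contour through `T b`, of the subdiagram behind `b`. -/
structure Expansion (G : ScalarDiagram V E ι) (loop : G.Part → (Sym2 G.Label → ℂ) → ℂ) (B : G.Part)
    (S : Finset G.Part) (R : Set (Sym2 G.Label → ℝ)) (M : (Sym2 G.Label → ℂ) → ℂ)
    (X : Finset G.Label) (RH : Set (Sym2 G.Label → ℝ)) (H : (Sym2 G.Label → ℂ) → ℂ)
    (N : G.Label → (Sym2 G.Label → ℂ) → ℂ) (T : G.Label → Sym2 G.Label → ℂ) : Prop where
  mem : B ∈ S
  measurable : Measurable M
  grows : ∀ ρ ∈ R, GrowsAlong (G.legs S) ∅ G.labelDim M ρ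
  dressed : G.Dressed loop B X RH H
  blocks : Blocks (G.legs {B}) X (G.legs S) (G.block B X)
  nonempty : ∀ b ∈ X, (pairs (G.branch b)).Nonempty
  reproduces : ∀ b ∈ X, ∀ z, Below (pairs (G.branch b)) (T b) z →
    Reproduces (pairs (G.branch b)) (N b) ((∑ i ∈ G.branch b, G.labelDim i - G.farDim b) / 2) z
  sum_eq : ∀ b ∈ X, ∑ q ∈ pairs (G.branch b), T b q =
    (∑ i ∈ G.branch b, G.labelDim i - G.farDim b) / 2
  below : ∀ ρ ∈ R, ∀ b ∈ X, ∀ q ∈ pairs (G.branch b), (T b q).re < ρ q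
  amp : ∀ δ, IsMellin (G.legs S) ∅ G.labelDim δ → (fun q => (δ q).re) ∈ R →
    (fun q => (blockVars (G.block B X) δ q).re) ∈ RH ∧
      M δ = H (blockVars (G.block B X) δ) * ∏ b ∈ X, N b δ

variable {loop : G.Part → (Sym2 G.Label → ℂ) → ℂ} {B : G.Part} {S : Finset G.Part}
  {R : Set (Sym2 G.Label → ℝ)} {M : (Sym2 G.Label → ℂ) → ℂ} {X : Finset G.Label}
  {RH : Set (Sym2 G.Label → ℝ)} {H : (Sym2 G.Label → ℂ) → ℂ}
  {N : G.Label → (Sym2 G.Label → ℂ) → ℂ} {T : G.Label → Sym2 G.Label → ℂ}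

/-- Legs of the root part that have been glued are no longer legs of the subdiagram. -/
theorem Expansion.notMem (h : G.Expansion loop B S R M X RH H N T) {p : E × Bool}
    (hp : (.inr p : G.Label) ∈ G.legs S) : (.inr p : G.Label) ∉ X := by
  intro hX
  obtain ⟨h1, h2⟩ := h.blocks.blockOf_mem hp
  by_cases hl : blockOf (G.legs {B}) (G.block B X) (.inr p) ∈ X
  · rw [block_of_mem hl] at h2
    simpa using mem_boundary.mp (branch_subset_boundary _ h2)
  · rw [block_of_notMem h1 hl, Finset.mem_singleton] at h2
    exact hl (h2 ▸ hX)

/-- A part that has not been glued to anything is its own expansion. -/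
theorem Expansion.part (hloop : IsMellinFunction (G.legs {B}) (loop B)) (N T) :
    G.Expansion loop B {B}
      {ρ | PolyGrowth (G.legs {B}) G.labelDim (G.partAmp loop B) ρ} (G.partAmp loop B) ∅
      {ρ | PolyGrowth (G.legs {B}) G.labelDim (G.partAmp loop B) ρ} (G.partAmp loop B) N T where
  mem := Finset.mem_singleton_self B
  measurable := (isMellinFunction_partAmp hloop).measurable
  grows _ hρ := hρ
  dressed := .bare
  blocks := by
    have hb : ∀ l ∈ G.legs {B}, G.block B ∅ l = {l} := fun l hl => block_of_notMem hl (by simp)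
    refine ⟨fun l hl l' hl' hne => ?_, ?_, fun l hl _ => hb l hl, Finset.empty_subset _⟩
    · rw [hb l hl, hb l' hl']
      simpa using hne
    · rw [Finset.biUnion_congr rfl hb, Finset.biUnion_singleton_eq_self]
  nonempty := by simp
  reproduces := by simp
  sum_eq := by simp
  below := by simp
  amp δ _ hR := by
    have he : ∀ q ∈ (G.legs {B}).sym2, δ q = blockVars (G.block B ∅) δ q := fun q hq => by
      rw [blockVars_congr (A' := fun l => {l}) (fun l hl => block_of_notMem hl (by simp)) δ q hq]
      induction q using Sym2.ind with
      | _ l l' => simp [blockVars_mk]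
    refine ⟨(Dressed.bare (G := G) (loop := loop) (B := B)).mem_of_eq
      (fun q hq => congrArg Complex.re (he q hq)) hR, ?_⟩
    rw [Finset.prod_empty, mul_one]
    exact (isMellinFunction_partAmp hloop).depends _ _ he

/-- The gluing integral of leg `a` dresses the root part. -/
theorem Expansion.dress (h : G.Expansion loop B S R M X RH H N T)
    (hloop : IsMellinFunction (G.legs {B}) (loop B)) {a : G.Label} (ha : a ∈ G.treeLegs B)
    (haX : a ∉ X) {τ : Sym2 G.Label → ℂ} {q : Sym2 G.Label}
    (hτ : IsContour G.labelDim G.farDim (G.legs S) ∅ a τ q) (hR : (fun p => (τ p).re) ∈ R) :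
    ∃ RH' H', G.Dressed loop B (insert a X) RH' H' ∧
      ∀ δ : Sym2 G.Label → ℂ, (∀ i ∈ (G.legs S).erase a, δ s(i, i) = -G.labelDim i) →
        Below (pairs ((G.legs S).erase a)) τ δ →
        (fun q => (blockVars (G.block B (insert a X)) δ q).re) ∈ RH' ∧
        glueIntegral 0 (G.legs S) ∅ a τ q M δ =
          H' (blockVars (G.block B (insert a X)) δ) * ∏ b ∈ X, N b δ := by
  have haL := treeLegs_subset B ha
  have hb : ∀ b ∈ X, G.block B X b = G.branch b := fun b hb => block_of_mem hb
  have hXne : ∀ b ∈ X, (pairs (G.block B X b)).Nonempty := fun b hbX => by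
    rw [hb b hbX]; exact h.nonempty b hbX
  have hT : ∀ b ∈ X, Below (pairs (G.branch b)) (T b) τ := fun b hbX => h.below _ hR b hbX
  obtain ⟨q₁, hq₁⟩ : (pairs ((G.legs {B}).erase a)).Nonempty := by
    rcases X.eq_empty_or_nonempty with rfl | hX
    · have h1 : G.legs S = G.legs {B} := by
        rw [h.blocks.union, Finset.biUnion_congr rfl fun l hl => h.blocks.single l hl (by simp),
          Finset.biUnion_singleton_eq_self]
      exact ⟨q, h1 ▸ hτ.mem⟩
    · exact h.dressed.exists_pair hX a
  have hHm := h.dressed.isMellinFunction hloop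
  have hc : IsContour G.labelDim G.farDim (G.legs {B}) X a (blockVars (G.block B X) τ) q₁ := by
    refine h.blocks.isContour haL haX hXne hτ (fun b hbX => ?_) hq₁
    rw [hb b hbX, ← h.sum_eq b hbX, Complex.re_sum, Complex.re_sum]
    exact Finset.sum_lt_sum_of_nonempty (h.nonempty b hbX) (hT b hbX)
  have hRH := (h.amp τ hτ.mellin hR).1
  refine ⟨_, _, Dressed.dress a _ q₁ h.dressed ha haX hc hRH fun δ _ hδ =>
    integrable_glueIntegrand hc haX haL h.dressed.subset_legs hHm.measurable
      (h.dressed.growsAlong hloop hRH) hδ, fun δ hdiag hδ => ?_⟩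
  have hbl := h.blocks.below haL haX hXne
    (fun i hi => hτ.mellin.diag i (Finset.mem_of_mem_erase hi) (by simp)) hdiag hδ
  have hvars : ∀ p ∈ indexSet (G.legs {B}) X a, blockVars (G.block B (insert a X)) δ p =
      blockVars (G.block B X) δ p := fun p hp => by
    refine blockVars_congr (L := (G.legs {B}).erase a)
      (fun l hl => block_insert (Finset.mem_erase.mp hl).1) δ p ?_
    rw [indexSet, Finset.mem_union] at hp
    rcases hp with hp | hp
    · exact pairs_subset_sym2 subset_rfl hp
    · obtain ⟨b, hbX, rfl⟩ := Finset.mem_image.mp hp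
      have : b ∈ (G.legs {B}).erase a :=
        Finset.mem_erase.mpr ⟨fun e => haX (e ▸ hbX), h.dressed.subset_legs hbX⟩
      exact Finset.mk_mem_sym2_iff.mpr ⟨this, this⟩
  refine ⟨fun p hp => ?_, ?_⟩
  · show _ < (blockVars (G.block B (insert a X)) δ p).re
    rw [hvars p hp]
    exact hbl p hp
  · rw [glueIntegral_congr haX _ q₁ H hvars]
    refine h.blocks.glueIntegral_eq (Δ' := G.farDim) haL haX hXne (hτ.of_empty 0) hq₁ hHm
      (fun b hbX => ?_) h.measurable (h.grows _ hR) (fun τ' hτ' hre => ?_) hdiag hδ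
    · rw [hb b hbX]
      exact h.reproduces b hbX τ (hT b hbX)
    · refine (h.amp τ' hτ' ?_).2
      simp_rw [hre]
      exact hR

end ScalarDiagram

/-! ### Factorization -/

namespace ScalarDiagram

variable {V E ι : Type} [Fintype V] [Fintype E] [Fintype ι] [DecidableEq E] [DecidableEq ι]
  {G : ScalarDiagram V E ι} {loop : G.Part → (Sym2 G.Label → ℂ) → ℂ}

/-- Gluing a subdiagram without further open tree propagators adds one factor to the expansion around
the root part. -/
theorem Expansion.glue (hG : G.Connected) {B : G.Part}
    {S S' : Finset G.Part} {R : Set (Sym2 G.Label → ℝ)} {M M' : (Sym2 G.Label → ℂ) → ℂ} {X : Finset G.Label}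
    {RH RH' : Set (Sym2 G.Label → ℝ)} {H H' : (Sym2 G.Label → ℂ) → ℂ}
    {N : G.Label → (Sym2 G.Label → ℂ) → ℂ} {T : G.Label → Sym2 G.Label → ℂ}
    (h : G.Expansion loop B S R M X RH H N T) {e : E} {b : Bool} {τ τ' : Sym2 G.Label → ℂ}
    {q q' : Sym2 G.Label} (hM'm : Measurable M')
    (hM'g : GrowsAlong (G.legs S') ∅ G.labelDim M' fun p => (τ' p).re) (hSS' : Disjoint S S')
    (he : G.IsTree e) (hB : G.partOf (G.base (.inr (e, b))) = B)
    (hB' : G.partOf (G.base (.inr (e, !b))) ∈ S')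
    (hcomp : ∀ l ∈ G.legs S', l.isRight → l = .inr (e, !b))
    (hτ : IsContour G.labelDim G.farDim (G.legs S) ∅ (.inr (e, b)) τ q)
    (hτ' : IsContour G.labelDim G.farDim (G.legs S') ∅ (.inr (e, !b)) τ' q')
    (hR : (fun p => (τ p).re) ∈ R) (haX : (.inr (e, b) : G.Label) ∉ X)
    (hH' : G.Dressed loop B (insert (.inr (e, b)) X) RH' H')
    (hdress : ∀ δ : Sym2 G.Label → ℂ,
      (∀ i ∈ (G.legs S).erase (.inr (e, b)), δ s(i, i) = -G.labelDim i) →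
        Below (pairs ((G.legs S).erase (.inr (e, b)))) τ δ →
        (fun q => (blockVars (G.block B (insert (.inr (e, b)) X)) δ q).re) ∈ RH' ∧
        glueIntegral 0 (G.legs S) ∅ (.inr (e, b)) τ q M δ =
          H' (blockVars (G.block B (insert (.inr (e, b)) X)) δ) * ∏ b ∈ X, N b δ) :
    G.Expansion loop B (S ∪ S')
      {ρ | (∀ p ∈ pairs ((G.legs S).erase (.inr (e, b))), (τ p).re < ρ p) ∧
        ∀ p ∈ pairs ((G.legs S').erase (.inr (e, !b))), (τ' p).re < ρ p}
      (Witten.glue (G.legs S) (.inr (e, b)) τ q M (G.legs S') (.inr (e, !b)) τ' q' M')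
      (insert (.inr (e, b)) X) RH' H'
      (Function.update N (.inr (e, b)) (glueIntegral 0 (G.legs S') ∅ (.inr (e, !b)) τ' q' M'))
      (Function.update T (.inr (e, b)) τ') := by
  set a : G.Label := .inr (e, b) with ha
  set a' : G.Label := .inr (e, !b) with ha'
  have hBS' : G.partOf (G.base a) ∉ S' := fun h' =>
    Finset.disjoint_left.mp hSS' (by rw [hB]; exact h.mem) h'
  have hbranch : G.branch a = (G.legs S').erase a' := branch_eq_erase hG hBS' hB' hcomp
  have hlegs : G.legs (S ∪ S') = (G.legs S).erase a ∪ (G.legs S').erase a' :=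
    legs_union hSS' he (hB ▸ h.mem) hB' hcomp
  have haT : a ∈ G.treeLegs B := mem_treeLegs_inr.mpr ⟨hB, he⟩
  have haS : a ∈ G.legs S := mem_legs_inr.mpr ⟨hB ▸ h.mem, he, fun h' =>
    Finset.disjoint_left.mp hSS' h' hB'⟩
  have ha'S : a' ∈ G.legs S' := mem_legs_inr.mpr ⟨hB', he, by rw [Bool.not_not]; exact hBS'⟩
  have hXa : ∀ b ∈ X, b ≠ a := fun b hb e => haX (e ▸ hb)
  have hXs : ∀ b ∈ X, G.branch b ⊆ (G.legs S).erase a := fun b hb => by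
    rw [← block_of_mem (B := B) hb]
    exact h.blocks.subset_erase (treeLegs_subset B haT) haX (h.dressed.subset_legs hb) (hXa b hb)
  have hdisj : Disjoint ((G.legs S).erase a) ((G.legs S').erase a') :=
    Finset.disjoint_of_subset_left (Finset.erase_subset _ _)
      (Finset.disjoint_of_subset_right (Finset.erase_subset _ _) (disjoint_legs hSS'))
  have hfar : G.labelDim a' = G.farDim a := farDim_inr e b
  refine
    { mem := Finset.mem_union_left _ h.mem
      measurable := (measurable_glueIntegral (by simp) hτ.mem_indexSet h.measurable).mul
        (measurable_glueIntegral (by simp) hτ'.mem_indexSet hM'm)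
      grows := fun ρ hρ => ?_
      dressed := hH'
      blocks := ?_
      nonempty := fun c hc => ?_
      reproduces := fun c hc z hz => ?_
      sum_eq := fun c hc => ?_
      below := fun ρ hρ c hc p hp => ?_
      amp := fun δ hδ hδR => ?_ }
  · refine GrowsAlong.mul
      (GrowsAlong.glueIntegral (hτ.of_empty 0) (by simp) haS (by simp) h.measurable (h.grows _ hR)
        (by rw [indexSet_empty]; exact hρ.1) ?_)
      (GrowsAlong.glueIntegral (hτ'.of_empty 0) (by simp) ha'S (by simp) hM'm hM'g
        (by rw [indexSet_empty]; exact hρ.2) ?_)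
    · rw [indexSet_empty, hlegs]
      exact pairs_subset_sym2 Finset.subset_union_left
    · rw [indexSet_empty, hlegs]
      exact pairs_subset_sym2 Finset.subset_union_right
  · rw [hlegs]
    exact h.blocks.insert (treeLegs_subset B haT) haX (fun l _ hla => block_insert hla)
      ((block_of_mem (Finset.mem_insert_self a X)).trans hbranch) hdisj
  · rcases Finset.mem_insert.mp hc with rfl | hc
    · rw [hbranch]
      exact ⟨q', hτ'.mem⟩
    · exact h.nonempty c hc
  · rcases Finset.mem_insert.mp hc with rfl | hc
    · rw [Function.update_self] at hz ⊢
      have h1 := reproduces_glueIntegral (hτ'.of_empty 0) ha'S hM'm hM'g (z := z)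
        (by rw [← hbranch]; exact hz)
      rw [hτ'.two_mul_sum_pairs ha'S, ← hbranch, hfar] at h1
      exact h1
    · rw [Function.update_of_ne (hXa c hc)] at hz ⊢
      exact h.reproduces c hc z hz
  · rcases Finset.mem_insert.mp hc with rfl | hc
    · rw [Function.update_self, hbranch, hτ'.two_mul_sum_pairs ha'S, hfar]
    · rw [Function.update_of_ne (hXa c hc)]
      exact h.sum_eq c hc
  · rcases Finset.mem_insert.mp hc with rfl | hc
    · rw [Function.update_self]
      exact hρ.2 p (hbranch ▸ hp)
    · rw [Function.update_of_ne (hXa c hc)]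
      exact (h.below _ hR c hc p hp).trans (hρ.1 p (pairs_mono (hXs c hc) hp))
  · obtain ⟨h1, h2⟩ := hdress δ (fun i hi => hδ.diag i (by
      rw [hlegs]; exact Finset.mem_union_left _ hi) (by simp)) hδR.1
    refine ⟨h1, ?_⟩
    rw [Witten.glue, h2, Finset.prod_insert haX, Function.update_self, mul_right_comm, mul_assoc]
    congr 2
    exact Finset.prod_congr rfl fun c hc => by rw [Function.update_of_ne (hXa c hc)]

/-- The factors `N b` of an expansion are products of factors of the parts other than the root, which
are functions of their local variables. -/
def FarFactors (G : ScalarDiagram V E ι) (loop : G.Part → (Sym2 G.Label → ℂ) → ℂ) (B : G.Part)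
    (S : Finset G.Part) (X : Finset G.Label) (N : G.Label → (Sym2 G.Label → ℂ) → ℂ)
    (T : G.Label → Sym2 G.Label → ℂ) (RP : G.Part → Set (Sym2 G.Label → ℝ))
    (HP : G.Part → (Sym2 G.Label → ℂ) → ℂ) : Prop :=
  (∀ P ∈ S, P ≠ B → G.Dressed loop P (G.treeLegs P) (RP P) (HP P)) ∧
    ∀ δ, IsMellin G.boundary ∅ G.labelDim δ → (∀ b ∈ X, Below (pairs (G.branch b)) (T b) δ) →
      (∀ P ∈ S, P ≠ B → IsMellin (G.legs {P}) (G.treeLegs P) G.labelDim (G.localVars δ) ∧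
        (fun q => (G.localVars δ q).re) ∈ RP P) ∧
      ∏ b ∈ X, N b δ = ∏ P ∈ S.erase B, HP P (G.localVars δ)

/-- Every pre-amplitude has an expansion around its root part.  In the induction step the new factor, the
gluing integral of the attached subdiagram, is expanded in turn around the root part of that
subdiagram. -/
theorem PreAmp.exists_expansion (hG : G.Connected)
    (hloop : ∀ B, IsMellinFunction (G.legs {B}) (loop B)) {B : G.Part} {S : Finset G.Part}
    {R : Set (Sym2 G.Label → ℝ)} {M : (Sym2 G.Label → ℂ) → ℂ} (h : G.PreAmp loop B S R M) :
    ∃ X RH H N T RP HP, G.Expansion loop B S R M X RH H N T ∧ G.FarFactors loop B S X N T RP HP := by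
  induction h with
  | part B =>
    refine ⟨_, _, _, fun _ _ => 0, fun _ _ => 0, fun _ => ∅, fun _ _ => 0,
      Expansion.part (hloop B) _ _, fun P hP hne => absurd (Finset.mem_singleton.mp hP) hne,
      fun δ _ _ => ⟨fun P hP hne => absurd (Finset.mem_singleton.mp hP) hne, ?_⟩⟩
    simp
  | @glue B B' S S' R R' M M' e b τ τ' q q' _ _ hSS' he hB hB' hcomp hτ hτ' hR hR' ih ih' =>
    obtain ⟨X, RH, H, N, T, RP, HP, hx, hf⟩ := ih
    obtain ⟨X', RH', H', N', T', RP', HP', hx', hf'⟩ := ih'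
    have hBS' : B ∉ S' := Finset.disjoint_left.mp hSS' hx.mem
    have hB'S : B' ∉ S := Finset.disjoint_right.mp hSS' hx'.mem
    set a : G.Label := .inr (e, b) with ha
    set a' : G.Label := .inr (e, !b) with ha'
    have haT : a ∈ G.treeLegs B := mem_treeLegs_inr.mpr ⟨hB, he⟩
    have ha'T : a' ∈ G.treeLegs B' := mem_treeLegs_inr.mpr ⟨hB', he⟩
    have haS : a ∈ G.legs S := mem_legs_inr.mpr ⟨hB ▸ hx.mem, he, hB' ▸ hB'S⟩
    have ha'S : a' ∈ G.legs S' := mem_legs_inr.mpr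
      ⟨hB' ▸ hx'.mem, he, by rw [Bool.not_not, hB]; exact hBS'⟩
    have haX : a ∉ X := hx.notMem haS
    have haX' : a' ∉ X' := hx'.notMem ha'S
    obtain ⟨RHn, Hn, hHn, hdress⟩ := hx.dress (hloop B) haT haX hτ hR
    obtain ⟨RHn', Hn', hHn', hdress'⟩ := hx'.dress (hloop B') ha'T haX' hτ' hR'
    -- all tree legs of the root part of the glued subdiagram are now dressed
    have hX' : insert a' X' = G.treeLegs B' := by
      refine Finset.Subset.antisymm hHn'.subset fun l hl => ?_
      by_contra hlX
      rw [Finset.mem_insert, not_or] at hlX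
      exact hlX.1 (hcomp l (hx'.blocks.mem (treeLegs_subset B' hl) hlX.2) (mem_treeLegs.mp hl).2)
    have hbranch : G.branch a = (G.legs S').erase a' :=
      branch_eq_erase hG (hB ▸ hBS') (hB' ▸ hx'.mem) hcomp
    have hlocal : ∀ δ : Sym2 G.Label → ℂ,
        blockVars (G.block B' (insert a' X')) δ = G.localVars δ := fun δ => by
      rw [hX', block_treeLegs, localVars_eq]
    have hblocks : Blocks (G.legs {B'}) (G.treeLegs B') G.boundary G.branch := by
      have h1 := hx'.blocks.insert (A' := G.branch) (C := G.branch a') (treeLegs_subset B' ha'T) haX'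
        (fun l hl hla => by
          by_cases hlX : l ∈ X'
          · exact (block_of_mem hlX).symm
          · rw [block_of_notMem hl hlX]
            rcases l with i | p
            · rfl
            · exact absurd (hcomp _ (hx'.blocks.mem hl hlX) rfl) hla) rfl
        (by rw [← hbranch]; exact hG.disjoint_branch e b)
      rw [hX', ← hbranch, he.branch_union b] at h1
      exact h1
    refine ⟨insert a X, RHn, Hn, _, _, fun P => if P = B' then RHn' else if P ∈ S' then RP' P else RP P,
      fun P => if P = B' then Hn' else if P ∈ S' then HP' P else HP P,
      hx.glue hG hx'.measurable (hx'.grows _ hR') hSS' he hB (hB' ▸ hx'.mem) hcomp hτ hτ' hR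
        haX hHn hdress, fun P hP hne => ?_, fun δ hδ hbelow => ?_⟩
    · by_cases hPB : P = B'
      · subst hPB
        simp only [if_true]
        exact hX' ▸ hHn'
      · simp only [if_neg hPB]
        by_cases hPS : P ∈ S'
        · simp only [if_pos hPS]
          exact hf'.1 P hPS hPB
        · simp only [if_neg hPS]
          exact hf.1 P ((Finset.mem_union.mp hP).resolve_right hPS) hne
    · have hXa : ∀ c ∈ X, c ≠ a := fun c hc e => haX (e ▸ hc)
      have hτ'δ : Below (pairs ((G.legs S').erase a')) τ' δ := by
        have := hbelow a (Finset.mem_insert_self a X)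
        rwa [Function.update_self, hbranch] at this
      obtain ⟨h1, h2⟩ := hf.2 δ hδ fun c hc => by
        have := hbelow c (Finset.mem_insert_of_mem hc)
        rwa [Function.update_of_ne (hXa c hc)] at this
      obtain ⟨h1', h2'⟩ := hf'.2 δ hδ fun c hc p hp => by
        refine (hx'.below _ hR' c hc p hp).trans (hτ'δ p (pairs_mono ?_ hp))
        rw [← block_of_mem (B := B') hc]
        exact hx'.blocks.subset_erase (treeLegs_subset B' ha'T) haX' (hx'.dressed.subset_legs hc)
          fun e => haX' (e ▸ hc)
      obtain ⟨h3, h4⟩ := hdress' δ (fun i hi => hδ.diag i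
        (branch_subset_boundary a (hbranch ▸ hi)) (by simp)) hτ'δ
      rw [hlocal] at h4
      simp_rw [hlocal] at h3
      refine ⟨fun P hP hne => ?_, ?_⟩
      · by_cases hPB : P = B'
        · subst hPB
          simp only [if_true]
          exact ⟨hblocks.isMellin hδ, h3⟩
        · simp only [if_neg hPB]
          by_cases hPS : P ∈ S'
          · simp only [if_pos hPS]
            exact h1' P hPS hPB
          · simp only [if_neg hPS]
            exact h1 P ((Finset.mem_union.mp hP).resolve_right hPS) hne
      · have h5 : ∏ c ∈ X, Function.update N a (glueIntegral 0 (G.legs S') ∅ a' τ' q' M') c δ =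
            ∏ P ∈ S.erase B, HP P (G.localVars δ) := by
          rw [← h2]
          exact Finset.prod_congr rfl fun c hc => by rw [Function.update_of_ne (hXa c hc)]
        rw [Finset.prod_insert haX, Function.update_self, h4, h2', h5, Finset.erase_union_distrib,
          Finset.erase_eq_of_notMem hBS', Finset.prod_union (Finset.disjoint_of_subset_left
            (Finset.erase_subset _ _) hSS'), mul_comm, ← Finset.mul_prod_erase S' _ hx'.mem]
        simp only [if_true]
        congr 1
        · refine Finset.prod_congr rfl fun P hP => ?_
          have hPS := Finset.mem_of_mem_erase hP
          rw [if_neg fun e : P = B' => hB'S (e ▸ hPS), if_neg (Finset.disjoint_left.mp hSS' hPS)]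
        · congr 1
          refine Finset.prod_congr rfl fun P hP => ?_
          obtain ⟨h6, h7⟩ := Finset.mem_erase.mp hP
          rw [if_neg h6, if_pos h7]

/-- The Gamma functions stripped off the parts are those of the propagators: every tree propagator
has two ends, which see complementary sets of boundary points and hence the same Mandelstam
variable. -/
theorem prod_propagatorFactor (hG : G.Connected) {δ : Sym2 G.Label → ℂ}
    (hδ : IsMellin G.boundary ∅ G.labelDim δ) :
    ∏ e ∈ G.treeEdges, G.propagatorFactor δ e =
      ∏ B, ∏ l ∈ G.treeLegs B, Complex.Gamma ((G.labelDim l + G.localVars δ s(l, l)) / 2) := by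
  classical
  set f : G.Label → ℂ := fun l => Complex.Gamma ((G.labelDim l + G.localVars δ s(l, l)) / 2) with hf
  have hB : ∀ B, G.treeLegs B = ((G.treeEdges ×ˢ Finset.univ).map Function.Embedding.inr).filter
      fun l : G.Label => G.partOf (G.base l) = B := fun B => by
    ext l
    rcases l with i | ⟨e, b⟩
    · simp [mem_treeLegs]
    · simp [mem_treeLegs_inr, treeEdges, and_comm]
  simp_rw [hB]
  rw [Finset.prod_fiberwise, Finset.prod_map, Finset.prod_product]
  refine Finset.prod_congr rfl fun e he => ?_
  have het : G.IsTree e := (Finset.mem_filter.mp he).2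
  have hm : mandelstam (G.branch (.inr (e, true))) δ = mandelstam (G.branch (.inr (e, false))) δ :=
    (hδ.mandelstam_compl (hG.disjoint_branch e false) (het.branch_union false)).symm
  rw [Fintype.prod_bool, propagatorFactor]
  simp only [hf, Function.Embedding.inr_apply, localVars_eq, blockVars_diag, hm, labelDim]
  simp only [← sub_eq_add_neg]

/-- In the expansion of the whole diagram all tree legs of the root part have been glued, so that the
blocks are the sets of boundary points seen through its legs. -/
theorem factorization (hG : G.Connected)
    (hloop : ∀ B, IsMellinFunction (G.legs {B}) (loop B)) {B₀ : G.Part}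
    {R : Set (Sym2 G.Label → ℝ)} {M : (Sym2 G.Label → ℂ) → ℂ}
    (hM : G.PreAmp loop B₀ Finset.univ R M) :
    ∃ (RH : G.Part → Set (Sym2 G.Label → ℝ)) (H : G.Part → (Sym2 G.Label → ℂ) → ℂ),
      (∀ B, G.Dressed loop B (G.treeLegs B) (RH B) (H B)) ∧
      ∀ δ, IsMellin G.boundary ∅ G.labelDim δ → (fun q => (δ q).re) ∈ R →
        (∀ B, (fun q => (G.localVars δ q).re) ∈ RH B) ∧
        M δ = (∏ e ∈ G.treeEdges, G.propagatorFactor δ e) *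
          ∏ B, G.partFactor B (H B) (G.localVars δ) := by
  obtain ⟨X, RH, H, N, T, RP, HP, hx, hf⟩ := hM.exists_expansion hG hloop
  have hlegs : G.legs Finset.univ = G.boundary := by
    ext l
    rw [mem_boundary]
    rcases l with i | ⟨e, b⟩
    · simp [mem_legs_inl]
    · simp [mem_legs_inr]
  have hX : X = G.treeLegs B₀ := by
    refine Finset.Subset.antisymm hx.dressed.subset fun l hl => ?_
    by_contra hlX
    have h1 := hx.blocks.mem (treeLegs_subset B₀ hl) hlX
    rw [hlegs, mem_boundary] at h1
    have h2 := (mem_treeLegs.mp hl).2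
    rw [← Sum.not_isRight] at h1
    simp [h2] at h1
  have hlocal : ∀ δ : Sym2 G.Label → ℂ, blockVars (G.block B₀ X) δ = G.localVars δ := fun δ => by
    rw [hX, block_treeLegs, localVars_eq]
  refine ⟨fun P => if P = B₀ then RH else RP P, fun P => if P = B₀ then H else HP P, fun P => ?_,
    fun δ hδ hδR => ?_⟩
  · by_cases hP : P = B₀
    · subst hP
      simp only [if_true]
      exact hX ▸ hx.dressed
    · simp only [if_neg hP]
      exact hf.1 P (Finset.mem_univ P) hP
  · obtain ⟨h1, h2⟩ := hx.amp δ (by rwa [hlegs]) hδR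
    obtain ⟨h3, h4⟩ := hf.2 δ hδ fun c hc p hp => hx.below _ hδR c hc p hp
    rw [hlocal] at h2
    simp_rw [hlocal] at h1
    have hmem : ∀ P, IsMellin (G.legs {P}) (G.treeLegs P) G.labelDim (G.localVars δ) ∧
        (fun q => (G.localVars δ q).re) ∈ (if P = B₀ then RH else RP P) := fun P => by
      by_cases hP : P = B₀
      · subst hP
        rw [if_pos rfl]
        refine ⟨?_, h1⟩
        have h5 := hx.blocks.isMellin (δ := δ) (Δ := G.labelDim) (by rwa [hlegs])
        rwa [hlocal, hX] at h5
      · rw [if_neg hP]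
        exact h3 P (Finset.mem_univ P) hP
    refine ⟨fun P => (hmem P).2, ?_⟩
    have hΓ : ∀ P, ∏ l ∈ G.treeLegs P,
        Complex.Gamma ((G.labelDim l + G.localVars δ s(l, l)) / 2) ≠ 0 := fun P => by
      refine Finset.prod_ne_zero_iff.mpr fun l hl => Complex.Gamma_ne_zero_of_re_pos ?_
      have hD : G.Dressed loop P (G.treeLegs P) (if P = B₀ then RH else RP P)
          (if P = B₀ then H else HP P) := by
        by_cases hP : P = B₀
        · subst hP
          simp only [if_true]
          exact hX ▸ hx.dressed
        · simp only [if_neg hP]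
          exact hf.1 P (Finset.mem_univ P) hP
      have := hD.re_pos (hmem P).1 (hmem P).2 l hl
      rw [Complex.div_ofNat_re]
      linarith
    rw [prod_propagatorFactor hG hδ, ← Finset.prod_mul_distrib, h2, h4,
      ← Finset.mul_prod_erase Finset.univ _ (Finset.mem_univ B₀)]
    have hP : ∀ (P : G.Part) (F : (Sym2 G.Label → ℂ) → ℂ), (∏ l ∈ G.treeLegs P,
        Complex.Gamma ((G.labelDim l + G.localVars δ s(l, l)) / 2)) *
        G.partFactor P F (G.localVars δ) = F (G.localVars δ) := fun P F => by
      rw [partFactor, mul_div_cancel₀ _ (hΓ P)]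
    simp_rw [hP, if_true]
    congr 1
    exact Finset.prod_congr rfl fun P hP => by rw [if_neg (Finset.mem_erase.mp hP).1]

end ScalarDiagram

end Witten

open Witten MeasureTheory in
theorem mainTheorem3 :
    -- insertion onto an end vertex
    (∀ (Λ : Type) [Fintype Λ] [DecidableEq Λ] (h c₀ c₁ : ℂ) (Δ : Λ → ℂ)
      (A₁ E₀ E₁ : Finset Λ) (k₁ l₁ k₀ l₀ : Λ),
      Disjoint A₁ E₀ → Disjoint A₁ E₁ → Disjoint E₀ E₁ →
      [k₁, l₁, k₀, l₀].Nodup → (∀ k ∈ [k₁, l₁, k₀, l₀], k ∉ A₁ ∪ E₀ ∪ E₁) →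
      Δ k₁ = h - c₁ → Δ l₁ = h + c₁ → Δ k₀ = h - c₀ → Δ l₀ = h + c₀ →
      ∀ (M' : (Sym2 Λ → ℂ) → ℂ) (σ ν τ ν' : Sym2 Λ → ℂ) (q₁ p₁ q₀ p₀ : Sym2 Λ),
      IsMellinFunction (insert k₁ A₁) M' →
      PolyGrowth (insert k₁ A₁) Δ M' (fun q => (σ q).re) →
      IsContour Δ 0 (insert k₁ A₁) ∅ k₁ σ q₁ →
      IsContour Δ 0 (insert l₁ (insert k₀ E₀)) ∅ l₁ ν p₁ →
      IsContour Δ 0 (A₁ ∪ insert k₀ E₀) ∅ k₀ τ q₀ →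
      IsContour Δ 0 (insert l₀ E₁) ∅ l₀ ν' p₀ →
      Below (pairs A₁) σ τ → Below (pairs (insert k₀ E₀)) ν τ →
      let M₀ := insertVertex h Δ (insert k₁ A₁) k₁ σ q₁ M' (insert l₁ (insert k₀ E₀)) l₁ ν p₁
      let M := insertVertex h Δ (A₁ ∪ insert k₀ E₀) k₀ τ q₀ M₀ (insert l₀ E₁) l₀ ν' p₀
      let D₀ := ∑ i ∈ E₀, Δ i
      let D₁ := ∑ i ∈ E₁, Δ i
      let M₀s : (Sym2 Λ → ℂ) → ℂ := fun δ =>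
        kernelTwo h c₁ (D₀ + (h - c₀)) (mandelstam A₁ δ) *
          glueIntegral 0 (insert k₁ A₁) ∅ k₁ σ q₁ M' δ
      (∀ δ, IsMellin (A₁ ∪ insert k₀ E₀) ∅ Δ δ →
        Below (pairs A₁) σ δ → Below (pairs (insert k₀ E₀)) ν δ →
        Integrable (glueIntegrand 0 (insert k₁ A₁) ∅ k₁ σ q₁ M' δ) ∧ M₀ δ = M₀s δ) ∧
      (∀ δ, IsMellin (A₁ ∪ E₀ ∪ E₁) ∅ Δ δ →
        Below (pairs (A₁ ∪ E₀)) τ δ → Below (pairs E₁) ν' δ →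
        Integrable (glueIntegrand 0 (A₁ ∪ insert k₀ E₀) ∅ k₀ τ q₀ M₀ δ) ∧
        Integrable (fun y : ℝ => localIntegrand h c₀ c₁ D₀ D₁ (mandelstam (A₁ ∪ E₀) δ)
          (mandelstam A₁ δ) ((mandelstam A₁ τ).re + y * Complex.I)) ∧
        M δ = M₀s δ * localFactor h c₀ c₁ D₀ D₁ (mandelstam (A₁ ∪ E₀) δ) (mandelstam A₁ δ)
          (mandelstam A₁ τ).re)) ∧
    -- insertion onto a vertex that glues several components
    (∀ (Λ κ : Type) [Fintype Λ] [DecidableEq Λ] [Fintype κ] (h c₀ : ℂ) (c : κ → ℂ) (Δ : Λ → ℂ)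
      (A : κ → Finset Λ) (E₀ E₁ : Finset Λ) (k : κ → Λ) (k₀ l₀ : Λ),
      Pairwise (fun a b => Disjoint (A a) (A b)) →
      (∀ a, Disjoint (A a) E₀) → (∀ a, Disjoint (A a) E₁) → Disjoint E₀ E₁ →
      (∀ a, k a ∉ A a) → k₀ ≠ l₀ →
      k₀ ∉ Finset.univ.biUnion A ∪ E₀ ∪ E₁ → l₀ ∉ Finset.univ.biUnion A ∪ E₀ ∪ E₁ →
      2 ≤ Fintype.card κ + E₀.card →
      (∀ a, Δ (k a) = h - c a) → Δ k₀ = h - c₀ → Δ l₀ = h + c₀ →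
      ∀ (M' : κ → (Sym2 Λ → ℂ) → ℂ) (σ : κ → Sym2 Λ → ℂ) (q : κ → Sym2 Λ)
        (τ ν' : Sym2 Λ → ℂ) (q₀ p₀ : Sym2 Λ) (ω : κ → ℝ),
      (∀ a, IsMellinFunction (insert (k a) (A a)) (M' a)) →
      (∀ a, PolyGrowth (insert (k a) (A a)) Δ (M' a) (fun p => (σ a p).re)) →
      (∀ a, IsContour Δ 0 (insert (k a) (A a)) ∅ (k a) (σ a) (q a)) →
      IsContour Δ 0 (Finset.univ.biUnion A ∪ insert k₀ E₀) ∅ k₀ τ q₀ →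
      IsContour Δ 0 (insert l₀ E₁) ∅ l₀ ν' p₀ →
      (∀ a, Below (pairs (A a)) (σ a) τ) →
      let D₀ := ∑ i ∈ E₀, Δ i
      let D₁ := ∑ i ∈ E₁, Δ i
      (∀ a, ω a < 0 ∧ ω a < (-c a).re ∧ 0 < ((h + c a - mandelstam (A a) τ) / 2).re + ω a) →
      0 < ((D₀ + (h - c₀) + ((Fintype.card κ : ℂ) - 2) * h + ∑ a, c a) / 2).re + ∑ a, ω a →
      let M₀ := forestGlue h c (D₀ + (h - c₀)) ω A k σ q M'
      let M := insertVertex h Δ (Finset.univ.biUnion A ∪ insert k₀ E₀) k₀ τ q₀ M₀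
        (insert l₀ E₁) l₀ ν' p₀
      ∀ δ, IsMellin (Finset.univ.biUnion A ∪ E₀ ∪ E₁) ∅ Δ δ →
        Below (pairs (Finset.univ.biUnion A ∪ E₀)) τ δ → Below (pairs E₁) ν' δ →
        let s : κ → ℂ := fun a => mandelstam (A a) δ
        let X := forestLocalFactor h c₀ c D₀ D₁ (mandelstam (Finset.univ.biUnion A ∪ E₀) δ) ω s
          (fun a => (mandelstam (A a) τ).re)
        Integrable (glueIntegrand 0 (Finset.univ.biUnion A ∪ insert k₀ E₀) ∅ k₀ τ q₀ M₀ δ) ∧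
        Integrable (fun y : κ → ℝ => forestLocalIntegrand h c₀ c D₀ D₁
          (mandelstam (Finset.univ.biUnion A ∪ E₀) δ) ω s
          (fun a => (mandelstam (A a) τ).re + y a * Complex.I)) ∧
        M δ = (∏ a, glueIntegral 0 (insert (k a) (A a)) ∅ (k a) (σ a) (q a) (M' a) δ) * X ∧
        (forestKernel h c (D₀ + (h - c₀)) ω s ≠ 0 →
          M δ = M₀ δ * (X / forestKernel h c (D₀ + (h - c₀)) ω s))) ∧
    -- factorization of the pre-amplitude of an arbitrary diagram
    (∀ (V E ι : Type) [Fintype V] [Fintype E] [Fintype ι] [DecidableEq E] [DecidableEq ι]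
      (G : ScalarDiagram V E ι) (loop : G.Part → (Sym2 G.Label → ℂ) → ℂ),
      G.Connected → (∀ B, IsMellinFunction (G.legs {B}) (loop B)) →
      ∀ (B₀ : G.Part) (R : Set (Sym2 G.Label → ℝ)) (M : (Sym2 G.Label → ℂ) → ℂ),
      G.PreAmp loop B₀ Finset.univ R M →
      ∃ (RH : G.Part → Set (Sym2 G.Label → ℝ)) (H : G.Part → (Sym2 G.Label → ℂ) → ℂ),
        (∀ B, G.Dressed loop B (G.treeLegs B) (RH B) (H B)) ∧
        ∀ δ, IsMellin G.boundary ∅ G.labelDim δ → (fun q => (δ q).re) ∈ R →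
          (∀ B, (fun q => (G.localVars δ q).re) ∈ RH B) ∧
          M δ = (∏ e ∈ G.treeEdges, G.propagatorFactor δ e) *
            ∏ B, G.partFactor B (H B) (G.localVars δ)) := by
  refine ⟨?_, ?_, ?_⟩
  · intro Λ _ _ h c₀ c₁ Δ A₁ E₀ E₁ k₁ l₁ k₀ l₀ h1 h2 h3 h4 h5 h6 h7 h8 h9 M' σ ν τ ν' q₁ p₁ q₀ p₀
      h10 h11 h12 h13 h14 h15 h16 h17
    exact insertion_onto_end_vertex h1 h2 h3 h4 h5 h6 h7 h8 h9 h10 h11 h12 h13 h14 h15 h16 h17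
  · intro Λ κ _ _ _ h c₀ c Δ A E₀ E₁ k k₀ l₀ h1 h2 h3 h4 h5 _ h6 h7 h8 h9 h10 h11 M' σ q τ ν' q₀ p₀
      ω h12 h13 h14 h15 h16 h17 D₀ D₁ h18 h19 M₀ M δ h20 h21 h22 s X
    obtain ⟨e1, e2, e3⟩ := insertion_onto_components h1 h2 h3 h4 h5 h6 h7 h8 h9 h10 h11 h12 h13
      h14 h15 h16 h17 h18 h19 h20 h21 h22
    refine ⟨e1, e2, e3, fun hK => ?_⟩
    have h23 : M₀ δ = forestKernel h c (D₀ + (h - c₀)) ω s *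
        ∏ a, glueIntegral 0 (insert (k a) (A a)) ∅ (k a) (σ a) (q a) (M' a) δ := rfl
    rw [h23, mul_right_comm, mul_div_cancel₀ _ hK, mul_comm]
    exact e3
  · intro V E ι _ _ _ _ _ G loop hG hloop B₀ R M hM
    exact G.factorization hG hloop hM
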